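/- **Definitions.** Graphs are finite, loopless, have labelled vertices and edges, and may have parallel edges. An *embedding* of a connected graph is an embedding in the sphere, described combinatorially by a rotation system of genus $0$, up to reorientation (reversing all rotations); an embedding of a graph *induces* an embedding of each connected subgraph by deletion. Let $A$ be a set of edge labels, called *strict*. An isomorphism is *$A$-fixing* if it changes the label of no strict edge and sends no other edge to a strict edge. A graph $H$ is a *hybrid subgraph* of $G$ if some subgraph of $G$ has an $A$-fixing isomorphism to $H$. A *hybrid deletion sequence* is a sequence $\mathcal G=(G_1,\dots,G_n)$, $n\ge 1$, with a set $A$ of strict labels, such that for each $i<n$ one of $G_i,G_{i+1}$ is a hybrid subgraph of the other; its *weak* edges are its edges that are not strict. A *simultaneous embedding* of $\mathcal G$ is a choice of embeddings $\phi_i$ of the $G_i$ such that, for each $i<n$, if $G_i$ is a hybrid subgraph of $G_{i+1}$, then $\phi_i$ is, up to an $A$-fixing isomorphism, the embedding induced by $\phi_{i+1}$ on some subgraph of $G_{i+1}$, and otherwise the same holds with $i$ and $i+1$ exchanged. The *planet* of equator $m$ is a wheel with rim vertices (its *surface*) $s_1,\dots,s_{4m}$; the *foundation* of $i\in[m]$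 is $\{s_{4i-3},\dots,s_{4i}\}$. For $I\subseteq[m]$ the *village* $V(m,I)$ arises from the planet by adding for each $i\in I$ a house, i.e. a path $v_1\dots v_7$ with the leaves of a claw glued to $v_2,v_4,v_6$, where $v_1$ is identified with $s_{4i-3}$ and $v_7$ with $s_{4i-1}$. A *housing sequence* with index set $I$ on a given labelled planet $P$ of equator $m$ is a hybrid deletion sequence of $2$-connected graphs such that: $P$ is a subgraph of every graph of the sequence; in every graph each vertex other than the centre of $P$ has strictly smaller degree than the centre; the first and the last graph are isomorphic to $V(m,I)$ by isomorphisms that map the planet of $V(m,I)$ to $P$; and in every simultaneous embedding the first and the last graph have, via these isomorphisms, the same embedding. An *arch* of it is a pair $\{i,j\}$ of distinct elements of $I$ such that some graph of the sequence has a path between the foundations of $i$ and $j$ that avoids all other vertices of $P$. Two pairs $\{a,b\},\{c,d\}\subseteq[m]$ *cross* if they alternate in the cyclic order of $[m]$. Graphs $G$ and $H$ are *unifiable* if for every embedding $\sigma$ of $G$ and every embedding $\pi$ of $H$ there is a unique embedding of $G\cup H$ that induces $\sigma$ and $\pi$. Hybrid deletion sequences $(G_1,\dots,G_n)$ and $(H_1,\dots,H_n)$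 are *unifiable* if $G_k$ and $H_k$ are unifiable for every $k$ and no edge is weak in both sequences. **Lemma.** Let $\mathcal G=(G_1,\dots,G_n)$ and $\mathcal H=(H_1,\dots,H_n)$ be housing sequences of the same length on the same labelled planet $P$ of equator $m$, with disjoint index sets $I$ and $J$ and disjoint sets of weak edges. Suppose that for every $k$ the graphs $G_k$ and $H_k$ have exactly the vertices and edges of $P$ in common, and that in the graphs of $\mathcal G$ (respectively $\mathcal H$) every surface vertex incident with an edge outside $P$ lies in the foundation of some $i\in I$ (respectively $i\in J$). If no arch of $\mathcal G$ crosses an arch of $\mathcal H$, then $\mathcal G$ and $\mathcal H$ are unifiable. -/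

import Mathlib

open Set

namespace Housing

universe u v u' v'

/-! ### Finite loopless multigraphs with labelled vertices and edges -/

/-- The union `(V(G) ∪ V(H), E(G) ∪ E(H))` of two labelled graphs. (Should an edge label have
different ends in `G` and in `H`, then the ends in `G` are kept; for compatible graphs this does
not occur.) -/
def union {α : Type u} {β : Type v} (G H : Graph α β) : Graph α β where
  vertexSet := G.vertexSet ∪ H.vertexSet
  edgeSet := G.edgeSet ∪ H.edgeSet
  IsLink e x y := G.IsLink e x y ∨ (e ∉ G.edgeSet ∧ H.IsLink e x y)
  isLink_symm := by
    refine fun e _ => ⟨fun x y h => ?_⟩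
    exact h.imp (fun h => h.symm) (fun h => ⟨h.1, h.2.symm⟩)
  eq_or_eq_of_isLink_of_isLink := by
    rintro e x y z w (h | h) (h' | h')
    · exact h.left_eq_or_eq h'
    · exact absurd h.edge_mem h'.1
    · exact absurd h'.edge_mem h.1
    · exact h.2.left_eq_or_eq h'.2
  edge_mem_iff_exists_isLink := by
    intro e
    constructor
    · intro h
      by_cases hG : e ∈ G.edgeSet
      · obtain ⟨x, y, hxy⟩ := Graph.exists_isLink_of_mem_edgeSet hG
        exact ⟨x, y, Or.inl hxy⟩
      · obtain ⟨x, y, hxy⟩ := Graph.exists_isLink_of_mem_edgeSet (h.resolve_left hG)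
        exact ⟨x, y, Or.inr ⟨hG, hxy⟩⟩
    · rintro ⟨x, y, h | h⟩
      · exact Or.inl h.edge_mem
      · exact Or.inr h.2.edge_mem
  left_mem_of_isLink := by
    rintro e x y (h | h)
    · exact Or.inl h.left_mem
    · exact Or.inr h.2.left_mem

/-- A graph is 2-connected if it has no loops, has at least three vertices, is connected, and
stays connected when any one vertex is deleted. -/
structure TwoConnected {α : Type u} {β : Type v} (G : Graph α β) : Prop where
  loopless : G.Loopless
  three_le : 3 ≤ G.vertexSet.encard
  connected : G.toSimpleGraph.Connected
  connected_delete : ∀ x ∈ G.vertexSet, (G.deleteVerts {x}).toSimpleGraph.Connected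

/-- The degree of a vertex in a loopless graph. -/
noncomputable def degree {α : Type u} {β : Type v} (G : Graph α β) (x : α) : ℕ :=
  (G.incidenceSet x).ncard

/-- The pair of maps `f` (on vertices) and `g` (on edges) is an isomorphism from `G` to `H`. -/
structure IsIso {α : Type u} {β : Type v} {α' : Type u'} {β' : Type v'}
    (G : Graph α β) (H : Graph α' β') (f : α → α') (g : β → β') : Prop where
  bijOn_vertex : BijOn f G.vertexSet H.vertexSet
  bijOn_edge : BijOn g G.edgeSet H.edgeSet
  isLink_iff : ∀ e ∈ G.edgeSet, ∀ x ∈ G.vertexSet, ∀ y ∈ G.vertexSet,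
    (G.IsLink e x y ↔ H.IsLink (g e) (f x) (f y))

/-! ### Embeddings in the sphere

Embeddings of finite connected loopless graphs in the sphere are described by rotation systems of
genus zero. They are considered up to reorientation: a rotation system and its inverse describe
the same embedding. A dart, or half-edge, is a pair `(x, e)` of a vertex and an incident edge. -/

open Classical in
/-- The involution that sends a dart `(x, e)` to the dart at the other end of `e` (and fixes all
pairs that are not darts). -/
noncomputable def flip {α : Type u} {β : Type v} (G : Graph α β) : Equiv.Perm (α × β) :=
  Function.Involutive.toPerm
    (fun d => if h : G.Inc d.2 d.1 then (h.other, d.2) else d) (by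
      rintro ⟨x, e⟩
      by_cases h : G.Inc e x
      · have h2 : G.Inc e h.other := h.inc_other
        simp only [h, h2, dif_pos, Prod.mk.injEq, and_true]
        exact h2.isLink_other.right_unique h.isLink_other.symm
      · simp [h])

/-- The faces of a rotation system `rot` on `G`: the orbits on darts of the permutation that sends
a dart to the successor, in the rotation, of the dart at the other end of the same edge. -/
def faces {α : Type u} {β : Type v} (G : Graph α β) (rot : Equiv.Perm (α × β)) :
    Set (Set (α × β)) :=
  {O | ∃ d : α × β, G.Inc d.2 d.1 ∧ O = {d' | (rot * flip G).SameCycle d d'}}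

/-- An embedding of a finite connected loopless graph in the sphere: a cyclic order of the edges
at each vertex, given by a successor permutation on darts, which satisfies Euler's formula. -/
structure Embedding {α : Type u} {β : Type v} (G : Graph α β) where
  /-- the successor permutation on darts -/
  rot : Equiv.Perm (α × β)
  rot_of_not_inc : ∀ d : α × β, ¬ G.Inc d.2 d.1 → rot d = d
  rot_fst : ∀ d : α × β, (rot d).1 = d.1
  sameCycle : ∀ (x : α) (e e' : β), G.Inc e x → G.Inc e' x → rot.SameCycle (x, e) (x, e')
  euler : G.vertexSet.ncard + (faces G rot).ncard = G.edgeSet.ncard + 2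

/-- Two embeddings of a graph are the same (up to reorientation). -/
def Embedding.Same {α : Type u} {β : Type v} {G : Graph α β} (σ τ : Embedding G) : Prop :=
  τ.rot = σ.rot ∨ τ.rot = σ.rot⁻¹

/-- The permutation `ρ` is obtained from `σ` by skipping all pairs that are not darts of `H`. -/
def Restricts {α : Type u} {β : Type v} (σ : Equiv.Perm (α × β)) (H : Graph α β)
    (ρ : Equiv.Perm (α × β)) : Prop :=
  ∀ d : α × β, H.Inc d.2 d.1 → ∃ k : ℕ, 0 < k ∧ ρ d = (σ ^ k) d ∧
    ∀ j : ℕ, 0 < j → j < k → ¬ H.Inc ((σ ^ j) d).2 ((σ ^ j) d).1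

/-- The embedding `σ` of `G` induces the embedding `ρ` of `H`, where `H` is a subgraph of `G`
(up to reorientation). -/
def Embedding.Induces {α : Type u} {β : Type v} {G H : Graph α β}
    (σ : Embedding G) (ρ : Embedding H) : Prop :=
  Restricts σ.rot H ρ.rot ∨ Restricts σ.rot⁻¹ H ρ.rot

/-- The isomorphism `(f, g)` from `G` to `H` maps the embedding `ρ` of `G` to the embedding `τ`
of `H` (up to reorientation). -/
def Embedding.MapsTo {α : Type u} {β : Type v} {α' : Type u'} {β' : Type v'}
    {G : Graph α β} {H : Graph α' β'} (f : α → α') (g : β → β')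
    (ρ : Embedding G) (τ : Embedding H) : Prop :=
  (∀ d : α × β, G.Inc d.2 d.1 → τ.rot (Prod.map f g d) = Prod.map f g (ρ.rot d)) ∨
  (∀ d : α × β, G.Inc d.2 d.1 → τ.rot⁻¹ (Prod.map f g d) = Prod.map f g (ρ.rot d))

/-- Two graphs are unifiable if any embedding of one and any embedding of the other are induced by
exactly one embedding of the union. -/
def Unifiable {α : Type u} {β : Type v} (G H : Graph α β) : Prop :=
  ∀ (σ : Embedding G) (π : Embedding H), ∃ τ : Embedding (union G H),
    (τ.Induces σ ∧ τ.Induces π) ∧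
      ∀ τ' : Embedding (union G H), τ'.Induces σ ∧ τ'.Induces π → τ.Same τ'

/-! ### Hybrid deletion sequences -/

/-- An isomorphism from `G'` to `H` that fixes the strict edge labels `A`: it relabels vertices,
and only edges whose label is not strict. -/
structure IsHybridIso {α : Type u} {β : Type v} (A : Set β) (G' H : Graph α β)
    (f : α → α) (g : β → β) : Prop extends IsIso G' H f g where
  fixes : ∀ e ∈ G'.edgeSet, e ∈ A ∨ g e ∈ A → g e = e

/-- `H` is a hybrid subgraph of `G`: it arises from a subgraph of `G` by relabelling vertices and
edges that are not in the set `A` of strict edge labels. -/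
def IsHybridSubgraph {α : Type u} {β : Type v} (A : Set β) (H G : Graph α β) : Prop :=
  ∃ G' : Graph α β, G' ≤ G ∧ ∃ (f : α → α) (g : β → β), IsHybridIso A G' H f g

/-- A hybrid deletion sequence of length `n + 1`, with its set of strict edge labels. -/
structure HybridDeletionSequence (α : Type u) (β : Type v) (n : ℕ) where
  graph : Fin (n + 1) → Graph α β
  strict : Set β
  finite_vertex : ∀ k, (graph k).vertexSet.Finite
  finite_edge : ∀ k, (graph k).edgeSet.Finite
  step : ∀ k : Fin n, IsHybridSubgraph strict (graph k.castSucc) (graph k.succ) ∨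
    IsHybridSubgraph strict (graph k.succ) (graph k.castSucc)

/-- The weak edges of a hybrid deletion sequence are its edges that are not strict. -/
def HybridDeletionSequence.weak {α : Type u} {β : Type v} {n : ℕ}
    (𝒢 : HybridDeletionSequence α β n) : Set β :=
  (⋃ k, (𝒢.graph k).edgeSet) \ 𝒢.strict

/-- Up to an isomorphism that fixes the strict edges, `τ` is the embedding induced by `σ` on some
subgraph. -/
def WeaklyInduces {α : Type u} {β : Type v} (A : Set β) {G H : Graph α β}
    (σ : Embedding G) (τ : Embedding H) : Prop :=
  ∃ G' : Graph α β, G' ≤ G ∧ ∃ (f : α → α) (g : β → β), IsHybridIso A G' H f g ∧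
    ∃ ρ : Embedding G', σ.Induces ρ ∧ Embedding.MapsTo f g ρ τ

/-- Simultaneous embeddings of a hybrid deletion sequence. -/
def IsSimultaneousEmbedding {α : Type u} {β : Type v} {n : ℕ}
    (𝒢 : HybridDeletionSequence α β n) (S : ∀ k, Embedding (𝒢.graph k)) : Prop :=
  ∀ k : Fin n,
    (IsHybridSubgraph 𝒢.strict (𝒢.graph k.castSucc) (𝒢.graph k.succ) →
      WeaklyInduces 𝒢.strict (S k.succ) (S k.castSucc)) ∧
    (¬ IsHybridSubgraph 𝒢.strict (𝒢.graph k.castSucc) (𝒢.graph k.succ) →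
      WeaklyInduces 𝒢.strict (S k.castSucc) (S k.succ))

/-- Two hybrid deletion sequences of the same length are unifiable if their `k`-th graphs are
unifiable for all `k` and they have no weak edge in common. -/
def UnifiableSeq {α : Type u} {β : Type v} {n : ℕ} (𝒢 ℋ : HybridDeletionSequence α β n) : Prop :=
  (∀ k, Unifiable (𝒢.graph k) (ℋ.graph k)) ∧ Disjoint 𝒢.weak ℋ.weak

/-! ### Planets and villages -/

/-- The vertex `s_{4i+r}` of the surface of a planet, for a house index `i` (all indices start
from zero). -/
def site {m : ℕ} (i : Fin m) (r : Fin 4) : Fin (4 * m) :=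
  ⟨4 * i + r, by have := i.isLt; have := r.isLt; omega⟩

/-- The (indices of the) vertices `s_{4i}, …, s_{4i+3}` of the foundation of the `i`-th house. -/
def foundation {m : ℕ} (i : Fin m) : Set (Fin (4 * m)) := Set.range (site i)

/-- A labelled planet of equator `m`: vertex and edge labels for a wheel of rim-length `4m`. -/
structure Planet (α : Type u) (β : Type v) (m : ℕ) where
  centre : α
  surface : Fin (4 * m) → α
  spoke : Fin (4 * m) → β
  rim : Fin (4 * m) → β
  surface_injective : Function.Injective surface
  spoke_injective : Function.Injective spoke
  rim_injective : Function.Injective rim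
  surface_ne_centre : ∀ k, surface k ≠ centre
  spoke_ne_rim : ∀ k l, spoke k ≠ rim l

/-- The wheel with centre `c` and rim `s_0 s_1 … s_{4m-1}`, in which the `k`-th spoke joins `c` to
`s_k` and the `k`-th rim edge joins `s_k` to its cyclic successor. -/
def Planet.graph {α : Type u} {β : Type v} {m : ℕ} (P : Planet α β m) : Graph α β where
  vertexSet := insert P.centre (range P.surface)
  edgeSet := range P.spoke ∪ range P.rim
  IsLink e x y := (∃ k, e = P.spoke k ∧ s(x, y) = s(P.centre, P.surface k)) ∨
    (∃ k, e = P.rim k ∧ s(x, y) = s(P.surface k, P.surface (finRotate _ k)))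
  isLink_symm := by
    refine fun e _ => ⟨fun x y h => ?_⟩
    rwa [Sym2.eq_swap (a := y) (b := x)]
  eq_or_eq_of_isLink_of_isLink := by
    rintro e x y z w (⟨k, rfl, h⟩ | ⟨k, rfl, h⟩) (⟨l, hl, h'⟩ | ⟨l, hl, h'⟩)
    · obtain rfl := P.spoke_injective hl
      have := h.trans h'.symm
      rw [Sym2.eq_iff] at this
      tauto
    · exact absurd hl (P.spoke_ne_rim _ _)
    · exact absurd hl.symm (P.spoke_ne_rim _ _)
    · obtain rfl := P.rim_injective hl
      have := h.trans h'.symm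
      rw [Sym2.eq_iff] at this
      tauto
  edge_mem_iff_exists_isLink := by
    intro e
    constructor
    · rintro (⟨k, rfl⟩ | ⟨k, rfl⟩)
      · exact ⟨_, _, Or.inl ⟨k, rfl, rfl⟩⟩
      · exact ⟨_, _, Or.inr ⟨k, rfl, rfl⟩⟩
    · rintro ⟨x, y, ⟨k, rfl, -⟩ | ⟨k, rfl, -⟩⟩
      · exact Or.inl ⟨k, rfl⟩
      · exact Or.inr ⟨k, rfl⟩
  left_mem_of_isLink := by
    rintro e x y (⟨k, rfl, h⟩ | ⟨k, rfl, h⟩)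
    · rw [Sym2.eq_iff] at h
      rcases h with ⟨rfl, -⟩ | ⟨rfl, -⟩
      · exact Or.inl rfl
      · exact Or.inr ⟨k, rfl⟩
    · rw [Sym2.eq_iff] at h
      rcases h with ⟨rfl, -⟩ | ⟨rfl, -⟩
      · exact Or.inr ⟨k, rfl⟩
      · exact Or.inr ⟨_, rfl⟩

/-- Vertex labels of villages: the centre and the surface of the planet, and for each house the
six vertices `v₂, v₃, v₄, v₅, v₆, w` (numbered `0, …, 5` in this order) that are not on the
planet. -/
inductive VillageVertex (m : ℕ) : Type
  | centre : VillageVertex m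
  | surface (k : Fin (4 * m)) : VillageVertex m
  | house (i : Fin m) (t : Fin 6) : VillageVertex m

/-- Edge labels of villages: spokes, rim edges, and for each house the six edges of its path
`v₁ … v₇` (in this order) followed by the three edges `wv₂`, `wv₄`, `wv₆` of its inhabitant. -/
inductive VillageEdge (m : ℕ) : Type
  | spoke (k : Fin (4 * m)) : VillageEdge m
  | rim (k : Fin (4 * m)) : VillageEdge m
  | house (i : Fin m) (t : Fin 9) : VillageEdge m

/-- The ends of the edges of a village; the vertices `v₁` and `v₇` of the `i`-th house are the
surface vertices `s_{4i}` and `s_{4i+2}`. -/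
def VillageEdge.ends {m : ℕ} : VillageEdge m → Sym2 (VillageVertex m)
  | .spoke k => s(.centre, .surface k)
  | .rim k => s(.surface k, .surface (finRotate _ k))
  | .house i t =>
    ![s(.surface (site i 0), .house i 0), s(.house i 0, .house i 1), s(.house i 1, .house i 2),
      s(.house i 2, .house i 3), s(.house i 3, .house i 4), s(.house i 4, .surface (site i 2)),
      s(.house i 5, .house i 0), s(.house i 5, .house i 2), s(.house i 5, .house i 4)] t

/-- The village `V(m, I)` with index set `I` on a planet of equator `m`. -/
def village (m : ℕ) (I : Set (Fin m)) : Graph (VillageVertex m) (VillageEdge m) where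
  vertexSet := {x | ∀ i t, x = .house i t → i ∈ I}
  edgeSet := {e | ∀ i t, e = .house i t → i ∈ I}
  IsLink e x y := (∀ i t, e = .house i t → i ∈ I) ∧ s(x, y) = e.ends
  isLink_symm := by
    refine fun e _ => ⟨fun x y h => ?_⟩
    exact ⟨h.1, Sym2.eq_swap.trans h.2⟩
  eq_or_eq_of_isLink_of_isLink := by
    rintro e x y z w ⟨-, h⟩ ⟨-, h'⟩
    have := h.trans h'.symm
    rw [Sym2.eq_iff] at this
    tauto
  edge_mem_iff_exists_isLink := by
    intro e
    constructor
    · intro h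
      obtain ⟨x, y, hxy⟩ : ∃ x y, e.ends = s(x, y) := by
        induction e.ends with | h x y => exact ⟨x, y, rfl⟩
      exact ⟨x, y, h, hxy.symm⟩
    · rintro ⟨x, y, h, -⟩
      exact h
  left_mem_of_isLink := by
    rintro e x y ⟨h, hxy⟩ i t rfl
    have hx : VillageVertex.house i t ∈ e.ends := by rw [← hxy]; simp
    rcases e with k | k | ⟨j, r⟩
    · simp [VillageEdge.ends] at hx
    · simp [VillageEdge.ends] at hx
    · have hj : i = j := by
        fin_cases r <;> simp [VillageEdge.ends] at hx <;> tauto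
      exact h i r (by rw [hj])

/-- An isomorphism from the village `V(m, I)` to the graph `G` that maps the planet of the village
to the labelled planet `P`. -/
structure Planet.IsVillageIso {α : Type u} {β : Type v} {m : ℕ} (P : Planet α β m)
    (I : Set (Fin m)) (G : Graph α β) (f : VillageVertex m → α) (g : VillageEdge m → β) :
    Prop extends IsIso (village m I) G f g where
  centre : f .centre = P.centre
  surface : ∀ k, f (.surface k) = P.surface k
  spoke : ∀ k, g (.spoke k) = P.spoke k
  rim : ∀ k, g (.rim k) = P.rim k

/-! ### Housing sequences -/

/-- `𝒢` is a housing sequence with housing index set `I` on the planet `P` of equator `m`. -/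
structure IsHousingSequence {α : Type u} {β : Type v} {m n : ℕ} (P : Planet α β m)
    (I : Set (Fin m)) (𝒢 : HybridDeletionSequence α β n) : Prop where
  twoConnected : ∀ k, TwoConnected (𝒢.graph k)
  planet_le : ∀ k, P.graph ≤ 𝒢.graph k
  degree_lt : ∀ k, ∀ x ∈ (𝒢.graph k).vertexSet, x ≠ P.centre →
    degree (𝒢.graph k) x < degree (𝒢.graph k) P.centre
  /-- The first and the last graph are copies of the village, and in every simultaneous embedding
  they are embedded in the same way. -/
  first_last : ∃ (f₀ f₁ : VillageVertex m → α) (g₀ g₁ : VillageEdge m → β),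
    P.IsVillageIso I (𝒢.graph 0) f₀ g₀ ∧ P.IsVillageIso I (𝒢.graph (Fin.last n)) f₁ g₁ ∧
    ∀ S : ∀ k, Embedding (𝒢.graph k), IsSimultaneousEmbedding 𝒢 S →
      ∃ ρ : Embedding (village m I),
        Embedding.MapsTo f₀ g₀ ρ (S 0) ∧ Embedding.MapsTo f₁ g₁ ρ (S (Fin.last n))

/-- Edges outside the planet meet the surface of the planet only in foundations of houses: every
surface vertex that is incident with an edge outside the planet is in the foundation of a house
with index in `I`. -/
def AttachesAtFoundations {α : Type u} {β : Type v} {m n : ℕ} (P : Planet α β m)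
    (I : Set (Fin m)) (𝒢 : HybridDeletionSequence α β n) : Prop :=
  ∀ k e t, (𝒢.graph k).Inc e (P.surface t) → e ∉ P.graph.edgeSet → ∃ i ∈ I, t ∈ foundation i

/-- The pair `(i, j)` is an arch: some graph of the sequence has a path between the foundations of
the `i`-th and the `j`-th house that avoids all other vertices of the planet. -/
def IsArch {α : Type u} {β : Type v} {m n : ℕ} (P : Planet α β m)
    (I : Set (Fin m)) (𝒢 : HybridDeletionSequence α β n) (i j : Fin m) : Prop :=
  i ∈ I ∧ j ∈ I ∧ i ≠ j ∧ ∃ (k : Fin (n + 1)) (x y : (𝒢.graph k).vertexSet)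
    (p : (𝒢.graph k).toSimpleGraph.Walk x y), p.IsPath ∧
    (x : α) ∈ P.surface '' foundation i ∧ (y : α) ∈ P.surface '' foundation j ∧
    ∀ z ∈ p.support, (z : α) ∈ P.graph.vertexSet → z = x ∨ z = y

/-- The pairs `{a, b}` and `{c, d}` alternate in the cyclic order of the equator. -/
def Cross {m : ℕ} (a b c d : Fin m) : Prop :=
  (sbtw a c b ∧ sbtw b d a) ∨ (sbtw a d b ∧ sbtw b c a)

end Housing

namespace Housing

open Equiv (Perm)

/-! ### First returns of permutations -/

section FirstReturn

variable {X : Type*} {R S T : Perm X} {A B : Set X} {x y z : X}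

/-! Fix an index and let G and H be the two graphs there, with embeddings σ and π. They share just
the planet, so the question is whether σ and π have exactly one common extension.

Genus zero is used in a homological form: a rotation system of a connected graph satisfies Euler's
formula if and only if every cycle modulo two is the border between two classes of faces, that is,
corners can be coloured so that the colour changes exactly along the cycle (`euler_iff_planar`, by
counting ranks). Colourings of triangles of the wheel show that every planar rotation system induces
on the planet the standard rotation or its inverse (`IsPlanarRotation.exists_wheelRotation`). After
reorientation, σ and π therefore have the same first-return map on the common darts.

Existence: at every vertex except the centre, at most one of the two graphs has edges outside the
planet, so a choice arises only at the centre. In the sector between two consecutive spokes, the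
edges of H are put before those of G if bridges of H may be attached at the first surface vertex of
the sector, and after them otherwise (`exists_isMerge`). For planarity, a cycle of the union is a
sum of a cycle of G and one of H, obtained by closing up its part in H with spokes
(`Fits.planar_union`). A colouring of G extends over a bridge of H if all corners of G where the
bridge is attached have one colour (`Fits.attachment_eq`). For a bridge inside a triangle of the
wheel this is a local check; for a bridge in the outer face it is where noncrossing enters
(`Fits.outer_eq`).

Uniqueness: by 2-connectedness, a bridge attached at the centre is also attached at the surface,
where its corner of G is prescribed, and distinct corners at a vertex of a 2-connected planar graph
lie in distinct faces. So each edge of H at the centre has a prescribed corner of G, and vice versa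
(`Fits.first_eq`); these corners determine the cyclic order (`AgreeOn.eq`).

Finally, bridges of the two graphs that cross on the rim contain paths that are crossing arches
(`Joins.isArch`, `cross_of_iterate`). -/

theorem inv_apply_apply (R : Perm X) (x : X) : R⁻¹ (R x) = x := R.symm_apply_apply x

theorem apply_inv_apply (R : Perm X) (x : X) : R (R⁻¹ x) = x := R.apply_symm_apply x

/-- `y` is the first element of `A` in the sequence `x, R x, R (R x), …`. -/
inductive First (R : Perm X) (A : Set X) : X → X → Prop
  | here {x : X} : x ∈ A → First R A x x
  | step {x y : X} : x ∉ A → First R A (R x) y → First R A x y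

theorem First.mem (h : First R A x y) : y ∈ A := by
  induction h with
  | here h => exact h
  | step _ _ ih => exact ih

theorem First.eq_of_mem (h : First R A x y) (hx : x ∈ A) : x = y := by
  cases h with
  | here _ => rfl
  | step h _ => exact absurd hx h

theorem First.next (h : First R A x y) (hx : x ∉ A) : First R A (R x) y := by
  cases h with
  | here h => exact absurd h hx
  | step _ h => exact h

theorem First.unique (h : First R A x y) (h' : First R A x z) : y = z := by
  induction h with
  | here h => exact h'.eq_of_mem h
  | step h _ ih => exact ih (h'.next h)

theorem First.exists_pow (h : First R A x y) :
    ∃ k : ℕ, (R ^ k) x = y ∧ ∀ j < k, (R ^ j) x ∉ A := by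
  induction h with
  | here h => exact ⟨0, rfl, by simp⟩
  | @step x y h _ ih =>
    obtain ⟨k, hk, hj⟩ := ih
    refine ⟨k + 1, by rw [pow_succ]; exact hk, fun j hlt => ?_⟩
    rcases j with _ | j
    · exact h
    · rw [pow_succ]; exact hj j (by omega)

theorem First.of_pow (k : ℕ) (hy : (R ^ k) x ∈ A) (h : ∀ j < k, (R ^ j) x ∉ A) :
    First R A x ((R ^ k) x) := by
  induction k generalizing x with
  | zero => exact .here hy
  | succ k ih =>
    refine .step (h 0 (by omega)) ?_
    have := @ih (R x) (by rw [pow_succ] at hy; exact hy) (fun j hj => by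
      have := h (j + 1) (by omega)
      rw [pow_succ] at this; exact this)
    rw [pow_succ]; exact this

theorem First.sameCycle (h : First R A x y) : R.SameCycle x y := by
  obtain ⟨k, hk, -⟩ := h.exists_pow
  exact ⟨k, by simpa using hk⟩

/-- The ambient type may be infinite; finite support is what makes orbits periodic, so that integer
exponents can be replaced by natural ones. -/
theorem exists_pow_of_sameCycle (hR : {x | R x ≠ x}.Finite) (h : R.SameCycle x y) :
    ∃ n : ℕ, (R ^ n) x = y := by
  obtain ⟨i, hi⟩ := h
  obtain ⟨k, hk, hkx⟩ : ∃ k : ℕ, 0 < k ∧ (R ^ k) x = x := by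
    by_cases hx : R x = x
    · exact ⟨1, one_pos, by simpa using hx⟩
    · have hmem : ∀ n : ℕ, (R ^ n) x ∈ {x | R x ≠ x} := by
        intro n hn
        apply hx
        have h1 : (R ^ n) (R x) = (R ^ n) x := by
          rw [← Perm.mul_apply, ← pow_succ, pow_succ', Perm.mul_apply]; exact hn
        exact (R ^ n).injective h1
      obtain ⟨a, b, hab, he⟩ : ∃ a b : ℕ, a < b ∧ (R ^ a) x = (R ^ b) x := by
        have : ¬ Function.Injective (fun n : ℕ => (⟨(R ^ n) x, hmem n⟩ : {x | R x ≠ x})) := by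
          intro hinj
          have := hR.to_subtype
          exact not_injective_infinite_finite _ hinj
        simp only [Function.Injective, not_forall] at this
        obtain ⟨a, b, he, hne⟩ := this
        have he' : (R ^ a) x = (R ^ b) x := congrArg Subtype.val he
        rcases lt_or_gt_of_ne hne with h | h
        · exact ⟨a, b, h, he'⟩
        · exact ⟨b, a, h, he'.symm⟩
      refine ⟨b - a, by omega, ?_⟩
      apply (R ^ a).injective
      rw [← Perm.mul_apply, ← pow_add, he]
      congr 2
      omega
  have hper : ∀ j : ℤ, (R ^ (k * j)) x = x := by
    intro j
    rw [zpow_mul]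
    exact Perm.zpow_apply_eq_self_of_apply_eq_self (by simpa using hkx) j
  have hlt : 0 ≤ i + k * |i| := by
    have : (1 : ℤ) ≤ k := by exact_mod_cast hk
    have h1 : |i| ≤ k * |i| := le_mul_of_one_le_left (abs_nonneg i) this
    have h2 := neg_abs_le i
    linarith
  -- Adding a multiple of the period `k` makes the exponent nonnegative.
  refine ⟨(i + k * |i|).toNat, ?_⟩
  rw [← zpow_natCast, Int.toNat_of_nonneg hlt, zpow_add, Perm.mul_apply, hper, hi]

theorem exists_first (hR : {x | R x ≠ x}.Finite) (h : R.SameCycle x y) (hy : y ∈ A) :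
    ∃ z, First R A x z := by
  classical
  obtain ⟨n, rfl⟩ := exists_pow_of_sameCycle hR h
  have hex : ∃ n : ℕ, (R ^ n) x ∈ A := ⟨n, hy⟩
  exact ⟨_, First.of_pow (Nat.find hex) (Nat.find_spec hex) (fun j hj => Nat.find_min hex hj)⟩

/-- The elements skipped on the way from `z` to `y` are skipped again on the way back, so looking
backwards from `y` and from `z` finds the same element. -/
theorem First.reverse (h : First R A z y) {w : X} (hw : First R⁻¹ A (R⁻¹ z) w) :
    First R⁻¹ A (R⁻¹ y) w := by
  induction h with
  | here _ => exact hw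
  | step h _ ih => exact ih (by rw [inv_apply_apply]; exact .step h hw)

theorem First.comp (hBA : B ⊆ A) (h : First R A x y) (hyz : First R B y z) : First R B x z := by
  induction h with
  | here _ => exact hyz
  | step h _ ih => exact .step (fun hx => h (hBA hx)) (ih hyz)

/-- An invariant of the steps of `R` outside `A` is inherited by first elements. -/
theorem First.induction_on {p : X → Prop} (h : First R A x y) (hx : p x)
    (hstep : ∀ z, z ∉ A → p z → p (R z)) : p y := by
  induction h with
  | here _ => exact hx
  | step h _ ih => exact ih (hstep _ h hx)

/-- `S` is the first-return map of `R` on `A`. -/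
def ReturnsTo (R : Perm X) (A : Set X) (S : Perm X) : Prop :=
  ∀ x ∈ A, First R A (R x) (S x)

theorem ReturnsTo.mem (h : ReturnsTo R A S) (hx : x ∈ A) : S x ∈ A := (h x hx).mem

theorem ReturnsTo.trans_first (h : ReturnsTo R A S) (hBA : B ⊆ A) (hx : x ∈ A)
    (hxy : First S B x y) : First R B x y := by
  induction hxy with
  | here hB => exact .here hB
  | step hB _ ih => exact .step hB ((h _ hx).comp hBA (ih (h.mem hx)))

theorem ReturnsTo.trans (h : ReturnsTo R A S) (hBA : B ⊆ A) (h' : ReturnsTo S B T) :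
    ReturnsTo R B T := fun x hx =>
  (h x (hBA hx)).comp hBA (h.trans_first hBA (h.mem (hBA hx)) (h' x hx))

theorem ReturnsTo.eq (h : ReturnsTo R A S) (h' : ReturnsTo R A T) (hS : ∀ x ∉ A, S x = x)
    (hT : ∀ x ∉ A, T x = x) : S = T := by
  ext x
  by_cases hx : x ∈ A
  · exact (h x hx).unique (h' x hx)
  · rw [hS x hx, hT x hx]

theorem ReturnsTo.first_inv (h : ReturnsTo R A S) (hx : x ∈ A) :
    First R⁻¹ A (R⁻¹ (S x)) x :=
  (h x hx).reverse (by rw [inv_apply_apply]; exact .here hx)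

theorem ReturnsTo.inv (h : ReturnsTo R A S) (hS : ∀ x ∉ A, S x = x) :
    ReturnsTo R⁻¹ A S⁻¹ := by
  intro x hx
  have hx' : S⁻¹ x ∈ A := by
    by_contra hn
    have := hS _ hn
    rw [apply_inv_apply] at this
    exact hn (this ▸ hx)
  have := h.first_inv hx'
  rwa [apply_inv_apply] at this

theorem ReturnsTo.sameCycle (h : ReturnsTo R A S) (hRfin : {x | S x ≠ x}.Finite) (hx : x ∈ A)
    (hxy : S.SameCycle x y) : R.SameCycle x y := by
  obtain ⟨n, rfl⟩ := exists_pow_of_sameCycle hRfin hxy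
  clear hxy
  induction n generalizing x with
  | zero => exact .refl _ _
  | succ n ih =>
    rw [pow_succ, Perm.mul_apply]
    exact (Perm.sameCycle_apply_right.2 (.refl _ _)).trans
      ((h x hx).sameCycle.trans (ih (h.mem hx)))

/-- First-return maps are again permutations, since by `First.reverse` the first-return map of `R⁻¹`
is a two-sided inverse. Outside `A` the map is set to be the identity, which makes it unique. -/
theorem exists_returnsTo (hR : {x | R x ≠ x}.Finite) (A : Set X) :
    ∃ S : Perm X, (∀ x ∉ A, S x = x) ∧ ReturnsTo R A S := by
  classical
  have hR' : {x | R⁻¹ x ≠ x}.Finite := by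
    refine hR.subset fun x hx hn => hx ?_
    exact Perm.inv_eq_iff_eq.2 hn.symm
  have key : ∀ x : X, ∃ y, (x ∈ A → First R A (R x) y) ∧ (x ∉ A → y = x) := by
    intro x
    by_cases hx : x ∈ A
    · obtain ⟨y, hy⟩ := exists_first hR (Perm.sameCycle_apply_left.2 (.refl R x)) hx
      exact ⟨y, fun _ => hy, fun h => absurd hx h⟩
    · exact ⟨x, fun h => absurd h hx, fun _ => rfl⟩
  have key' : ∀ x : X, ∃ y, (x ∈ A → First R⁻¹ A (R⁻¹ x) y) ∧ (x ∉ A → y = x) := by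
    intro x
    by_cases hx : x ∈ A
    · obtain ⟨y, hy⟩ := exists_first hR' (Perm.sameCycle_apply_left.2 (.refl R⁻¹ x)) hx
      exact ⟨y, fun _ => hy, fun h => absurd hx h⟩
    · exact ⟨x, fun h => absurd h hx, fun _ => rfl⟩
  choose f hf hf' using key
  choose g hg hg' using key'
  refine ⟨⟨f, g, fun x => ?_, fun x => ?_⟩, fun x hx => hf' x hx, fun x hx => hf x hx⟩
  · by_cases hx : x ∈ A
    · have h1 := (hf x hx).reverse (w := x) (by rw [inv_apply_apply]; exact .here hx)
      exact (hg _ (hf x hx).mem).unique h1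
    · rw [hf' x hx, hg' x hx]
  · by_cases hx : x ∈ A
    · have h1 := (hg x hx).reverse (w := x)
        (by rw [inv_apply_apply]; exact .here hx)
      rw [inv_inv] at h1
      exact (hf _ (hg x hx).mem).unique h1
    · rw [hg' x hx, hf' x hx]

/-- Two elements cannot each come first after the other, before `A ∩ B` is met. -/
theorem First.not_symm (hR : {x | R x ≠ x}.Finite) (hxA : x ∉ A) (hxy : First R A x y)
    (hyx : First R B y x) {p : X} (hp : p ∈ A ∩ B) (hxp : R.SameCycle x p) : False := by
  obtain ⟨q, hq⟩ := exists_first hR hxp hp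
  have hyA := hxy.mem
  -- No element of `D` is skipped on the way from `u` to `v`, so the distance to `D` strictly drops.
  -- Going from `x` to `y` and back would make the distance from `x` smaller than itself.
  have hlt : ∀ {C D : Set X} {u v : X} {k : ℕ}, D ⊆ C → First R C u v → u ≠ v →
      (R ^ k) u ∈ D → (∀ j < k, (R ^ j) u ∉ D) →
      ∃ l < k, (R ^ l) v ∈ D ∧ ∀ j < l, (R ^ j) v ∉ D := by
    intro C D u v k hDC huv hne hk hj
    obtain ⟨i, rfl, hi⟩ := huv.exists_pow
    have hik : i ≤ k := by
      by_contra hlt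
      exact hi k (by omega) (hDC hk)
    have hi0 : i ≠ 0 := by rintro rfl; exact hne rfl
    refine ⟨k - i, by omega, ?_, fun j hjl => ?_⟩
    · rw [← Perm.mul_apply, ← pow_add, Nat.sub_add_cancel hik]; exact hk
    · rw [← Perm.mul_apply, ← pow_add]; exact hj _ (by omega)
  obtain ⟨k, hk, hj⟩ := hq.exists_pow
  have hne : x ≠ y := fun h => hxA (h ▸ hyA)
  obtain ⟨l, hl, hl1, hl2⟩ := hlt inter_subset_left hxy hne (hk ▸ hq.mem) hj
  obtain ⟨l', hl', hl1', -⟩ := hlt inter_subset_right hyx hne.symm hl1 hl2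
  exact hj l' (by omega) hl1'

end FirstReturn

/-! ### Merging permutations with a common first-return map -/

section Merge

variable {X : Type*} {A B : Set X} {σ π ρ τ : Perm X} {K : X → Prop}

/-- `τ` merges `σ` on `A` with `π` on `B`, where both have the first-return map `ρ` on `A ∩ B`:
between consecutive elements `q` and `p` of `A ∩ B`, the elements of `B` come before those of `A`
if and only if `K p`. -/
structure IsMerge (A B : Set X) (σ π ρ τ : Perm X) (K : X → Prop) : Prop where
  left_out : ∀ g ∈ A, g ∉ B → σ g ∉ B → τ g = σ g
  right_out : ∀ h ∈ B, h ∉ A → π h ∉ A → τ h = π h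
  left_pos : ∀ g ∈ A, g ∉ B → σ g ∈ B → K (σ g) → τ g = σ g
  left_neg : ∀ g ∈ A, g ∉ B → σ g ∈ B → ¬ K (σ g) → τ g = π (ρ⁻¹ (σ g))
  right_pos : ∀ h ∈ B, h ∉ A → π h ∈ A → K (π h) → τ h = σ (ρ⁻¹ (π h))
  right_neg : ∀ h ∈ B, h ∉ A → π h ∈ A → ¬ K (π h) → τ h = π h
  pos_out : ∀ q ∈ A, q ∈ B → K (ρ q) → π q ∉ A → τ q = π q
  pos_in : ∀ q ∈ A, q ∈ B → K (ρ q) → π q ∈ A → τ q = σ q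
  neg_out : ∀ q ∈ A, q ∈ B → ¬ K (ρ q) → σ q ∉ B → τ q = σ q
  neg_in : ∀ q ∈ A, q ∈ B → ¬ K (ρ q) → σ q ∈ B → τ q = π q

/-- Exchanging the two permutations negates `K`, so everything below need be shown for one side
only. -/
theorem IsMerge.symm (h : IsMerge A B σ π ρ τ K) : IsMerge B A π σ ρ τ (fun p => ¬ K p) where
  left_out := h.right_out
  right_out := h.left_out
  left_pos := h.right_neg
  left_neg g hg hg' hB hK := h.right_pos g hg hg' hB (not_not.1 hK)
  right_pos := h.left_neg
  right_neg g hg hg' hB hK := h.left_pos g hg hg' hB (not_not.1 hK)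
  pos_out q hB hA := h.neg_out q hA hB
  pos_in q hB hA := h.neg_in q hA hB
  neg_out q hB hA hK := h.pos_out q hA hB (not_not.1 hK)
  neg_in q hB hA hK := h.pos_in q hA hB (not_not.1 hK)

/-- If the block of `B` comes first, then leaving it leads to the start of the block of `A` in the
same gap, which is the `σ`-successor of the previous common element. -/
theorem IsMerge.first_pos (h : IsMerge A B σ π ρ τ K) (hσ : ∀ x ∉ A, σ x = x)
    (hπ : ∀ x ∉ B, π x = x) (hρ : ∀ x ∉ A ∩ B, ρ x = x) {x p : X} (hx : x ∈ B) (hxA : x ∉ A)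
    (hf : First π (A ∩ B) x p) (hp : K p) : First τ A x (σ (ρ⁻¹ p)) := by
  induction hf with
  | here hx' => exact absurd hx'.1 hxA
  | @step x p hx' hf ih =>
    have hB : π x ∈ B := by
      by_contra hn
      exact hn ((π.injective (hπ _ hn)).symm ▸ hx)
    refine .step hxA ?_
    by_cases hA : π x ∈ A
    · have hpe := hf.eq_of_mem ⟨hA, hB⟩
      subst hpe
      rw [h.right_pos x hx hxA hA hp]
      refine .here ?_
      have : ρ⁻¹ (π x) ∈ A ∩ B := by
        by_contra hn
        have := hρ _ hn
        rw [apply_inv_apply] at this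
        exact hn (this ▸ ⟨hA, hB⟩)
      by_contra hn
      exact hn ((σ.injective (hσ _ hn)).symm ▸ this.1)
    · rw [h.right_out x hx hxA hA]
      exact ih hB hA hp

/-- If the block of `B` comes last, then it ends at the next common element. -/
theorem IsMerge.first_neg (h : IsMerge A B σ π ρ τ K)
    (hπ : ∀ x ∉ B, π x = x) {x p : X} (hx : x ∈ B) (hxA : x ∉ A)
    (hf : First π (A ∩ B) x p) (hp : ¬ K p) : First τ A x p := by
  induction hf with
  | here hx' => exact absurd hx'.1 hxA
  | @step x p hx' hf ih =>
    have hB : π x ∈ B := by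
      by_contra hn
      exact hn ((π.injective (hπ _ hn)).symm ▸ hx)
    refine .step hxA ?_
    by_cases hA : π x ∈ A
    · have hpe := hf.eq_of_mem ⟨hA, hB⟩
      subst hpe
      rw [h.right_neg x hx hxA hA hp]
      exact .here hA
    · rw [h.right_out x hx hxA hA]
      exact ih hB hA hp

theorem mem_of_apply_mem {X : Type*} {A : Set X} {σ : Perm X} (hσ : ∀ x ∉ A, σ x = x) {x : X}
    (hx : x ∈ A) : σ x ∈ A := by
  by_contra hn
  exact hn ((σ.injective (hσ _ hn)).symm ▸ hx)

/-- Skipping the blocks of `B` restores `σ`. The cases are those of the definition; when a block of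
`B` has to be skipped, the two preceding lemmas tell where it ends. -/
theorem IsMerge.returnsTo (h : IsMerge A B σ π ρ τ K) (hσ : ∀ x ∉ A, σ x = x)
    (hπ : ∀ x ∉ B, π x = x) (hρ : ∀ x ∉ A ∩ B, ρ x = x) (rσ : ReturnsTo σ (A ∩ B) ρ)
    (rπ : ReturnsTo π (A ∩ B) ρ) : ReturnsTo τ A σ := by
  intro x hx
  have hσx := mem_of_apply_mem hσ hx
  by_cases hxB : x ∈ B
  · have hπx := mem_of_apply_mem hπ hxB
    by_cases hK : K (ρ x)
    · by_cases hA : π x ∈ A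
      · rw [h.pos_in x hx hxB hK hA]
        exact .here hσx
      · rw [h.pos_out x hx hxB hK hA]
        have := h.first_pos hσ hπ hρ hπx hA (rπ x ⟨hx, hxB⟩) hK
        rwa [inv_apply_apply] at this
    · by_cases hB : σ x ∈ B
      · rw [h.neg_in x hx hxB hK hB]
        have hs := (rσ x ⟨hx, hxB⟩).eq_of_mem ⟨hσx, hB⟩
        by_cases hA : π x ∈ A
        · rw [(rπ x ⟨hx, hxB⟩).eq_of_mem ⟨hA, hπx⟩, hs]
          exact .here (hs ▸ hσx)
        · rw [hs]
          exact h.first_neg hπ hπx hA (rπ x ⟨hx, hxB⟩) hK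
      · rw [h.neg_out x hx hxB hK hB]
        exact .here hσx
  · by_cases hB : σ x ∈ B
    · by_cases hK : K (σ x)
      · rw [h.left_pos x hx hxB hB hK]
        exact .here hσx
      · rw [h.left_neg x hx hxB hB hK]
        set q := ρ⁻¹ (σ x) with hq
        have hρq : ρ q = σ x := by rw [hq, apply_inv_apply]
        have hqP : q ∈ A ∩ B := by
          by_contra hn
          have := hρ _ hn
          rw [hρq] at this
          exact hn (this ▸ ⟨hσx, hB⟩)
        have hf := rπ q hqP
        rw [hρq] at hf
        by_cases hA : π q ∈ A
        · rw [hf.eq_of_mem ⟨hA, mem_of_apply_mem hπ hqP.2⟩]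
          exact .here hσx
        · exact h.first_neg hπ (mem_of_apply_mem hπ hqP.2) hA hf hK
    · rw [h.left_out x hx hxB hB]
      exact .here hσx

/-- The merge is a product of permutations, so bijectivity is automatic. With `η = π ρ⁻¹` and `γ = σ
ρ⁻¹`, each cycle of `η` or `γ` through a common element `p` consists of `p` and the block before it.
Multiplying `ρ` by `η` or `γ` thus inserts these blocks, and the order of the factors is the order
of the blocks. The map `φ` (the vertex of a dart, in the application) is preserved by all factors.
-/
theorem exists_isMerge {Y : Type*} (φ : X → Y) (hσ : ∀ x ∉ A, σ x = x) (hπ : ∀ x ∉ B, π x = x)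
    (hρ : ∀ x ∉ A ∩ B, ρ x = x) (rσ : ReturnsTo σ (A ∩ B) ρ) (rπ : ReturnsTo π (A ∩ B) ρ)
    (hφσ : ∀ x, φ (σ x) = φ x) (hφπ : ∀ x, φ (π x) = φ x) (hφρ : ∀ x, φ (ρ x) = φ x)
    (K : X → Prop) :
    ∃ τ : Perm X, IsMerge A B σ π ρ τ K ∧ (∀ x, x ∉ A → x ∉ B → τ x = x) ∧
      ∀ x, φ (τ x) = φ x := by
  classical
  have hρ' : ∀ x ∉ A ∩ B, ρ⁻¹ x = x := fun x hx => Perm.inv_eq_iff_eq.2 (hρ x hx).symm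
  have hφρ' : ∀ x, φ (ρ⁻¹ x) = φ x := fun x => by
    rw [← hφρ (ρ⁻¹ x), apply_inv_apply]
  have hρm : ∀ {x}, x ∈ A ∩ B → ρ⁻¹ x ∈ A ∩ B := fun {x} hx => mem_of_apply_mem hρ' hx
  set η := π * ρ⁻¹ with hη
  set γ := σ * ρ⁻¹ with hγ
  have hηap : ∀ x, η x = π (ρ⁻¹ x) := fun x => rfl
  have hγap : ∀ x, γ x = σ (ρ⁻¹ x) := fun x => rfl
  -- The elements of `B` whose next common element satisfies `K`: the blocks, with their end points,
  -- that have to come first.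
  let Q : X → Prop := fun x => x ∈ B ∧ ∃ p, First π (A ∩ B) x p ∧ K p
  have hηB : ∀ x, x ∉ B → η x = x := fun x hx => by
    rw [hηap, hρ' x (fun h => hx h.2), hπ x hx]
  have hγA : ∀ x, x ∉ A → γ x = x := fun x hx => by
    rw [hγap, hρ' x (fun h => hx h.1), hσ x hx]
  have hηm : ∀ x ∈ B, η x ∈ B := fun x hx => mem_of_apply_mem hηB hx
  have hQ : ∀ x, Q (η x) ↔ Q x := by
    intro x
    by_cases hx : x ∈ B
    · have h1 : ∀ p, First π (A ∩ B) (η x) p ↔ First π (A ∩ B) x p := by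
        intro p
        by_cases hxA : x ∈ A
        · have h2 := rπ _ (hρm ⟨hxA, hx⟩)
          rw [apply_inv_apply] at h2
          constructor
          · intro h
            rw [h.unique h2]
            exact .here ⟨hxA, hx⟩
          · intro h
            rw [← h.eq_of_mem ⟨hxA, hx⟩]
            exact h2
        · rw [hηap, hρ' x (fun h => hxA h.1)]
          exact ⟨fun h => .step (fun h => hxA h.1) h, fun h => h.next (fun h => hxA h.1)⟩
      simp only [Q, h1, hx, hηm x hx]
    · rw [hηB x hx]
  -- As `Q` is a union of cycles of `η`, this permutation splits into a factor `η₂` for the blocks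
  -- that precede those of `A` and a factor `η₁` for those that follow.
  let η₂ : Perm X := Perm.ofSubtype (η.subtypePerm (p := Q) hQ)
  let η₁ : Perm X := Perm.ofSubtype (η.subtypePerm (p := fun x => ¬ Q x)
    (fun x => not_congr (hQ x)))
  have e2 : ∀ x, Q x → η₂ x = η x := fun x hx => by
    simp only [η₂]; rw [Perm.ofSubtype_apply_of_mem _ hx]; rfl
  have e2' : ∀ x, ¬ Q x → η₂ x = x := fun x hx => Perm.ofSubtype_apply_of_not_mem _ hx
  have e1 : ∀ x, ¬ Q x → η₁ x = η x := fun x hx => by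
    simp only [η₁]; rw [Perm.ofSubtype_apply_of_mem (p := fun x => ¬ Q x) _ hx]; rfl
  have e1' : ∀ x, Q x → η₁ x = x := fun x hx =>
    Perm.ofSubtype_apply_of_not_mem (p := fun x => ¬ Q x) _ (not_not.2 hx)
  have hQB : ∀ {x}, x ∉ B → ¬ Q x := fun hx h => hx h.1
  have e1B : ∀ x, x ∉ B → η₁ x = x := fun x hx => by rw [e1 x (hQB hx), hηB x hx]
  have hQP : ∀ {x}, x ∈ A ∩ B → (Q x ↔ K x) := fun {x} hx =>
    ⟨fun ⟨_, p, hp, hK⟩ => by rwa [hp.eq_of_mem hx], fun h => ⟨hx.2, x, .here hx, h⟩⟩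
  have hQ' : ∀ {x}, x ∈ B → x ∉ A → π x ∈ A → (Q x ↔ K (π x)) := by
    intro x hx hxA hA
    have hP : π x ∈ A ∩ B := ⟨hA, mem_of_apply_mem hπ hx⟩
    rw [← hQP hP, ← hQ x, hηap, hρ' x (fun h => hxA h.1)]
  have hap : ∀ x, (η₁ * γ * η₂ * ρ) x = η₁ (γ (η₂ (ρ x))) := fun x => rfl
  have hρP : ∀ {x}, x ∈ A ∩ B → ρ x ∈ A ∩ B := fun hx => mem_of_apply_mem hρ hx
  -- the value on an element of `A ∩ B`
  have q1 : ∀ q ∈ A, q ∈ B → K (ρ q) → π q ∉ A → (η₁ * γ * η₂ * ρ) q = π q := by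
    intro q hA hB hK h
    rw [hap, e2 _ ((hQP (hρP ⟨hA, hB⟩)).2 hK), hηap, inv_apply_apply, hγA _ h, e1']
    have := (hQ (ρ q)).2 ((hQP (hρP ⟨hA, hB⟩)).2 hK)
    rwa [hηap, inv_apply_apply] at this
  refine ⟨η₁ * γ * η₂ * ρ, ⟨?_, ?_, ?_, ?_, ?_, ?_, q1, ?_, ?_, ?_⟩, ?_, ?_⟩
  · intro g hA hB h
    rw [hap, hρ _ (fun h => hB h.2), e2' _ (hQB hB), hγap, hρ' _ (fun h => hB h.2), e1B _ h]
  · intro x hB hA h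
    rw [hap, hρ _ (fun h => hA h.1)]
    by_cases hx : Q x
    · rw [e2 _ hx, hηap, hρ' _ (fun h => hA h.1), hγA _ h, e1']
      have := (hQ x).2 hx
      rwa [hηap, hρ' _ (fun h => hA h.1)] at this
    · rw [e2' _ hx, hγA _ hA, e1 _ hx, hηap, hρ' _ (fun h => hA h.1)]
  · intro g hA hB h hK
    rw [hap, hρ _ (fun h => hB h.2), e2' _ (hQB hB), hγap, hρ' _ (fun h => hB h.2), e1']
    exact (hQP ⟨mem_of_apply_mem hσ hA, h⟩).2 hK
  · intro g hA hB h hK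
    rw [hap, hρ _ (fun h => hB h.2), e2' _ (hQB hB), hγap, hρ' _ (fun h => hB h.2), e1]
    · rfl
    · exact fun h' => hK ((hQP ⟨mem_of_apply_mem hσ hA, h⟩).1 h')
  · intro x hB hA h hK
    have hx := (hQ' hB hA h).2 hK
    rw [hap, hρ _ (fun h => hA h.1), e2 _ hx, hηap, hρ' x (fun h => hA h.1), hγap]
    set q := ρ⁻¹ (π x) with hq
    have hqP : q ∈ A ∩ B := hρm ⟨h, mem_of_apply_mem hπ hB⟩
    by_cases hs : σ q ∈ B
    · have := (rσ q hqP).eq_of_mem ⟨mem_of_apply_mem hσ hqP.1, hs⟩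
      rw [hq, apply_inv_apply, ← hq] at this
      rw [e1']
      rw [this]
      exact (hQP ⟨h, mem_of_apply_mem hπ hB⟩).2 hK
    · rw [e1B _ hs]
  · intro x hB hA h hK
    have hx := fun h' => hK ((hQ' hB hA h).1 h')
    rw [hap, hρ _ (fun h => hA h.1), e2' _ hx, hγA _ hA, e1 _ hx, hηap, hρ' _ (fun h => hA h.1)]
  · intro q hA hB hK h
    have hp := (rπ q ⟨hA, hB⟩).eq_of_mem ⟨h, mem_of_apply_mem hπ hB⟩
    rw [hap, e2 _ ((hQP (hρP ⟨hA, hB⟩)).2 hK), hηap, inv_apply_apply, hp, hγap, inv_apply_apply]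
    by_cases hs : σ q ∈ B
    · have := (rσ q ⟨hA, hB⟩).eq_of_mem ⟨mem_of_apply_mem hσ hA, hs⟩
      rw [e1']
      rw [this]
      exact (hQP (hρP ⟨hA, hB⟩)).2 hK
    · rw [e1B _ hs]
  · intro q hA hB hK h
    rw [hap, e2' _ (fun h' => hK ((hQP (hρP ⟨hA, hB⟩)).1 h')), hγap, inv_apply_apply, e1B _ h]
  · intro q hA hB hK h
    have hp := (rσ q ⟨hA, hB⟩).eq_of_mem ⟨mem_of_apply_mem hσ hA, h⟩
    have hn := fun h' => hK ((hQP (hρP ⟨hA, hB⟩)).1 h')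
    rw [hap, e2' _ hn, hγap, inv_apply_apply, hp, e1 _ hn, hηap, inv_apply_apply]
  · intro x hA hB
    rw [hap, hρ _ (fun h => hA h.1), e2' _ (hQB hB), hγA _ hA, e1B _ hB]
  · have hφη : ∀ x, φ (η x) = φ x := fun x => by rw [hηap, hφπ, hφρ']
    have hφγ : ∀ x, φ (γ x) = φ x := fun x => by rw [hγap, hφσ, hφρ']
    have h2 : ∀ x, φ (η₂ x) = φ x := fun x => by
      by_cases hx : Q x
      · rw [e2 x hx, hφη]
      · rw [e2' x hx]
    have h1 : ∀ x, φ (η₁ x) = φ x := fun x => by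
      by_cases hx : Q x
      · rw [e1' x hx]
      · rw [e1 x hx, hφη]
    intro x
    rw [hap, h1, hφγ, h2, hφρ]

end Merge

/-! ### Rotation systems and colourings of their corners -/

section Colouring

variable {α : Type*} {β : Type*} {G H : Graph α β} {R S : Perm (α × β)} {x y : α} {e : β}
  {d d' : α × β}

/-- The darts of a graph. -/
def darts (G : Graph α β) : Set (α × β) := {d | G.Inc d.2 d.1}

@[simp] theorem mem_darts : d ∈ darts G ↔ G.Inc d.2 d.1 := Iff.rfl

theorem darts_mono (h : H ≤ G) : darts H ⊆ darts G := fun _ hd => Graph.Inc.mono h hd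

theorem finite_darts (hV : G.vertexSet.Finite) (hE : G.edgeSet.Finite) : (darts G).Finite :=
  (hV.prod hE).subset fun _ hd => ⟨hd.vertex_mem, hd.edge_mem⟩

/-- A rotation system: a cyclic order of the edges at each vertex. -/
structure IsRotation (G : Graph α β) (R : Perm (α × β)) : Prop where
  of_not_inc : ∀ d : α × β, ¬ G.Inc d.2 d.1 → R d = d
  fst : ∀ d : α × β, (R d).1 = d.1
  sameCycle : ∀ (x : α) (e e' : β), G.Inc e x → G.Inc e' x → R.SameCycle (x, e) (x, e')

theorem Embedding.isRotation (σ : Embedding G) : IsRotation G σ.rot :=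
  ⟨σ.rot_of_not_inc, σ.rot_fst, σ.sameCycle⟩

theorem IsRotation.mem (hR : IsRotation G R) (hd : d ∈ darts G) : R d ∈ darts G :=
  mem_of_apply_mem (A := darts G) hR.of_not_inc hd

theorem IsRotation.inv (hR : IsRotation G R) : IsRotation G R⁻¹ where
  of_not_inc d hd := Perm.inv_eq_iff_eq.2 (hR.of_not_inc d hd).symm
  fst d := by rw [← hR.fst (R⁻¹ d), apply_inv_apply]
  sameCycle x e e' h h' := Perm.sameCycle_inv.2 (hR.sameCycle x e e' h h')

theorem IsRotation.support_finite (hR : IsRotation G R) (hfin : (darts G).Finite) :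
    {d | R d ≠ d}.Finite :=
  hfin.subset fun d hd => by
    by_contra hn
    exact hd (hR.of_not_inc d hn)

/-- The darts at a vertex form one cycle of the rotation, so a function that no step at this vertex
changes is constant there. -/
theorem IsRotation.const_at (hR : IsRotation G R) (hfin : (darts G).Finite) {Y : Type*}
    {f : α × β → Y} (hf : ∀ d ∈ darts G, d.1 = x → f (R d) = f d) {e e' : β} (he : G.Inc e x)
    (he' : G.Inc e' x) : f (x, e) = f (x, e') := by
  obtain ⟨n, hn⟩ := exists_pow_of_sameCycle (hR.support_finite hfin) (hR.sameCycle x e e' he he')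
  rw [← hn]
  clear hn
  suffices h : ∀ n : ℕ, (R ^ n) (x, e) ∈ darts G ∧ ((R ^ n) (x, e)).1 = x ∧
      f (x, e) = f ((R ^ n) (x, e)) from (h n).2.2
  intro n
  induction n with
  | zero => exact ⟨he, rfl, rfl⟩
  | succ n ih =>
    rw [pow_succ', Perm.mul_apply]
    exact ⟨hR.mem ih.1, (hR.fst _).trans ih.2.1, by rw [hf _ ih.1 ih.2.1, ih.2.2]⟩

theorem flip_of_isLink (h : G.IsLink e x y) : flip G (x, e) = (y, e) := by
  have hi : G.Inc e x := h.inc_left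
  have : flip G (x, e) = (hi.other, e) := dif_pos hi
  rw [this, hi.isLink_other.right_unique h]

theorem flip_of_not_inc (h : ¬ G.Inc d.2 d.1) : flip G d = d :=
  dif_neg h

theorem exists_flip_eq (hd : d ∈ darts G) : ∃ y, G.IsLink d.2 d.1 y ∧ flip G d = (y, d.2) := by
  obtain ⟨y, hy⟩ := hd
  exact ⟨y, hy, flip_of_isLink hy⟩

theorem flip_mem (hd : d ∈ darts G) : flip G d ∈ darts G := by
  obtain ⟨y, hy, h⟩ := exists_flip_eq hd
  rw [h]
  exact hy.inc_right

@[simp] theorem flip_flip (d : α × β) : flip G (flip G d) = d := by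
  by_cases hd : d ∈ darts G
  · obtain ⟨y, hy, h⟩ := exists_flip_eq hd
    rw [h, flip_of_isLink hy.symm]
  · rw [flip_of_not_inc hd, flip_of_not_inc hd]

theorem flip_eq_of_le (h : H ≤ G) (hd : d ∈ darts H) : flip H d = flip G d := by
  obtain ⟨y, hy, h'⟩ := exists_flip_eq hd
  rw [h', ← flip_of_isLink (hy.mono h)]

/-- The boundary of a chain modulo two at a vertex. -/
noncomputable def bd (G : Graph α β) (C : β → ZMod 2) (v : α) : ZMod 2 :=
  open Classical in ∑ᶠ e, if G.Inc e v then C e else 0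

/-- The colouring `f` of the corners of a rotation system (where the colour of a dart is the colour
of the corner just before it) changes exactly along the edges of the chain `C`, both around
vertices and across edges. -/
def IsColouring (G : Graph α β) (R : Perm (α × β)) (C : β → ZMod 2) (f : α × β → ZMod 2) : Prop :=
  ∀ d ∈ darts G, f (R d) = f d + C d.2 ∧ f (flip G d) = f d + C d.2

/-- A rotation system is planar if all cycles modulo two separate the faces in two classes. -/
def Planar (G : Graph α β) (R : Perm (α × β)) : Prop :=
  ∀ C : β → ZMod 2, (∀ v ∈ G.vertexSet, bd G C v = 0) → ∃ f, IsColouring G R C f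

theorem zmod_add_self (a : ZMod 2) : a + a = 0 := CharTwo.add_self_eq_zero a

theorem zmod_cases (a : ZMod 2) : a = 0 ∨ a = 1 := by
  revert a; decide

theorem Planar.inv (hR : IsRotation G R) (h : Planar G R) : Planar G R⁻¹ := by
  intro C hC
  obtain ⟨f, hf⟩ := h C hC
  -- After reversal, the corner before a dart is the one that used to be after it, and this has the
  -- colour of the dart at the other end.
  refine ⟨fun d => f (flip G d), fun d hd => ⟨?_, ?_⟩⟩
  · have hd' := hR.inv.mem hd
    obtain ⟨h1, h2⟩ := hf _ hd'
    obtain ⟨h3, h4⟩ := hf _ hd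
    rw [apply_inv_apply] at h1
    dsimp only
    rw [h2, h4, ← h1, add_assoc, zmod_add_self, add_zero]
  · have := (hf d hd).2
    simp only [flip_flip]
    rw [this, add_assoc, zmod_add_self, add_zero]

theorem bd_support_finite (hE : G.edgeSet.Finite) (C : β → ZMod 2) (v : α) :
    (Function.support fun e => open Classical in if G.Inc e v then C e else 0).Finite := by
  refine hE.subset fun e he => ?_
  by_contra hn
  apply he
  simp only [ite_eq_right_iff]
  intro h
  exact absurd h.edge_mem hn

theorem bd_add (hE : G.edgeSet.Finite) (C D : β → ZMod 2) (v : α) :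
    bd G (C + D) v = bd G C v + bd G D v := by
  classical
  unfold bd
  rw [← finsum_add_distrib (bd_support_finite hE C v) (bd_support_finite hE D v)]
  refine finsum_congr fun e => ?_
  split_ifs <;> simp

theorem bd_congr {C D : β → ZMod 2} {v : α} (h : ∀ e, G.Inc e v → C e = D e) :
    bd G C v = bd G D v := by
  classical
  unfold bd
  refine finsum_congr fun e => ?_
  split_ifs with he
  · exact h e he
  · rfl

theorem bd_eq_zero {C : β → ZMod 2} {v : α} (h : ∀ e, G.Inc e v → C e = 0) : bd G C v = 0 := by
  classical
  unfold bd
  refine (finsum_congr fun e => ?_).trans finsum_zero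
  split_ifs with he
  · exact h e he
  · rfl

theorem bd_mono (hHG : H ≤ G) {C : β → ZMod 2} (hC : ∀ e ∉ H.edgeSet, C e = 0) (v : α) :
    bd G C v = bd H C v := by
  classical
  unfold bd
  refine finsum_congr fun e => ?_
  by_cases he : e ∈ H.edgeSet
  · rw [Graph.IsSubgraph.inc_congr hHG he]
  · rw [hC e he]; simp

theorem bd_single [DecidableEq β] (e : β) (v : α) :
    bd G (Pi.single e 1) v = open Classical in if G.Inc e v then 1 else 0 := by
  classical
  unfold bd
  rw [finsum_eq_single _ e]
  · simp
  · intro e' he'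
    simp [Pi.single_eq_of_ne he']

theorem bd_eq_sum (hE : G.edgeSet.Finite) (C : β → ZMod 2) (v : α) :
    bd G C v = open Classical in ∑ e ∈ hE.toFinset, if G.Inc e v then C e else 0 := by
  classical
  unfold bd
  refine finsum_eq_sum_of_support_subset _ fun e he => ?_
  by_contra hn
  apply he
  simp only [ite_eq_right_iff]
  intro h
  exact absurd (by simpa using h.edge_mem) hn

/-- A chain that is the local change of a colouring has no boundary. -/
theorem bd_eq_zero_of_rotation (hE : G.edgeSet.Finite) (hR : IsRotation G R) {C : β → ZMod 2}
    {f : α × β → ZMod 2} {v : α} (hf : ∀ e, G.Inc e v → f (R (v, e)) = f (v, e) + C e) :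
    bd G C v = 0 := by
  classical
  have hfst : ∀ e, R (v, e) = (v, (R (v, e)).2) := fun e => Prod.ext (hR.fst _) rfl
  have hfst' : ∀ e, R⁻¹ (v, e) = (v, (R⁻¹ (v, e)).2) := fun e => Prod.ext (hR.inv.fst _) rfl
  let r : Perm β := ⟨fun e => (R (v, e)).2, fun e => (R⁻¹ (v, e)).2,
    fun e => by dsimp only; rw [← hfst, inv_apply_apply],
    fun e => by dsimp only; rw [← hfst', apply_inv_apply]⟩
  have hr : ∀ e, R (v, e) = (v, r e) := hfst
  have hrinc : ∀ e, G.Inc (r e) v ↔ G.Inc e v := by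
    intro e
    constructor
    · intro h
      by_contra hn
      have := hR.of_not_inc (v, e) hn
      rw [hr] at this
      simp only [Prod.mk.injEq, true_and] at this
      exact hn (this ▸ h)
    · intro h
      have := hR.mem (d := (v, e)) h
      rwa [hr] at this
  -- Each `C e` is the sum of the colours before and after `e`; reindexing by the rotation turns the
  -- second sum into the first.
  have key : bd G C v = bd G (fun e => f (v, e)) v + bd G (fun e => f (v, e)) v := by
    conv_rhs => lhs; unfold bd
    rw [← finsum_comp_equiv r]
    unfold bd
    rw [← finsum_add_distrib ?_ (bd_support_finite hE _ v)]
    · refine finsum_congr fun e => ?_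
      rw [hrinc]
      split_ifs with he
      · have := hf e he
        rw [hr] at this
        dsimp only
        rw [this, add_right_comm, zmod_add_self, zero_add]
      · simp
    · refine hE.subset fun e he => ?_
      by_contra hn
      apply he
      simp only [ite_eq_right_iff]
      intro h
      exact absurd ((hrinc e).1 h).edge_mem hn
  rw [key, zmod_add_self]

theorem connected_induction (hG : G.toSimpleGraph.Connected) {p : α → Prop} {x : α}
    (hx : x ∈ G.vertexSet) (hpx : p x) (hp : ∀ e x y, G.IsLink e x y → p x → p y) :
    ∀ y ∈ G.vertexSet, p y := by
  intro y hy
  obtain ⟨w⟩ := hG.preconnected ⟨x, hx⟩ ⟨y, hy⟩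
  have : ∀ (u v : G.vertexSet), G.toSimpleGraph.Walk u v → p u → p v := by
    intro u v w
    induction w with
    | nil => exact id
    | cons h _ ih =>
      intro hu
      obtain ⟨-, e, he⟩ := h
      exact ih (hp e _ _ he hu)
  exact this _ _ w hpx

theorem invariant_const (hR : IsRotation G R) (hfin : (darts G).Finite)
    (hG : G.toSimpleGraph.Connected) {Y : Type*} {f : α × β → Y}
    (h1 : ∀ d ∈ darts G, f (R d) = f d) (h2 : ∀ d ∈ darts G, f (flip G d) = f d)
    (hd : d ∈ darts G) (hd' : d' ∈ darts G) : f d = f d' := by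
  have hat : ∀ {x : α} {e e' : β}, G.Inc e x → G.Inc e' x → f (x, e) = f (x, e') :=
    fun he he' => hR.const_at hfin (fun d hd _ => h1 d hd) he he'
  refine connected_induction hG (x := d.1) (p := fun y => ∀ e, G.Inc e y → f d = f (y, e))
    hd.vertex_mem (fun e he => hat hd he) ?_ d'.1 hd'.vertex_mem d'.2 hd'
  intro e x y hxy hx e' he'
  rw [hx e hxy.inc_left, hat he' hxy.inc_right, ← h2 _ (show (x, e) ∈ darts G from hxy.inc_left),
    flip_of_isLink hxy]

theorem IsColouring.add {C D : β → ZMod 2} {f g : α × β → ZMod 2} (hf : IsColouring G R C f)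
    (hg : IsColouring G R D g) : IsColouring G R (C + D) (f + g) := by
  intro d hd
  simp only [Pi.add_apply, (hf d hd).1, (hf d hd).2, (hg d hd).1, (hg d hd).2]
  constructor <;> abel

theorem IsColouring.add_const {C : β → ZMod 2} {f : α × β → ZMod 2} (hf : IsColouring G R C f)
    (a : ZMod 2) : IsColouring G R C (fun d => f d + a) := by
  intro d hd
  simp only [(hf d hd).1, (hf d hd).2]
  constructor <;> abel

/-- The sum of two colourings for the same chain changes nowhere, so by connectedness it is
constant. -/
theorem IsColouring.unique (hR : IsRotation G R) (hfin : (darts G).Finite)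
    (hG : G.toSimpleGraph.Connected) {C : β → ZMod 2} {f g : α × β → ZMod 2}
    (hf : IsColouring G R C f) (hg : IsColouring G R C g) (hd : d ∈ darts G)
    (hd' : d' ∈ darts G) : f d + g d = f d' + g d' := by
  refine invariant_const (f := fun d => f d + g d) hR hfin hG (fun d hd => ?_) (fun d hd => ?_)
    hd hd'
  · simp only [(hf d hd).1, (hg d hd).1]
    rw [add_add_add_comm, zmod_add_self, add_zero]
  · simp only [(hf d hd).2, (hg d hd).2]
    rw [add_add_add_comm, zmod_add_self, add_zero]

theorem IsColouring.eq_of_first {A : Set (α × β)} {C : β → ZMod 2} {f : α × β → ZMod 2}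
    (hf : IsColouring G R C f) (hR : IsRotation G R) (hC : ∀ d ∈ darts G, d ∉ A → C d.2 = 0)
    (hd : d ∈ darts G) (h : First R A d d') : f d = f d' := by
  refine (h.induction_on (p := fun z => z ∈ darts G ∧ f d = f z) ⟨hd, rfl⟩ ?_).2
  rintro z hz ⟨hzG, hfz⟩
  exact ⟨hR.mem hzG, by rw [(hf z hzG).1, hC z hzG hz, add_zero, hfz]⟩

/-- The exponents differ by one: `ReturnsTo` starts its search at `R d`, whereas `Restricts` counts
from `d`. -/
theorem restricts_iff_returnsTo (hS : ∀ d ∉ darts H, S d = d) :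
    Restricts R H S ↔ ReturnsTo R (darts H) S := by
  constructor
  · intro h d hd
    obtain ⟨k, hk, he, hj⟩ := h d hd
    obtain ⟨k, rfl⟩ := Nat.exists_eq_succ_of_ne_zero hk.ne'
    have := First.of_pow (R := R) (A := darts H) (x := R d) k ?_ ?_
    · rwa [← Perm.mul_apply, ← pow_succ, ← he] at this
    · rw [← Perm.mul_apply, ← pow_succ, ← he]
      exact mem_of_apply_mem hS hd
    · intro j hjk
      rw [← Perm.mul_apply, ← pow_succ]
      exact hj (j + 1) (by omega) (by omega)
  · intro h d hd
    obtain ⟨k, hk, hj⟩ := (h d hd).exists_pow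
    refine ⟨k + 1, by omega, by rw [pow_succ, Perm.mul_apply, hk], fun j hj0 hjk => ?_⟩
    obtain ⟨j, rfl⟩ := Nat.exists_eq_succ_of_ne_zero hj0.ne'
    have := hj j (by omega)
    rwa [← Perm.mul_apply, ← pow_succ] at this

end Colouring

/-! ### Euler's formula and planarity -/

section Euler

variable {α : Type*} {β : Type*} {G : Graph α β} {R : Perm (α × β)}

theorem finite_faces (hfin : (darts G).Finite) (R : Perm (α × β)) : (faces G R).Finite := by
  refine (hfin.image fun d => {d' | (R * flip G).SameCycle d d'}).subset ?_
  rintro O ⟨d, hd, rfl⟩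
  exact ⟨d, hd, rfl⟩

/-- A function on darts that is invariant under the face permutation is constant on faces. -/
theorem face_const (hR : IsRotation G R) (hfin : (darts G).Finite) {Y : Type*} {f : α × β → Y}
    (hf : ∀ d ∈ darts G, f (R (flip G d)) = f d) {d d' : α × β} (hd : d ∈ darts G)
    (h : (R * flip G).SameCycle d d') : f d = f d' := by
  have hsupp : {d | (R * flip G) d ≠ d}.Finite := hfin.subset fun d hd => by
    by_contra hn
    apply hd
    rw [Perm.mul_apply, flip_of_not_inc hn, hR.of_not_inc _ hn]
  obtain ⟨n, rfl⟩ := exists_pow_of_sameCycle hsupp h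
  suffices h : ∀ n : ℕ, ((R * flip G) ^ n) d ∈ darts G ∧ f d = f (((R * flip G) ^ n) d) from
    (h n).2
  intro n
  induction n with
  | zero => exact ⟨hd, rfl⟩
  | succ n ih =>
    rw [pow_succ', Perm.mul_apply]
    exact ⟨hR.mem (flip_mem ih.1), by rw [Perm.mul_apply, hf _ ih.1, ih.2]⟩

theorem finrank_ker_eq_one {ι : Type*} [Nonempty ι] {W : Type*} [AddCommGroup W]
    [Module (ZMod 2) W] (L : (ι → ZMod 2) →ₗ[ZMod 2] W) (h1 : L (fun _ => 1) = 0)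
    (h : ∀ f, L f = 0 → ∀ i j, f i = f j) : Module.finrank (ZMod 2) (LinearMap.ker L) = 1 := by
  obtain ⟨i₀⟩ := ‹Nonempty ι›
  refine finrank_eq_one (⟨fun _ => 1, h1⟩ : LinearMap.ker L) ?_ ?_
  · intro h0
    have := congrFun (congrArg Subtype.val h0) i₀
    simp at this
  · rintro ⟨f, hf⟩
    refine ⟨f i₀, Subtype.ext ?_⟩
    funext j
    simpa using h f hf i₀ j

/-- Let V, E, F count vertices, edges and faces. The cycle space, the kernel of the incidence matrix
`M`, has dimension E − V + 1, since the kernel of the transpose consists of the constants. Borders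
of sets of faces form the range of `δ`, of dimension F − 1 because the kernel of `δ` also consists
of the constants. Borders are cycles, so all cycles are borders exactly if the dimensions agree. An
edge is required because faces are orbits of darts: an isolated vertex would have none. -/
theorem euler_iff_planar (hV : G.vertexSet.Finite) (hE : G.edgeSet.Finite)
    (hloop : G.Loopless) (hG : G.toSimpleGraph.Connected) (hne : G.edgeSet.Nonempty)
    (hR : IsRotation G R) :
    G.vertexSet.ncard + (faces G R).ncard = G.edgeSet.ncard + 2 ↔ Planar G R := by
  classical
  have hfin := finite_darts hV hE
  have := hV.fintype
  have := hE.fintype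
  have := (finite_faces hfin R).fintype
  have hends : ∀ e : G.edgeSet, ∃ x y, G.IsLink e x y := fun e =>
    Graph.exists_isLink_of_mem_edgeSet e.2
  choose a b hab using hends
  let face : ∀ d : darts G, faces G R := fun d =>
    ⟨{d' | (R * flip G).SameCycle d.1 d'}, d.1, d.2, rfl⟩
  let fa : G.edgeSet → faces G R := fun e => face ⟨(a e, e), (hab e).inc_left⟩
  let fb : G.edgeSet → faces G R := fun e => face ⟨(b e, e), (hab e).inc_right⟩
  obtain ⟨M, hM⟩ : ∃ M : Matrix G.vertexSet G.edgeSet (ZMod 2),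
      ∀ v e, M v e = if G.Inc e v then 1 else 0 := ⟨fun v e => _, fun v e => rfl⟩
  let δ : (faces G R → ZMod 2) →ₗ[ZMod 2] (G.edgeSet → ZMod 2) :=
    { toFun := fun f e => f (fa e) + f (fb e)
      map_add' := fun f g => by funext e; simp only [Pi.add_apply]; abel
      map_smul' := fun c f => by
        funext e; simp only [Pi.smul_apply, smul_eq_mul, RingHom.id_apply]; ring }
  have hface : ∀ (d d' : darts G), (R * flip G).SameCycle d.1 d'.1 → face d = face d' := by
    intro d d' h
    apply Subtype.ext
    ext z
    exact ⟨fun hz => h.symm.trans hz, fun hz => h.trans hz⟩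
  -- coboundary of vertex functions
  have hMT : ∀ (g : G.vertexSet → ZMod 2) (e : G.edgeSet),
      M.transpose.mulVecLin g e = g ⟨a e, (hab e).left_mem⟩ + g ⟨b e, (hab e).right_mem⟩ := by
    intro g e
    have hne : a e ≠ b e := fun h => hloop.not_isLoopAt e (a e) (by
      have := hab e; rw [← h] at this; exact this)
    have hne' : (⟨a e, (hab e).left_mem⟩ : G.vertexSet) ≠ ⟨b e, (hab e).right_mem⟩ :=
      fun h => hne (congrArg Subtype.val h)
    rw [← Finset.sum_pair hne']
    simp only [Matrix.mulVecLin_apply, Matrix.mulVec, dotProduct, Matrix.transpose_apply, hM,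
      ite_mul, one_mul, zero_mul]
    rw [← Finset.sum_filter]
    congr 1
    ext v
    simp only [Finset.mem_filter, Finset.mem_univ, true_and, Finset.mem_insert,
      Finset.mem_singleton]
    constructor
    · intro h
      exact (h.eq_or_eq_of_isLink (hab e)).imp Subtype.ext Subtype.ext
    · rintro (rfl | rfl)
      · exact (hab e).inc_left
      · exact (hab e).inc_right
  have hMbd : ∀ (C : β → ZMod 2) (v : G.vertexSet),
      M.mulVecLin (fun e => C e) v = bd G C v := by
    intro C v
    rw [bd_eq_sum hE]
    simp only [Matrix.mulVecLin_apply, Matrix.mulVec, dotProduct, hM, ite_mul, one_mul, zero_mul]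
    exact (Finset.sum_subtype hE.toFinset (fun e => by simp)
      (fun e => if G.Inc e v then C e else 0)).symm
  obtain ⟨e₀, he₀⟩ := hne
  have hnV : Nonempty G.vertexSet := ⟨⟨a ⟨e₀, he₀⟩, (hab _).left_mem⟩⟩
  have hnF : Nonempty (faces G R) := ⟨fa ⟨e₀, he₀⟩⟩
  have kMT : Module.finrank (ZMod 2) (LinearMap.ker M.transpose.mulVecLin) = 1 := by
    refine finrank_ker_eq_one _ ?_ ?_
    · funext e
      rw [hMT]
      exact zmod_add_self 1
    · intro g hg i j
      refine connected_induction hG (x := i.1)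
        (p := fun y => ∀ h : y ∈ G.vertexSet, g i = g ⟨y, h⟩) i.2 (fun _ => rfl) ?_ j.1 j.2 j.2
      intro e x y hxy hx hy
      rw [hx hxy.left_mem]
      have h0 := congrFun hg ⟨e, hxy.edge_mem⟩
      rw [hMT, Pi.zero_apply] at h0
      have h1 := CharTwo.add_eq_zero.1 h0
      rcases (hab ⟨e, hxy.edge_mem⟩).eq_and_eq_or_eq_and_eq hxy with ⟨h2, h3⟩ | ⟨h2, h3⟩
      · simpa only [h2, h3] using h1
      · simpa only [h2, h3] using h1.symm
  -- invariant functions of darts from functions of faces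
  have hinv : ∀ (f : faces G R → ZMod 2) (d : darts G),
      f (face ⟨R (flip G d.1), hR.mem (flip_mem d.2)⟩) = f (face d) := by
    intro f d
    rw [hface]
    exact (Perm.sameCycle_apply_left (f := R * flip G)).2 (.refl _ _)
  have hδ : ∀ (f : faces G R → ZMod 2) (d : darts G),
      δ f ⟨d.1.2, d.2.edge_mem⟩ = f (face d) + f (face ⟨flip G d.1, flip_mem d.2⟩) := by
    rintro f ⟨⟨x, e⟩, hd⟩
    obtain ⟨y, hy⟩ := id hd
    have h1 : flip G (x, e) = (y, e) := flip_of_isLink hy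
    simp only [h1]
    change f (fa ⟨e, _⟩) + f (fb ⟨e, _⟩) = _
    simp only [fa, fb]
    rcases (hab ⟨e, hy.edge_mem⟩).eq_and_eq_or_eq_and_eq hy with ⟨h2, h3⟩ | ⟨h2, h3⟩
    · simp only [h2, h3]
    · simp only [h2, h3]
      rw [add_comm]
  have kδ : Module.finrank (ZMod 2) (LinearMap.ker δ) = 1 := by
    refine finrank_ker_eq_one _ ?_ ?_
    · funext e
      exact zmod_add_self 1
    · rintro f hf ⟨_, d, hd, rfl⟩ ⟨_, d', hd', rfl⟩
      have hfl : ∀ d : darts G, f (face ⟨flip G d.1, flip_mem d.2⟩) = f (face d) := by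
        intro d
        have := hδ f d
        rw [hf, Pi.zero_apply] at this
        exact (CharTwo.add_eq_zero.1 this.symm).symm
      let F : α × β → ZMod 2 := fun d => if h : d ∈ darts G then f (face ⟨d, h⟩) else 0
      have hF : ∀ d (h : d ∈ darts G), F d = f (face ⟨d, h⟩) := fun d h => dif_pos h
      have := invariant_const hR hfin hG (f := F) (d := d) (d' := d') ?_ ?_ hd hd'
      · rw [hF d hd, hF d' hd'] at this
        exact this
      · intro d hd
        rw [hF _ (hR.mem hd), hF d hd]
        have h1 := hinv f ⟨flip G d, flip_mem hd⟩
        simp only [flip_flip] at h1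
        rw [h1, hfl ⟨d, hd⟩]
      · intro d hd
        rw [hF _ (flip_mem hd), hF d hd, hfl ⟨d, hd⟩]
  -- Going once around a vertex, the face colour changes an even number of times.
  have hle : LinearMap.range δ ≤ LinearMap.ker M.mulVecLin := by
    rintro _ ⟨f, rfl⟩
    rw [LinearMap.mem_ker]
    funext v
    let C : β → ZMod 2 := fun e => if h : e ∈ G.edgeSet then δ f ⟨e, h⟩ else 0
    have hC : ∀ e (h : e ∈ G.edgeSet), C e = δ f ⟨e, h⟩ := fun e h => dif_pos h
    have : δ f = fun e : G.edgeSet => C e := by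
      funext e
      rw [hC e.1 e.2]
    rw [this, hMbd]
    let F : α × β → ZMod 2 := fun d => if h : d ∈ darts G then f (face ⟨d, h⟩) else 0
    have hF : ∀ d (h : d ∈ darts G), F d = f (face ⟨d, h⟩) := fun d h => dif_pos h
    refine bd_eq_zero_of_rotation hE hR (f := F) fun e he => ?_
    have hd : (v.1, e) ∈ darts G := he
    rw [hF _ hd, hF _ (hR.mem hd), hC e he.edge_mem, hδ f ⟨_, hd⟩, ← add_assoc, zmod_add_self,
      zero_add]
    have h1 := hinv f ⟨flip G (v.1, e), flip_mem hd⟩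
    simp only [flip_flip] at h1
    exact h1
  -- Colourings of corners are invariant under the face permutation, so they are the same as
  -- functions on faces.
  have hplanar : Planar G R ↔ LinearMap.ker M.mulVecLin ≤ LinearMap.range δ := by
    constructor
    · intro h c hc
      let C : β → ZMod 2 := fun e => if h : e ∈ G.edgeSet then c ⟨e, h⟩ else 0
      have hC : ∀ e (h : e ∈ G.edgeSet), C e = c ⟨e, h⟩ := fun e h => dif_pos h
      have hCc : (fun e : G.edgeSet => C e) = c := funext fun e => hC e.1 e.2
      obtain ⟨f, hf⟩ := h C fun v hv => by
        rw [← hMbd C ⟨v, hv⟩, hCc, hc]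
        rfl
      have hff : ∀ d ∈ darts G, f (R (flip G d)) = f d := by
        intro d hd
        have h1 := (hf _ (flip_mem hd)).1
        have h2 := (hf _ hd).2
        obtain ⟨y, -, hy⟩ := exists_flip_eq hd
        rw [h1, h2, hy, add_assoc, zmod_add_self, add_zero]
      have hchoose : ∀ O : faces G R, ∃ d : darts G, face d = O := by
        rintro ⟨_, d, hd, rfl⟩
        exact ⟨⟨d, hd⟩, rfl⟩
      choose r hr using hchoose
      have hrf : ∀ d : darts G, f (r (face d)).1 = f d.1 := by
        intro d
        refine (face_const hR hfin hff d.2 ?_).symm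
        have : (r (face d)).1 ∈ (face (r (face d))).1 := Perm.SameCycle.refl _ _
        rw [hr] at this
        exact this
      refine ⟨fun O => f (r O).1, ?_⟩
      funext e
      have := hδ (fun O => f (r O).1) ⟨(a e, e), (hab e).inc_left⟩
      refine this.trans ?_
      rw [hrf, hrf]
      have h2 := (hf (a e, e) (hab e).inc_left).2
      rw [h2, ← add_assoc, zmod_add_self, zero_add]
      exact hC e.1 e.2
    · intro h C hC
      obtain ⟨f, hf⟩ := h (show (fun e : G.edgeSet => C e) ∈ _ from by
        rw [LinearMap.mem_ker]
        funext v
        rw [hMbd]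
        exact hC v.1 v.2)
      let F : α × β → ZMod 2 := fun d => if h : d ∈ darts G then f (face ⟨d, h⟩) else 0
      have hF : ∀ d (h : d ∈ darts G), F d = f (face ⟨d, h⟩) := fun d h => dif_pos h
      have hfl : ∀ d ∈ darts G, F (flip G d) = F d + C d.2 := by
        intro d hd
        have := hδ f ⟨d, hd⟩
        rw [hf] at this
        rw [hF _ (flip_mem hd), hF d hd]
        dsimp only at this
        rw [this, ← add_assoc, zmod_add_self, zero_add]
      refine ⟨F, fun d hd => ⟨?_, hfl d hd⟩⟩
      rw [← hfl d hd, hF _ (hR.mem hd), hF _ (flip_mem hd)]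
      have h1 := hinv f ⟨flip G d, flip_mem hd⟩
      simp only [flip_flip] at h1
      exact h1
  have r1 := LinearMap.finrank_range_add_finrank_ker M.transpose.mulVecLin
  have r2 := LinearMap.finrank_range_add_finrank_ker M.mulVecLin
  have r3 := LinearMap.finrank_range_add_finrank_ker δ
  have r4 : Module.finrank (ZMod 2) (LinearMap.range M.transpose.mulVecLin) =
      Module.finrank (ZMod 2) (LinearMap.range M.mulVecLin) := Matrix.rank_transpose M
  rw [kMT] at r1
  rw [kδ] at r3
  rw [Module.finrank_fintype_fun_eq_card] at r1 r2 r3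
  rw [← Nat.card_coe_set_eq, ← Nat.card_coe_set_eq, ← Nat.card_coe_set_eq,
    Nat.card_eq_fintype_card, Nat.card_eq_fintype_card, Nat.card_eq_fintype_card, hplanar]
  constructor
  · intro h
    refine (Submodule.eq_of_le_of_finrank_eq hle ?_).ge
    omega
  · intro h
    have := le_antisymm hle h
    rw [this] at r3
    omega

end Euler

/-! ### Bridges -/

section Bridge

variable {α : Type*} {β : Type*} {G H Q : Graph α β} {R : Perm (α × β)}

/-- Two edges of `H` are in the same bridge of `Q` if they are connected outside the vertices
of `Q`. -/
def SameBridge (Q H : Graph α β) : β → β → Prop :=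
  Relation.ReflTransGen fun e e' => ∃ x, x ∉ Q.vertexSet ∧ H.Inc e x ∧ H.Inc e' x

theorem SameBridge.symm {e e' : β} (h : SameBridge Q H e e') : SameBridge Q H e' e := by
  induction h with
  | refl => exact .refl
  | tail _ h ih =>
    obtain ⟨x, hx, h1, h2⟩ := h
    exact .head ⟨x, hx, h2, h1⟩ ih

theorem SameBridge.trans {e e' e'' : β} (h : SameBridge Q H e e') (h' : SameBridge Q H e' e'') :
    SameBridge Q H e e'' := Relation.ReflTransGen.trans h h'

theorem sameBridge_of_inc {e e' : β} {x : α} (hx : x ∉ Q.vertexSet) (he : H.Inc e x)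
    (he' : H.Inc e' x) : SameBridge Q H e e' := .single ⟨x, hx, he, he'⟩

theorem notMem_edgeSet_of_inc (hQ : Q ≤ H) {e : β} {x : α} (hx : x ∉ Q.vertexSet)
    (he : H.Inc e x) : e ∉ Q.edgeSet := fun h =>
  hx ((Graph.IsSubgraph.inc_congr hQ h).2 he).vertex_mem

theorem SameBridge.notMem_edgeSet (hQ : Q ≤ H) {e e' : β} (h : SameBridge Q H e e')
    (he : e ∉ Q.edgeSet) : e' ∉ Q.edgeSet := by
  induction h with
  | refl => exact he
  | tail _ h _ =>
    obtain ⟨x, hx, -, h'⟩ := h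
    exact notMem_edgeSet_of_inc hQ hx h'

theorem IsColouring.eq_of_inc {C : β → ZMod 2} {f : α × β → ZMod 2} (hf : IsColouring H R C f)
    {e : β} (hC : C e = 0) {x y : α} (hx : H.Inc e x) (hy : H.Inc e y) : f (x, e) = f (y, e) := by
  obtain ⟨z, hz⟩ := hx
  rcases hy.eq_or_eq_of_isLink hz with rfl | rfl
  · rfl
  · have := (hf (x, e) hz.inc_left).2
    rw [flip_of_isLink hz, hC, add_zero] at this
    exact this.symm

/-- A colouring that does not change along edges outside `Q` is constant on bridges of `Q`. -/
theorem IsColouring.eq_of_sameBridge (hR : IsRotation H R) (hfin : (darts H).Finite) (hQ : Q ≤ H)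
    {C : β → ZMod 2} {f : α × β → ZMod 2} (hf : IsColouring H R C f)
    (hC : ∀ e ∉ Q.edgeSet, C e = 0) {e e' : β} (h : SameBridge Q H e e') (he : e ∉ Q.edgeSet)
    {x x' : α} (hx : H.Inc e x) (hx' : H.Inc e' x') : f (x, e) = f (x', e') := by
  induction h generalizing x' with
  | refl => exact hf.eq_of_inc (hC e he) hx hx'
  | @tail e₁ e₂ _ h ih =>
    obtain ⟨y, hy, h1, h2⟩ := h
    rw [ih h1, hR.const_at hfin (f := f) (x := y) ?_ h1 h2,
      hf.eq_of_inc (hC e₂ (notMem_edgeSet_of_inc hQ hy h2)) h2 hx']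
    rintro ⟨z, e₃⟩ hd rfl
    rw [(hf _ hd).1, hC _ (notMem_edgeSet_of_inc hQ hy hd), add_zero]

end Bridge

/-! ### Cyclic successors -/

section Cyclic

variable {n : ℕ}

/-- The cyclic successor. -/
def nxt (t : Fin n) : Fin n := finRotate n t

theorem val_nxt (t : Fin n) : (nxt t : ℕ) = (t + 1) % n := by
  have := t.neZero
  rw [nxt, finRotate_apply, Fin.val_add, Fin.val_one', Nat.add_mod_mod]

theorem val_iterate_nxt (t : Fin n) (j : ℕ) : (nxt^[j] t : ℕ) = (t + j) % n := by
  induction j with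
  | zero => exact (Nat.mod_eq_of_lt t.isLt).symm
  | succ j ih =>
    rw [Function.iterate_succ_apply', val_nxt, ih, Nat.mod_add_mod, add_assoc]

theorem nxt_injective : Function.Injective (nxt : Fin n → Fin n) := (finRotate n).injective

theorem exists_nxt_eq (t : Fin n) : ∃ u, nxt u = t := (finRotate n).surjective t

theorem iterate_nxt_ne (t : Fin n) {j k : ℕ} (hjk : j < k) (hk : k < n + j) :
    nxt^[j] t ≠ nxt^[k] t := by
  intro h
  have h1 := congrArg Fin.val h
  rw [val_iterate_nxt, val_iterate_nxt] at h1
  have h2 : t + j ≡ t + k [MOD n] := h1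
  have h3 : j ≡ k [MOD n] := Nat.ModEq.add_left_cancel' _ h2
  have h4 := (Nat.modEq_iff_dvd' hjk.le).1 h3
  have := Nat.le_of_dvd (by omega) h4
  omega

theorem exists_iterate_nxt (t u : Fin n) : ∃ j < n, nxt^[j] t = u := by
  have ht := t.isLt
  have hu := u.isLt
  by_cases h : t.val ≤ u.val
  · refine ⟨u - t, by omega, Fin.ext ?_⟩
    rw [val_iterate_nxt, Nat.add_sub_cancel' h, Nat.mod_eq_of_lt hu]
  · refine ⟨u + n - t, by omega, Fin.ext ?_⟩
    rw [val_iterate_nxt, Nat.add_sub_cancel' (by omega), Nat.add_mod_right, Nat.mod_eq_of_lt hu]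

theorem nxt_ne (hn : 2 ≤ n) (t : Fin n) : nxt t ≠ t :=
  (iterate_nxt_ne t (j := 0) (k := 1) (by omega) (by omega)).symm

theorem nxt_nxt_ne (hn : 3 ≤ n) (t : Fin n) : nxt (nxt t) ≠ t :=
  (iterate_nxt_ne t (j := 0) (k := 2) (by omega) (by omega)).symm

theorem iterate_nxt_self (t : Fin n) : nxt^[n] t = t := Fin.ext <| by
  rw [val_iterate_nxt, Nat.add_mod_right, Nat.mod_eq_of_lt t.isLt]

end Cyclic

/-! ### Planets -/

section Wheel

variable {α : Type*} {β : Type*} {m : ℕ} (P : Planet α β m) {G : Graph α β} {e : β}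
  {t u : Fin (4 * m)}

theorem Planet.isLink_spoke (t : Fin (4 * m)) :
    P.graph.IsLink (P.spoke t) P.centre (P.surface t) := Or.inl ⟨t, rfl, rfl⟩

theorem Planet.isLink_rim (t : Fin (4 * m)) :
    P.graph.IsLink (P.rim t) (P.surface t) (P.surface (nxt t)) := Or.inr ⟨t, rfl, rfl⟩

theorem Planet.surface_mem (t : Fin (4 * m)) : P.surface t ∈ P.graph.vertexSet := Or.inr ⟨t, rfl⟩

theorem Planet.centre_mem : P.centre ∈ P.graph.vertexSet := Or.inl rfl

theorem Planet.spoke_mem (t : Fin (4 * m)) : P.spoke t ∈ P.graph.edgeSet := Or.inl ⟨t, rfl⟩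

theorem Planet.rim_mem (t : Fin (4 * m)) : P.rim t ∈ P.graph.edgeSet := Or.inr ⟨t, rfl⟩

theorem Planet.inc_spoke {x : α} :
    P.graph.Inc (P.spoke t) x ↔ x = P.centre ∨ x = P.surface t := by
  constructor
  · intro h
    exact h.eq_or_eq_of_isLink (P.isLink_spoke t)
  · rintro (rfl | rfl)
    · exact (P.isLink_spoke t).inc_left
    · exact (P.isLink_spoke t).inc_right

theorem Planet.inc_rim {x : α} :
    P.graph.Inc (P.rim t) x ↔ x = P.surface t ∨ x = P.surface (nxt t) := by
  constructor
  · intro h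
    exact h.eq_or_eq_of_isLink (P.isLink_rim t)
  · rintro (rfl | rfl)
    · exact (P.isLink_rim t).inc_left
    · exact (P.isLink_rim t).inc_right

theorem Planet.inc_centre : P.graph.Inc e P.centre ↔ ∃ t, e = P.spoke t := by
  constructor
  · intro h
    rcases h.edge_mem with ⟨t, rfl⟩ | ⟨t, rfl⟩
    · exact ⟨t, rfl⟩
    · rcases P.inc_rim.1 h with h | h
      · exact absurd h.symm (P.surface_ne_centre _)
      · exact absurd h.symm (P.surface_ne_centre _)
  · rintro ⟨t, rfl⟩
    exact (P.isLink_spoke t).inc_left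

theorem Planet.inc_surface : P.graph.Inc e (P.surface (nxt t)) ↔
    e = P.spoke (nxt t) ∨ e = P.rim (nxt t) ∨ e = P.rim t := by
  constructor
  · intro h
    rcases h.edge_mem with ⟨u, rfl⟩ | ⟨u, rfl⟩
    · rcases P.inc_spoke.1 h with h | h
      · exact absurd h (P.surface_ne_centre _)
      · rw [P.surface_injective h]
        exact Or.inl rfl
    · rcases P.inc_rim.1 h with h | h
      · rw [P.surface_injective h]
        exact Or.inr (Or.inl rfl)
      · rw [nxt_injective (P.surface_injective h)]
        exact Or.inr (Or.inr rfl)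
  · rintro (rfl | rfl | rfl)
    · exact P.inc_spoke.2 (Or.inr rfl)
    · exact P.inc_rim.2 (Or.inl rfl)
    · exact P.inc_rim.2 (Or.inr rfl)

variable {P}

theorem Planet.inc_spoke' (hP : P.graph ≤ G) {x : α} :
    G.Inc (P.spoke t) x ↔ x = P.centre ∨ x = P.surface t := by
  rw [← Graph.IsSubgraph.inc_congr hP (P.spoke_mem t), P.inc_spoke]

theorem Planet.inc_rim' (hP : P.graph ≤ G) {x : α} :
    G.Inc (P.rim t) x ↔ x = P.surface t ∨ x = P.surface (nxt t) := by
  rw [← Graph.IsSubgraph.inc_congr hP (P.rim_mem t), P.inc_rim]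

variable (P)

/-- The indicator of the edges of the triangle at the `t`-th rim edge. -/
noncomputable def Planet.triangle (t : Fin (4 * m)) : β → ZMod 2 := by
  classical exact Pi.single (P.spoke t) 1 + Pi.single (P.spoke (nxt t)) 1 + Pi.single (P.rim t) 1

variable {P}

/-- The triangles at the rim edges are the test cycles for the faces of the wheel. -/
theorem Planet.bd_triangle (hm : 0 < m) (hP : P.graph ≤ G) (hE : G.edgeSet.Finite) (v : α) :
    bd G (P.triangle t) v = 0 := by
  classical
  have h1 : ∀ u, P.centre ≠ P.surface u := fun u => (P.surface_ne_centre u).symm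
  have h2 : P.surface t ≠ P.surface (nxt t) := fun h =>
    nxt_ne (by omega) t (P.surface_injective h).symm
  unfold Planet.triangle
  rw [bd_add hE, bd_add hE, bd_single, bd_single, bd_single]
  simp only [P.inc_spoke' hP, P.inc_rim' hP]
  by_cases hv : v = P.centre
  · subst hv
    simp only [h1, or_false, if_true, if_false, add_zero]
    exact zmod_add_self 1
  · by_cases hv1 : v = P.surface t
    · subst hv1
      simp only [hv, h2, or_false, or_true, if_true, if_false, add_zero]
      exact zmod_add_self 1
    · by_cases hv2 : v = P.surface (nxt t)
      · subst hv2
        simp only [hv, hv1, or_false, or_true, if_true, if_false, zero_add]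
        exact zmod_add_self 1
      · simp [hv, hv1, hv2]

theorem Planet.triangle_eq_zero (h1 : e ≠ P.spoke t) (h2 : e ≠ P.spoke (nxt t))
    (h3 : e ≠ P.rim t) : P.triangle t e = 0 := by
  unfold Planet.triangle
  simp [h1, h2, h3]

theorem Planet.triangle_of_notMem (h : e ∉ P.graph.edgeSet) : P.triangle t e = 0 :=
  P.triangle_eq_zero (fun h' => h (h' ▸ P.spoke_mem _)) (fun h' => h (h' ▸ P.spoke_mem _))
    (fun h' => h (h' ▸ P.rim_mem _))

theorem Planet.triangle_spoke (hm : 0 < m) : P.triangle t (P.spoke t) = 1 := by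
  unfold Planet.triangle
  have h2 : P.spoke t ≠ P.spoke (nxt t) := fun h =>
    nxt_ne (by omega) t (P.spoke_injective h).symm
  simp [h2, P.spoke_ne_rim]

theorem Planet.triangle_spoke_nxt (hm : 0 < m) : P.triangle t (P.spoke (nxt t)) = 1 := by
  unfold Planet.triangle
  have h2 : P.spoke (nxt t) ≠ P.spoke t := fun h =>
    nxt_ne (by omega) t (P.spoke_injective h)
  simp [h2, P.spoke_ne_rim]

theorem Planet.triangle_spoke_of_ne (h1 : u ≠ t) (h2 : u ≠ nxt t) :
    P.triangle t (P.spoke u) = 0 :=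
  P.triangle_eq_zero (fun h => h1 (P.spoke_injective h)) (fun h => h2 (P.spoke_injective h))
    (P.spoke_ne_rim _ _)

theorem Planet.triangle_rim : P.triangle t (P.rim t) = 1 := by
  unfold Planet.triangle
  have h2 : ∀ u, P.rim t ≠ P.spoke u := fun u => (P.spoke_ne_rim u t).symm
  simp [h2]

theorem Planet.triangle_rim_of_ne (h : u ≠ t) : P.triangle t (P.rim u) = 0 :=
  P.triangle_eq_zero (P.spoke_ne_rim _ _).symm (P.spoke_ne_rim _ _).symm
    (fun h' => h (P.rim_injective h'))

end Wheel

/-! ### The embedding of a planet -/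

section WheelRotation

variable {α : Type*} {β : Type*} {m : ℕ} {P : Planet α β m} {G H : Graph α β}
  {R S : Perm (α × β)}

/-- A planar rotation system on a finite connected graph that contains the planet `P`. -/
structure IsPlanarRotation (P : Planet α β m) (G : Graph α β) (R : Perm (α × β)) : Prop where
  pos : 0 < m
  planet_le : P.graph ≤ G
  finite_vertex : G.vertexSet.Finite
  finite_edge : G.edgeSet.Finite
  loopless : G.Loopless
  connected : G.toSimpleGraph.Connected
  rotation : IsRotation G R
  planar : Planar G R

theorem IsPlanarRotation.inv (h : IsPlanarRotation P G R) : IsPlanarRotation P G R⁻¹ :=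
  { h with rotation := h.rotation.inv, planar := h.planar.inv h.rotation }

theorem IsPlanarRotation.finite_darts (h : IsPlanarRotation P G R) : (darts G).Finite :=
  Housing.finite_darts h.finite_vertex h.finite_edge

theorem ReturnsTo.fst (hR : IsRotation G R) (hS : ∀ d ∉ darts H, S d = d)
    (h : ReturnsTo R (darts H) S) (d : α × β) : (S d).1 = d.1 := by
  by_cases hd : d ∈ darts H
  · exact (h d hd).induction_on (p := fun z => z.1 = d.1) (hR.fst d)
      fun z _ hz => (hR.fst z).trans hz
  · rw [hS d hd]

theorem notMem_edgeSet_of_notMem_darts (hHG : H ≤ G) {d : α × β} (hd : d ∈ darts G)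
    (hd' : d ∉ darts H) : d.2 ∉ H.edgeSet := fun h =>
  hd' ((Graph.IsSubgraph.inc_congr hHG h).2 hd)

theorem IsColouring.apply_returnsTo {C : β → ZMod 2} {f : α × β → ZMod 2}
    (hf : IsColouring G R C f) (hR : IsRotation G R) (hHG : H ≤ G)
    (hC : ∀ e ∉ H.edgeSet, C e = 0) (h : ReturnsTo R (darts H) S) {d : α × β}
    (hd : d ∈ darts H) : f (S d) = f d + C d.2 := by
  have hd' := darts_mono hHG hd
  rw [← (hf d hd').1]
  exact (hf.eq_of_first hR (fun d hd hd' => hC _ (notMem_edgeSet_of_notMem_darts hHG hd hd'))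
    (hR.mem hd') (h d hd)).symm

theorem Planet.centre_dart (P : Planet α β m) (t : Fin (4 * m)) :
    (P.centre, P.spoke t) ∈ darts P.graph := (P.isLink_spoke t).inc_left

theorem Planet.spoke_dart (P : Planet α β m) (t : Fin (4 * m)) :
    (P.surface t, P.spoke t) ∈ darts P.graph := (P.isLink_spoke t).inc_right

theorem Planet.rim_dart (P : Planet α β m) (t : Fin (4 * m)) :
    (P.surface t, P.rim t) ∈ darts P.graph := (P.isLink_rim t).inc_left

theorem Planet.rim_dart' (P : Planet α β m) (t : Fin (4 * m)) :
    (P.surface (nxt t), P.rim t) ∈ darts P.graph := (P.isLink_rim t).inc_right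

/-- The surface vertices outside the triangle form a path on the rim along which no colour change
occurs. They all see one side of the triangle, and this side can be given colour 0. -/
theorem IsPlanarRotation.exists_triangle_colouring (h : IsPlanarRotation P G R)
    (t : Fin (4 * m)) : ∃ f, IsColouring G R (P.triangle t) f ∧ ∀ u, u ≠ t → u ≠ nxt t →
      (∀ e, G.Inc e (P.surface u) → f (P.surface u, e) = 0) ∧ f (P.centre, P.spoke u) = 0 := by
  have hm := h.pos
  obtain ⟨f, hf⟩ := h.planar (P.triangle t)
    fun v _ => P.bd_triangle hm h.planet_le h.finite_edge v
  set a := f (P.surface (nxt (nxt t)), P.spoke (nxt (nxt t))) with ha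
  have hz : ∀ u, u ≠ t → u ≠ nxt t → ∀ e, G.Inc e (P.surface u) → P.triangle t e = 0 := by
    intro u hu hu' e he
    by_cases hP : e ∈ P.graph.edgeSet
    · have he' := (Graph.IsSubgraph.inc_congr h.planet_le hP).2 he
      obtain ⟨w, rfl⟩ := exists_nxt_eq u
      rcases P.inc_surface.1 he' with rfl | rfl | rfl
      · exact P.triangle_spoke_of_ne hu hu'
      · exact P.triangle_rim_of_ne hu
      · exact P.triangle_rim_of_ne fun hw => hu' (congrArg nxt hw)
    · exact P.triangle_of_notMem hP
  have hconst : ∀ u, u ≠ t → u ≠ nxt t → ∀ e e', G.Inc e (P.surface u) →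
      G.Inc e' (P.surface u) → f (P.surface u, e) = f (P.surface u, e') := by
    intro u hu hu' e e' he he'
    refine h.rotation.const_at h.finite_darts (fun d hd hdu => ?_) he he'
    have hd' := (hf d hd).1
    rwa [hz u hu hu' d.2 (hdu ▸ hd), add_zero] at hd'
  have hinc : ∀ {e x}, P.graph.Inc e x → G.Inc e x := fun he => he.mono h.planet_le
  -- The offset 2 skips both surface vertices of the triangle.
  have hchain : ∀ j, j + 2 < 4 * m →
      f (P.surface (nxt^[j + 2] t), P.spoke (nxt^[j + 2] t)) = a := by
    intro j
    induction j with
    | zero => intro _; rfl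
    | succ j ih =>
      intro hj
      have ih := ih (by omega)
      set u := nxt^[j + 2] t with hu
      have hu1 : nxt^[j + 1 + 2] t = nxt u :=
        Function.iterate_succ_apply' nxt (j + 2) t
      have h1 : u ≠ t := (iterate_nxt_ne t (j := 0) (by omega) (by omega)).symm
      have h2 : u ≠ nxt t := (iterate_nxt_ne t (j := 1) (by omega) (by omega)).symm
      have h3 : nxt u ≠ t := hu1 ▸ (iterate_nxt_ne t (j := 0) (by omega) (by omega)).symm
      have h4 : nxt u ≠ nxt t := hu1 ▸ (iterate_nxt_ne t (j := 1) (by omega) (by omega)).symm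
      rw [hu1, hconst (nxt u) h3 h4 _ _ (hinc (P.spoke_dart _)) (hinc (P.rim_dart' u)), ← ih,
        hconst u h1 h2 _ _ (hinc (P.spoke_dart _)) (hinc (P.rim_dart u))]
      have := (hf (P.surface u, P.rim u) (hinc (P.rim_dart u))).2
      rwa [flip_of_isLink ((P.isLink_rim u).mono h.planet_le), P.triangle_rim_of_ne h1,
        add_zero] at this
  -- Adding `a` normalises the colour to 0, as `a + a = 0`.
  refine ⟨fun d => f d + a, hf.add_const a, fun u hu hu' => ?_⟩
  have hs : f (P.surface u, P.spoke u) = a := by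
    obtain ⟨j, hj, rfl⟩ := exists_iterate_nxt t u
    rcases j with _ | _ | j
    · exact absurd rfl hu
    · exact absurd rfl hu'
    · exact hchain j hj
  constructor
  · intro e he
    simp only
    rw [hconst u hu hu' e _ he (hinc (P.spoke_dart u)), hs, zmod_add_self]
  · have := (hf (P.surface u, P.spoke u) (hinc (P.spoke_dart u))).2
    rw [flip_of_isLink ((P.isLink_spoke u).symm.mono h.planet_le), P.triangle_spoke_of_ne hu hu',
      add_zero, hs] at this
    simp only
    rw [this, zmod_add_self]

/-- The standard rotation system of a planet. -/
structure WheelRotation (P : Planet α β m) (S : Perm (α × β)) : Prop where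
  centre : ∀ t, S (P.centre, P.spoke t) = (P.centre, P.spoke (nxt t))
  rim : ∀ t, S (P.surface t, P.rim t) = (P.surface t, P.spoke t)
  spoke : ∀ t, S (P.surface (nxt t), P.spoke (nxt t)) = (P.surface (nxt t), P.rim t)
  prev : ∀ t, S (P.surface (nxt t), P.rim t) = (P.surface (nxt t), P.rim (nxt t))

/-- At the centre, the colouring of the `t`-th triangle changes just at its two spokes, and the
corners before all other spokes have colour 0. Hence these two spokes are consecutive, in one order
or the other. The order is the same for all triangles, since a spoke has one predecessor only. -/
theorem IsPlanarRotation.centre_cases (h : IsPlanarRotation P G R)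
    (hS : ∀ d ∉ darts P.graph, S d = d) (hret : ReturnsTo R (darts P.graph) S) :
    (∀ t, S (P.centre, P.spoke t) = (P.centre, P.spoke (nxt t))) ∨
      ∀ t, S (P.centre, P.spoke (nxt t)) = (P.centre, P.spoke t) := by
  have hm := h.pos
  have hν : ∀ t, ∃ u, S (P.centre, P.spoke t) = (P.centre, P.spoke u) := by
    intro t
    have h1 := hret.fst h.rotation hS (P.centre, P.spoke t)
    have h2 := hret.mem (P.centre_dart t)
    rw [mem_darts, h1, P.inc_centre] at h2
    obtain ⟨u, hu⟩ := h2
    exact ⟨u, Prod.ext h1 hu⟩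
  choose ν hν using hν
  have hinj : Function.Injective ν := by
    intro t u htu
    have : S (P.centre, P.spoke t) = S (P.centre, P.spoke u) := by rw [hν, hν, htu]
    exact P.spoke_injective (congrArg Prod.snd (S.injective this))
  have hsurj := Finite.surjective_of_injective hinj
  have key : ∀ t, ν t = nxt t ∨ ν (nxt t) = t := by
    intro t
    obtain ⟨f, hf, h0⟩ := h.exists_triangle_colouring t
    have hstep : ∀ u, f (P.centre, P.spoke (ν u)) =
        f (P.centre, P.spoke u) + P.triangle t (P.spoke u) := by
      intro u
      rw [← hν]
      exact hf.apply_returnsTo h.rotation h.planet_le (fun e he => P.triangle_of_notMem he) hret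
        (P.centre_dart u)
    -- Otherwise the corners before and after the `t`-th spoke would both have colour 0, although
    -- the colour changes there.
    by_contra! hcon
    obtain ⟨hc1, hc2⟩ := hcon
    have ht := hstep t
    rw [P.triangle_spoke hm] at ht
    have hne : ν t ≠ t := by
      intro h1
      rw [h1] at ht
      exact one_ne_zero (left_eq_add.1 ht)
    rw [(h0 _ hne hc1).2] at ht
    obtain ⟨w, hw⟩ := hsurj t
    have hwt : w ≠ t := fun h1 => hne (h1 ▸ hw)
    have hwt' : w ≠ nxt t := fun h1 => hc2 (h1 ▸ hw)
    have hw' := hstep w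
    rw [hw, (h0 w hwt hwt').2, P.triangle_spoke_of_ne hwt hwt', add_zero] at hw'
    rw [hw', zero_add] at ht
    exact zero_ne_one ht
  by_cases hex : ∃ t, ν t = nxt t
  · left
    obtain ⟨t₀, ht₀⟩ := hex
    have hstep : ∀ t, ν t = nxt t → ν (nxt t) = nxt (nxt t) := by
      intro t ht
      refine (key (nxt t)).resolve_right fun h1 => ?_
      exact nxt_nxt_ne (by omega) t (hinj (h1.trans ht.symm))
    intro t
    obtain ⟨j, -, rfl⟩ := exists_iterate_nxt t₀ t
    rw [hν]
    congr 2
    induction j with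
    | zero => exact ht₀
    | succ j ih =>
      rw [Function.iterate_succ_apply']
      exact hstep _ ih
  · right
    intro t
    rw [hν, (key t).resolve_left fun h1 => hex ⟨t, h1⟩]

/-- Once the direction at the centre is fixed, the colour 1 lies between the two spokes of the
triangle there. Propagating along spokes and rim edges yields the colours at the surface. -/
theorem IsPlanarRotation.exists_triangle_values (h : IsPlanarRotation P G R)
    (hret : ReturnsTo R (darts P.graph) S)
    (hc : ∀ t, S (P.centre, P.spoke t) = (P.centre, P.spoke (nxt t))) (t : Fin (4 * m)) :
    ∃ f, IsColouring G R (P.triangle t) f ∧ (∀ u, u ≠ t → u ≠ nxt t →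
      (∀ e, G.Inc e (P.surface u) → f (P.surface u, e) = 0) ∧ f (P.centre, P.spoke u) = 0) ∧
      f (P.centre, P.spoke t) = 0 ∧ f (P.centre, P.spoke (nxt t)) = 1 ∧
      f (P.surface t, P.spoke t) = 1 ∧ f (P.surface (nxt t), P.spoke (nxt t)) = 0 ∧
      f (P.surface (nxt t), P.rim (nxt t)) = 0 ∧
      ∀ w, nxt w = t → f (P.surface t, P.rim w) = 0 := by
  have hm := h.pos
  obtain ⟨f, hf, h0⟩ := h.exists_triangle_colouring t
  have hinc : ∀ {e x}, P.graph.Inc e x → G.Inc e x := fun he => he.mono h.planet_le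
  have hstep : ∀ d ∈ darts P.graph, f (S d) = f d + P.triangle t d.2 := fun d hd =>
    hf.apply_returnsTo h.rotation h.planet_le (fun e he => P.triangle_of_notMem he) hret hd
  have hspoke : ∀ u, f (P.surface u, P.spoke u) =
      f (P.centre, P.spoke u) + P.triangle t (P.spoke u) := by
    intro u
    rw [← flip_of_isLink ((P.isLink_spoke u).mono h.planet_le)]
    exact (hf _ (hinc (P.centre_dart u))).2
  have hrim : ∀ u, f (P.surface u, P.rim u) =
      f (P.surface (nxt u), P.rim u) + P.triangle t (P.rim u) := by
    intro u
    rw [← flip_of_isLink ((P.isLink_rim u).symm.mono h.planet_le)]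
    exact (hf _ (hinc (P.rim_dart' u))).2
  have e1 : nxt t ≠ t := nxt_ne (by omega) t
  have e2 : nxt (nxt t) ≠ t := nxt_nxt_ne (by omega) t
  have e3 : nxt (nxt t) ≠ nxt t := nxt_ne (by omega) _
  have a1 : f (P.centre, P.spoke (nxt t)) = 1 := by
    have := hstep _ (P.centre_dart (nxt t))
    rw [hc, (h0 _ e2 e3).2, P.triangle_spoke_nxt hm] at this
    exact CharTwo.add_eq_zero.1 this.symm
  have a2 : f (P.centre, P.spoke t) = 0 := by
    have := hstep _ (P.centre_dart t)
    rwa [hc, a1, P.triangle_spoke hm, right_eq_add] at this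
  refine ⟨f, hf, h0, a2, a1, ?_, ?_, ?_, ?_⟩
  · rw [hspoke, a2, P.triangle_spoke hm, zero_add]
  · rw [hspoke, a1, P.triangle_spoke_nxt hm, zmod_add_self]
  · rw [hrim, (h0 _ e2 e3).1 _ (hinc (P.rim_dart' _)), P.triangle_rim_of_ne e1, add_zero]
  · rintro w rfl
    have w1 : w ≠ nxt w := (nxt_ne (by omega) w).symm
    have w2 : w ≠ nxt (nxt w) := (nxt_nxt_ne (by omega) w).symm
    have := hrim w
    rw [(h0 w w1 w2).1 _ (hinc (P.rim_dart w)), P.triangle_rim_of_ne w1, add_zero] at this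
    exact this.symm

/-- A surface vertex has three planet darts. The colours for the triangles on its two sides
determine the predecessor and the successor of its spoke, and bijectivity leaves one value for the
third step. -/
theorem IsPlanarRotation.wheelRotation (h : IsPlanarRotation P G R)
    (hS : ∀ d ∉ darts P.graph, S d = d) (hret : ReturnsTo R (darts P.graph) S)
    (hc : ∀ t, S (P.centre, P.spoke t) = (P.centre, P.spoke (nxt t))) : WheelRotation P S := by
  have hm := h.pos
  have hsurf : ∀ (t : Fin (4 * m)) (e : β), P.graph.Inc e (P.surface (nxt t)) →
      ∃ e', S (P.surface (nxt t), e) = (P.surface (nxt t), e') ∧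
        (e' = P.spoke (nxt t) ∨ e' = P.rim (nxt t) ∨ e' = P.rim t) := by
    intro t e he
    have h1 := hret.fst h.rotation hS (P.surface (nxt t), e)
    have h2 := hret.mem (show (P.surface (nxt t), e) ∈ darts P.graph from he)
    rw [mem_darts, h1, P.inc_surface] at h2
    exact ⟨(S (P.surface (nxt t), e)).2, Prod.ext h1 rfl, h2⟩
  have hstep : ∀ {t f}, IsColouring G R (P.triangle t) f → ∀ d ∈ darts P.graph,
      f (S d) = f d + P.triangle t d.2 := fun hf d hd =>
    hf.apply_returnsTo h.rotation h.planet_le (fun e he => P.triangle_of_notMem he) hret hd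
  have hrim : ∀ t, S (P.surface t, P.rim t) = (P.surface t, P.spoke t) := by
    intro t
    obtain ⟨f, hf, -, -, -, a3, -, -, a6⟩ := h.exists_triangle_values hret hc t
    obtain ⟨d, hd⟩ := S.surjective (P.surface t, P.spoke t)
    have hdm : d ∈ darts P.graph := by
      by_contra hn
      have := hS d hn
      rw [hd] at this
      exact hn (this ▸ P.spoke_dart t)
    have hd1 : d.1 = P.surface t := by
      rw [← hret.fst h.rotation hS d, hd]
    obtain ⟨x, e⟩ := d
    obtain rfl : x = P.surface t := hd1
    obtain ⟨w, rfl⟩ := exists_nxt_eq t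
    have h1 := hstep hf _ hdm
    rw [hd, a3] at h1
    rcases P.inc_surface.1 hdm with rfl | rfl | rfl
    · rw [a3, P.triangle_spoke hm] at h1
      exact absurd (left_eq_add.1 h1) one_ne_zero
    · exact hd
    · rw [a6 w rfl, P.triangle_rim_of_ne (nxt_ne (by omega) w).symm, add_zero] at h1
      exact absurd h1 one_ne_zero
  have hspoke : ∀ t, S (P.surface (nxt t), P.spoke (nxt t)) = (P.surface (nxt t), P.rim t) := by
    intro t
    obtain ⟨f, hf, -, -, -, -, a4, a5, -⟩ := h.exists_triangle_values hret hc t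
    obtain ⟨e', he', hcase⟩ := hsurf t _ (P.spoke_dart (nxt t))
    have h1 := hstep hf _ (P.spoke_dart (nxt t))
    rw [he', a4, P.triangle_spoke_nxt hm, zero_add] at h1
    rcases hcase with rfl | rfl | rfl
    · rw [a4] at h1
      exact absurd h1 zero_ne_one
    · rw [a5] at h1
      exact absurd h1 zero_ne_one
    · exact he'
  refine ⟨hc, hrim, hspoke, fun t => ?_⟩
  obtain ⟨e', he', hcase⟩ := hsurf t _ (P.rim_dart' t)
  rcases hcase with rfl | rfl | rfl
  · have := S.injective (he'.trans (hrim (nxt t)).symm)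
    exact absurd (P.rim_injective (congrArg Prod.snd this)).symm (nxt_ne (by omega) t)
  · exact he'
  · have := S.injective (he'.trans (hspoke t).symm)
    exact absurd (congrArg Prod.snd this).symm (P.spoke_ne_rim _ _)

/-- Up to reorientation, planar rotation systems induce the standard one on the planet. -/
theorem IsPlanarRotation.exists_wheelRotation (h : IsPlanarRotation P G R) :
    ∃ S : Perm (α × β), (∀ d ∉ darts P.graph, S d = d) ∧ WheelRotation P S ∧
      (ReturnsTo R (darts P.graph) S ∨ ReturnsTo R⁻¹ (darts P.graph) S) := by
  obtain ⟨S, hS, hret⟩ := exists_returnsTo (h.rotation.support_finite h.finite_darts)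
    (darts P.graph)
  rcases h.centre_cases hS hret with hc | hc
  · exact ⟨S, hS, h.wheelRotation hS hret hc, Or.inl hret⟩
  · have hS' : ∀ d ∉ darts P.graph, S⁻¹ d = d := fun d hd => Perm.inv_eq_iff_eq.2 (hS d hd).symm
    have hret' := hret.inv hS
    exact ⟨S⁻¹, hS', h.inv.wheelRotation hS' hret' fun t => Perm.inv_eq_iff_eq.2 (hc t).symm,
      Or.inr hret'⟩

theorem Planet.darts_cases {d : α × β} (hd : d ∈ darts P.graph) :
    (∃ t, d = (P.centre, P.spoke (nxt t))) ∨ (∃ t, d = (P.surface t, P.spoke t)) ∨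
      (∃ t, d = (P.surface (nxt t), P.rim t)) ∨ ∃ t, d = (P.surface t, P.rim t) := by
  obtain ⟨x, e⟩ := d
  rcases (show P.graph.Inc e x from hd).vertex_mem with rfl | ⟨t, rfl⟩
  · obtain ⟨t, rfl⟩ := P.inc_centre.1 hd
    obtain ⟨u, rfl⟩ := exists_nxt_eq t
    exact Or.inl ⟨u, rfl⟩
  · obtain ⟨u, rfl⟩ := exists_nxt_eq t
    rcases P.inc_surface.1 hd with rfl | rfl | rfl
    · exact Or.inr (Or.inl ⟨_, rfl⟩)
    · exact Or.inr (Or.inr (Or.inr ⟨_, rfl⟩))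
    · exact Or.inr (Or.inr (Or.inl ⟨_, rfl⟩))

/-- A wheel rotation on a planet is determined. -/
theorem WheelRotation.eq {T : Perm (α × β)} (h : WheelRotation P S) (h' : WheelRotation P T)
    (hS : ∀ d ∉ darts P.graph, S d = d) (hT : ∀ d ∉ darts P.graph, T d = d) : S = T := by
  ext1 d
  by_cases hd : d ∈ darts P.graph
  · rcases P.darts_cases hd with ⟨t, rfl⟩ | ⟨t, rfl⟩ | ⟨t, rfl⟩ | ⟨t, rfl⟩
    · rw [h.centre, h'.centre]
    · obtain ⟨u, rfl⟩ := exists_nxt_eq t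
      rw [h.spoke, h'.spoke]
    · rw [h.prev, h'.prev]
    · rw [h.rim, h'.rim]
  · rw [hS d hd, hT d hd]

/-- The darts of the planet just after a corner inside the `t`-th triangle. -/
def Planet.inside (P : Planet α β m) (t : Fin (4 * m)) : Set (α × β) :=
  {(P.centre, P.spoke (nxt t)), (P.surface t, P.spoke t), (P.surface (nxt t), P.rim t)}

/-- The colouring of a triangle detects which corners of the planet lie in it; this is how a bridge
is located in a face of the wheel. -/
theorem IsPlanarRotation.exists_inside_colouring (h : IsPlanarRotation P G R)
    (hret : ReturnsTo R (darts P.graph) S) (hW : WheelRotation P S) (t : Fin (4 * m)) :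
    ∃ f, IsColouring G R (P.triangle t) f ∧
      ∀ d ∈ darts P.graph, (f d = 1 ↔ d ∈ P.inside t) := by
  have hm := h.pos
  obtain ⟨f, hf, h0, a1, a2, a3, a4, a5, a6⟩ := h.exists_triangle_values hret hW.centre t
  have hinc : ∀ {e x}, P.graph.Inc e x → G.Inc e x := fun he => he.mono h.planet_le
  have hstep : ∀ d ∈ darts P.graph, f (S d) = f d + P.triangle t d.2 := fun d hd =>
    hf.apply_returnsTo h.rotation h.planet_le (fun e he => P.triangle_of_notMem he) hret hd
  have hno : ∀ {d : α × β}, f d = 0 → d ∉ P.inside t → (f d = 1 ↔ d ∈ P.inside t) :=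
    fun h1 h2 => ⟨fun h3 => absurd (h1.symm.trans h3) zero_ne_one, fun h3 => absurd h3 h2⟩
  have hyes : ∀ {d : α × β}, f d = 1 → d ∈ P.inside t → (f d = 1 ↔ d ∈ P.inside t) :=
    fun h1 h2 => ⟨fun _ => h2, fun _ => h1⟩
  have hsc := P.surface_ne_centre
  have hsr := P.spoke_ne_rim
  have hsr' := fun k l => (P.spoke_ne_rim k l).symm
  refine ⟨f, hf, fun d hd => ?_⟩
  rcases P.darts_cases hd with ⟨u, rfl⟩ | ⟨u, rfl⟩ | ⟨u, rfl⟩ | ⟨u, rfl⟩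
  · by_cases hu : u = t
    · subst hu
      exact hyes a2 (Or.inl rfl)
    · have hu' : nxt u ≠ nxt t := fun h1 => hu (nxt_injective h1)
      refine hno ?_ ?_
      · by_cases hut : nxt u = t
        · rw [hut, a1]
        · exact (h0 _ hut hu').2
      · rintro (h1 | h1 | h1) <;> simp only [mem_singleton_iff, Prod.mk.injEq] at h1
        · exact hu' (P.spoke_injective h1.2)
        · exact hsc _ h1.1.symm
        · exact hsc _ h1.1.symm
  · by_cases hu : u = t
    · subst hu
      exact hyes a3 (Or.inr (Or.inl rfl))
    · refine hno ?_ ?_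
      · by_cases hut : u = nxt t
        · rw [hut, a4]
        · exact (h0 _ hu hut).1 _ (hinc (P.spoke_dart u))
      · rintro (h1 | h1 | h1) <;> simp only [mem_singleton_iff, Prod.mk.injEq] at h1
        · exact hsc _ h1.1
        · exact hu (P.spoke_injective h1.2)
        · exact hsr _ _ h1.2
  · by_cases hu : u = t
    · subst hu
      refine hyes ?_ (Or.inr (Or.inr rfl))
      rw [← hW.spoke, hstep _ (P.spoke_dart _), a4, P.triangle_spoke_nxt hm, zero_add]
    · have hu' : nxt u ≠ nxt t := fun h1 => hu (nxt_injective h1)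
      refine hno ?_ ?_
      · by_cases hut : nxt u = t
        · rw [hut, a6 u hut]
        · exact (h0 _ hut hu').1 _ (hinc (P.rim_dart' u))
      · rintro (h1 | h1 | h1) <;> simp only [mem_singleton_iff, Prod.mk.injEq] at h1
        · exact hsc _ h1.1
        · exact hsr' _ _ h1.2
        · exact hu (P.rim_injective h1.2)
  · refine hno ?_ ?_
    · by_cases hu : u = t
      · subst hu
        have := hstep _ (P.rim_dart u)
        rwa [hW.rim, a3, P.triangle_rim, right_eq_add] at this
      · by_cases hut : u = nxt t
        · rw [hut, a5]
        · exact (h0 _ hu hut).1 _ (hinc (P.rim_dart u))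
    · rintro (h1 | h1 | h1) <;> simp only [mem_singleton_iff, Prod.mk.injEq] at h1
      · exact hsc _ h1.1
      · exact hsr' _ _ h1.2
      · have h2 := P.rim_injective h1.2
        subst h2
        exact nxt_ne (by omega) u (P.surface_injective h1.1).symm

end WheelRotation

/-! ### Cycles through the planet -/

section Closure

variable {α : Type*} {β : Type*} {m : ℕ} {P : Planet α β m} {G : Graph α β} {R : Perm (α × β)}

/-- Every edge is counted at each of its two ends. -/
theorem sum_bd (hV : G.vertexSet.Finite) (hE : G.edgeSet.Finite) (hloop : G.Loopless)
    (C : β → ZMod 2) : ∑ v ∈ hV.toFinset, bd G C v = 0 := by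
  classical
  simp only [bd_eq_sum hE]
  rw [Finset.sum_comm]
  refine Finset.sum_eq_zero fun e he => ?_
  obtain ⟨a, b, hab⟩ := Graph.exists_isLink_of_mem_edgeSet (G := G) (e := e) (by simpa using he)
  have hne : a ≠ b := fun h => hloop.not_isLoopAt e a (by rw [← h] at hab; exact hab)
  rw [← Finset.sum_filter]
  have : hV.toFinset.filter (fun v => G.Inc e v) = {a, b} := by
    ext v
    simp only [Finset.mem_filter, Set.Finite.mem_toFinset, Finset.mem_insert,
      Finset.mem_singleton]
    constructor
    · rintro ⟨-, h⟩
      exact h.eq_or_eq_of_isLink hab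
    · rintro (rfl | rfl)
      · exact ⟨hab.left_mem, hab.inc_left⟩
      · exact ⟨hab.right_mem, hab.inc_right⟩
  rw [this, Finset.sum_pair hne, zmod_add_self]

/-- Give each spoke the boundary of `D` at its surface vertex. This cancels the boundary at the
surface, and at the centre it vanishes because the total boundary does. -/
theorem IsPlanarRotation.exists_spoke_closure (h : IsPlanarRotation P G R) {D : β → ZMod 2}
    (hD : ∀ v ∈ G.vertexSet, v ∉ P.graph.vertexSet → bd G D v = 0) :
    ∃ C : β → ZMod 2, (∀ e, e ∉ range P.spoke → C e = 0) ∧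
      ∀ v ∈ G.vertexSet, bd G (D + C) v = 0 := by
  classical
  let C : β → ZMod 2 := fun e => if h : ∃ t, P.spoke t = e then bd G D (P.surface h.choose) else 0
  have hC : ∀ t, C (P.spoke t) = bd G D (P.surface t) := by
    intro t
    have hex : ∃ u, P.spoke u = P.spoke t := ⟨t, rfl⟩
    have : C (P.spoke t) = bd G D (P.surface hex.choose) := dif_pos hex
    rw [this, P.spoke_injective hex.choose_spec]
  have hC0 : ∀ e, e ∉ range P.spoke → C e = 0 := fun e he => dif_neg he
  have hsurf : ∀ t, bd G C (P.surface t) = bd G D (P.surface t) := by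
    intro t
    conv_lhs => unfold bd
    rw [finsum_eq_single _ (P.spoke t), if_pos ((P.inc_spoke' h.planet_le).2 (Or.inr rfl)), hC]
    intro e he
    rw [ite_eq_right_iff]
    intro hinc
    by_cases hr : e ∈ range P.spoke
    · obtain ⟨u, rfl⟩ := hr
      rcases (P.inc_spoke' h.planet_le).1 hinc with h1 | h1
      · exact absurd h1 (P.surface_ne_centre _)
      · exact absurd (congrArg P.spoke (P.surface_injective h1).symm) he
    · exact hC0 e hr
  have hne : ∀ v ∈ G.vertexSet, v ≠ P.centre → bd G (D + C) v = 0 := by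
    intro v hv hvc
    rw [bd_add h.finite_edge]
    by_cases hP : v ∈ P.graph.vertexSet
    · rcases hP with rfl | ⟨t, rfl⟩
      · exact absurd rfl hvc
      · rw [hsurf, zmod_add_self]
    · rw [hD v hv hP, zero_add]
      refine bd_eq_zero fun e he => hC0 e ?_
      rintro ⟨t, rfl⟩
      rcases (P.inc_spoke' h.planet_le).1 he with rfl | rfl
      · exact hP P.centre_mem
      · exact hP (P.surface_mem t)
  refine ⟨C, hC0, fun v hv => ?_⟩
  by_cases hvc : v = P.centre
  · have hsum := sum_bd h.finite_vertex h.finite_edge h.loopless (D + C)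
    rwa [Finset.sum_eq_single_of_mem v (by simpa using hv)] at hsum
    intro w hw hwv
    exact hne w (by simpa using hw) (hvc ▸ hwv)
  · exact hne v hv hvc

end Closure

/-! ### Planarity of unions -/

section Union

variable {α : Type*} {β : Type*} {m : ℕ} {P : Planet α β m} {G H U : Graph α β}
  {σ π S τ : Perm (α × β)} {I J : Set (Fin (4 * m))}

/-- Some bridge of `P` in `H` is attached at the `t`-th and at the `u`-th surface vertex. -/
def Joins (P : Planet α β m) (H : Graph α β) (t u : Fin (4 * m)) : Prop :=
  ∃ e e', e ∉ P.graph.edgeSet ∧ SameBridge P.graph H e e' ∧ H.Inc e (P.surface t) ∧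
    H.Inc e' (P.surface u)

theorem Joins.symm {t u : Fin (4 * m)} (hP : P.graph ≤ H) (h : Joins P H t u) : Joins P H u t := by
  obtain ⟨e, e', he, hs, h1, h2⟩ := h
  exact ⟨e', e, hs.notMem_edgeSet hP he, hs.symm, h2, h1⟩

/-- Two planar rotation systems on graphs that share just the planet `P`, with the standard
orientation of `P`, whose bridges are attached at disjoint sets of surface vertices and do not
cross. -/
structure Fits (P : Planet α β m) (I J : Set (Fin (4 * m))) (G H U : Graph α β)
    (σ π S : Perm (α × β)) : Prop where
  left : IsPlanarRotation P G σ
  right : IsPlanarRotation P H π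
  wheel : WheelRotation P S
  wheel_off : ∀ d ∉ darts P.graph, S d = d
  left_returns : ReturnsTo σ (darts P.graph) S
  right_returns : ReturnsTo π (darts P.graph) S
  le_left : G ≤ U
  le_right : H ≤ U
  vertexSet_eq : U.vertexSet = G.vertexSet ∪ H.vertexSet
  inc_iff : ∀ e x, U.Inc e x ↔ G.Inc e x ∨ H.Inc e x
  vertex_inter : ∀ x, x ∈ G.vertexSet → x ∈ H.vertexSet → x ∈ P.graph.vertexSet
  edge_inter : ∀ e, e ∈ G.edgeSet → e ∈ H.edgeSet → e ∈ P.graph.edgeSet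
  left_attach : ∀ t e, G.Inc e (P.surface t) → e ∉ P.graph.edgeSet → t ∈ I
  right_attach : ∀ t e, H.Inc e (P.surface t) → e ∉ P.graph.edgeSet → t ∈ J
  disjoint : ∀ t, t ∈ I → t ∉ J
  noncrossing : ∀ t j k l, 0 < j → j < k → k < l → l < 4 * m →
    Joins P G (nxt^[j] t) (nxt^[l] t) → ¬ Joins P H t (nxt^[k] t)

theorem Fits.symm (h : Fits P I J G H U σ π S) : Fits P J I H G U π σ S where
  left := h.right
  right := h.left
  wheel := h.wheel
  wheel_off := h.wheel_off
  left_returns := h.right_returns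
  right_returns := h.left_returns
  le_left := h.le_right
  le_right := h.le_left
  vertexSet_eq := by rw [h.vertexSet_eq, union_comm]
  inc_iff e x := by rw [h.inc_iff, or_comm]
  vertex_inter x h1 h2 := h.vertex_inter x h2 h1
  edge_inter e h1 h2 := h.edge_inter e h2 h1
  left_attach := h.right_attach
  right_attach := h.left_attach
  disjoint t h1 h2 := h.disjoint t h2 h1
  noncrossing t j k l hj hjk hkl hl h1 h2 := by
    have e : ∀ a b, nxt^[a] (nxt^[b] t) = nxt^[a + b] t := fun a b =>
      (Function.iterate_add_apply _ _ _ _).symm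
    -- Crossing is symmetric: the four alternating positions are read again from the first
    -- attachment of the other bridge.
    refine h.noncrossing (nxt^[j] t) (k - j) (l - j) (4 * m - j) (by omega) (by omega) (by omega)
      (by omega) ?_ ?_
    · rw [e, e, Nat.sub_add_cancel hjk.le, Nat.sub_add_cancel (by omega), iterate_nxt_self]
      exact h2.symm h.left.planet_le
    · rw [e, Nat.sub_add_cancel (by omega)]
      exact h1

theorem Fits.finite_darts (h : Fits P I J G H U σ π S) : (darts U).Finite :=
  (h.left.finite_darts.union h.right.finite_darts).subset fun _ hd =>
    (h.inc_iff _ _).1 hd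

theorem Fits.mem_planet (h : Fits P I J G H U σ π S) {d : α × β} (h1 : d ∈ darts G)
    (h2 : d ∈ darts H) : d ∈ darts P.graph :=
  (Graph.IsSubgraph.inc_congr h.left.planet_le (h.edge_inter _ h1.edge_mem h2.edge_mem)).2 h1

theorem Planet.exists_dart (hm : 0 < m) {x : α} (hx : x ∈ P.graph.vertexSet) :
    ∃ e, P.graph.Inc e x := by
  rcases hx with rfl | ⟨t, rfl⟩
  · exact ⟨_, P.centre_dart ⟨0, by omega⟩⟩
  · exact ⟨_, P.spoke_dart t⟩

theorem exists_first_planet {K : Graph α β} {R : Perm (α × β)} (hm : 0 < m)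
    (hR : IsRotation K R) (hfin : (darts K).Finite) (hP : P.graph ≤ K) {d : α × β}
    (hd : d ∈ darts K) (hx : d.1 ∈ P.graph.vertexSet) : ∃ p, First R (darts P.graph) d p := by
  obtain ⟨e, he⟩ := P.exists_dart hm hx
  exact exists_first (hR.support_finite hfin) (hR.sameCycle d.1 d.2 e hd (he.mono hP)) he

theorem First.fst {K : Graph α β} {R : Perm (α × β)} (hR : IsRotation K R) {A : Set (α × β)}
    {d p : α × β} (h : First R A d p) : p.1 = d.1 :=
  h.induction_on (p := fun z => z.1 = d.1) rfl fun z _ hz => (hR.fst z).trans hz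

/-- All attachments of a bridge are in the same face of the planet. -/
theorem IsPlanarRotation.inside_iff (h : IsPlanarRotation P G σ)
    (hret : ReturnsTo σ (darts P.graph) S) (hW : WheelRotation P S) {d d' p p' : α × β}
    (hd : d ∈ darts G) (hd' : d' ∈ darts G) (he : d.2 ∉ P.graph.edgeSet)
    (hs : SameBridge P.graph G d.2 d'.2) (hp : First σ (darts P.graph) d p)
    (hp' : First σ (darts P.graph) d' p') (t : Fin (4 * m)) : p ∈ P.inside t ↔ p' ∈ P.inside t := by
  obtain ⟨f, hf, hin⟩ := h.exists_inside_colouring hret hW t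
  have hC : ∀ d ∈ darts G, d ∉ darts P.graph → P.triangle t d.2 = 0 := fun d hd hd' =>
    P.triangle_of_notMem (notMem_edgeSet_of_notMem_darts h.planet_le hd hd')
  rw [← hin p hp.mem, ← hin p' hp'.mem, ← hf.eq_of_first h.rotation hC hd hp,
    ← hf.eq_of_first h.rotation hC hd' hp']
  have := hf.eq_of_sameBridge h.rotation h.finite_darts h.planet_le
    (fun e he => P.triangle_of_notMem he) hs he hd hd'
  rw [show d = (d.1, d.2) from rfl, this]

/-- Off the attachments of `G`, all darts of `G` at a surface vertex belong to the planet, so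
nothing is skipped in the first return. -/
theorem Fits.left_apply (h : Fits P I J G H U σ π S) {t : Fin (4 * m)} (ht : t ∉ I) {e : β}
    (he : P.graph.Inc e (P.surface t)) : σ (P.surface t, e) = S (P.surface t, e) := by
  have he' := he.mono h.left.planet_le
  refine (h.left_returns _ he).eq_of_mem ?_
  have h1 := h.left.rotation.mem (d := (P.surface t, e)) he'
  have h2 := h.left.rotation.fst (P.surface t, e)
  by_contra hn
  rw [mem_darts, h2] at h1
  refine ht (h.left_attach t _ h1 ?_)
  have := notMem_edgeSet_of_notMem_darts h.left.planet_le
    (h.left.rotation.mem (d := (P.surface t, e)) he') hn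
  exact this

/-- At a surface vertex where nothing of `G` is attached, the darts of `G` are those of `P`. -/
theorem Fits.first_left (h : Fits P I J G H U σ π S) (hτ : IsRotation U τ) {t : Fin (4 * m)}
    (ht : t ∉ I) {d p : α × β} (hd : d.1 = P.surface t) (hp : First τ (darts P.graph) d p) :
    First τ (darts G) d p := by
  induction hp with
  | here hp => exact .here (darts_mono h.left.planet_le hp)
  | @step d p hn _ ih =>
    refine .step (fun hG => ?_) (ih ((hτ.fst d).trans hd))
    have := notMem_edgeSet_of_notMem_darts h.left.planet_le hG hn
    rw [mem_darts, hd] at hG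
    exact ht (h.left_attach t _ hG this)

theorem IsColouring.eq_of_first_at {R : Perm (α × β)} {A : Set (α × β)} {C : β → ZMod 2}
    {f : α × β → ZMod 2} (hf : IsColouring G R C f) (hR : IsRotation G R) {x : α}
    (hC : ∀ e, G.Inc e x → (x, e) ∉ A → C e = 0) {d d' : α × β} (hd : d ∈ darts G) (hx : d.1 = x)
    (h : First R A d d') : f d = f d' := by
  refine (h.induction_on (p := fun z => z ∈ darts G ∧ z.1 = x ∧ f d = f z) ⟨hd, hx, rfl⟩ ?_).2.2
  rintro ⟨y, e⟩ hz ⟨hzG, rfl, hfz⟩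
  exact ⟨hR.mem hzG, hR.fst _, by rw [(hf _ hzG).1, hC e hzG hz, add_zero, hfz]⟩

/-- The colour outside the planet does not change along vertices where the chain is supported on
the planet. -/
theorem IsPlanarRotation.outer_chain (h : IsPlanarRotation P G σ)
    (hret : ReturnsTo σ (darts P.graph) S) (hW : WheelRotation P S) {C : β → ZMod 2}
    {f : α × β → ZMod 2} (hf : IsColouring G σ C f) (t : Fin (4 * m)) (k : ℕ)
    (hC : ∀ j, 0 < j → j ≤ k → ∀ e, G.Inc e (P.surface (nxt^[j] t)) → e ∉ P.graph.edgeSet →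
      C e = 0) :
    f (P.surface (nxt^[k] t), P.rim (nxt^[k] t)) = f (P.surface t, P.rim t) := by
  induction k with
  | zero => rfl
  | succ k ih =>
    rw [← ih fun j hj hjk => hC j hj (by omega)]
    have hC' := hC (k + 1) (by omega) le_rfl
    rw [Function.iterate_succ_apply'] at hC' ⊢
    set u := nxt^[k] t
    have hinc : ∀ {e x}, P.graph.Inc e x → G.Inc e x := fun he => he.mono h.planet_le
    have h1 := hf _ (hinc (P.rim_dart' u))
    have h2 := (hret _ (P.rim_dart' u))
    rw [hW.prev] at h2
    have h3 := hf.eq_of_first_at h.rotation (x := P.surface (nxt u)) (fun e he hn => hC' e he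
      (notMem_edgeSet_of_notMem_darts h.planet_le (d := (P.surface (nxt u), e)) he hn))
      (h.rotation.mem (hinc (P.rim_dart' u))) (h.rotation.fst _) h2
    rw [flip_of_isLink ((P.isLink_rim u).symm.mono h.planet_le)] at h1
    rw [← h3, h1.1, h1.2]

/-- The outer corners at two attachments of a bridge of the other graph have the same colour. -/
theorem Fits.outer_eq (h : Fits P I J G H U σ π S) {C : β → ZMod 2}
    (hC : ∀ v ∈ G.vertexSet, bd G C v = 0) {f : α × β → ZMod 2} (hf : IsColouring G σ C f)
    {t u : Fin (4 * m)} (ht : t ∉ I) (hu : u ∉ I) (hj : Joins P H t u) :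
    f (P.surface u, P.rim u) = f (P.surface t, P.rim t) := by
  classical
  obtain ⟨k, hk, rfl⟩ := exists_iterate_nxt t u
  rcases Nat.eq_zero_or_pos k with rfl | hk0
  · rfl
  -- The bridges of `G` with an attachment strictly between `t` and `u`. The cycle `C` is split into
  -- its part `D` on these bridges and the rest, and spokes close up both parts.
  let B : β → Prop := fun e => e ∉ P.graph.edgeSet ∧ ∃ e', SameBridge P.graph G e e' ∧
    ∃ j, 0 < j ∧ j < k ∧ G.Inc e' (P.surface (nxt^[j] t))
  let D : β → ZMod 2 := fun e => if B e then C e else 0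
  have hDpos : ∀ {e}, B e → D e = C e := fun he => if_pos he
  have hDneg : ∀ {e}, ¬ B e → D e = 0 := fun he => if_neg he
  obtain ⟨C', hC', hbd⟩ := h.left.exists_spoke_closure (D := D) (by
    intro v hv hvP
    by_cases hex : ∃ e, G.Inc e v ∧ B e
    · obtain ⟨e, he, hB⟩ := hex
      rw [← hC v hv]
      refine bd_congr fun e' he' => hDpos ⟨notMem_edgeSet_of_inc h.left.planet_le hvP he', ?_⟩
      obtain ⟨e'', hs, hj⟩ := hB.2
      exact ⟨e'', (sameBridge_of_inc hvP he' he).trans hs, hj⟩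
    · exact bd_eq_zero fun e he => hDneg fun hB => hex ⟨e, he, hB⟩)
  obtain ⟨f₁, hf₁⟩ := h.left.planar _ hbd
  have hf₂ := hf.add hf₁
  have hC'0 : ∀ {e}, e ∉ P.graph.edgeSet → C' e = 0 := fun {e} he => hC' e fun ⟨t, ht⟩ =>
    he (ht ▸ P.spoke_mem t)
  -- Between `t` and `u`, all edges outside the planet are in `B`, so the remainder of `C` vanishes
  -- on them.
  have h2 := h.left.outer_chain h.left_returns h.wheel hf₂ t k (by
    intro j hj0 hjk e he heP
    rcases hjk.lt_or_eq with hlt | rfl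
    · have hB : B e := ⟨heP, e, .refl, j, hj0, hlt, he⟩
      simp only [Pi.add_apply]
      rw [hDpos hB, hC'0 heP, add_zero, zmod_add_self]
    · exact absurd (h.left_attach _ e he heP) hu)
  have e1 : ∀ a b, nxt^[a] (nxt^[b] t) = nxt^[a + b] t := fun a b =>
      (Function.iterate_add_apply _ _ _ _).symm
  -- On the way from `u` back to `t`, the part `D` vanishes: a bridge in `B` attached there would
  -- cross the bridge of `H` that joins `t` and `u`.
  have h1 := h.left.outer_chain h.left_returns h.wheel hf₁ (nxt^[k] t) (4 * m - k) (by
    intro j hj0 hjk e he heP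
    rw [e1] at he
    rcases hjk.lt_or_eq with hlt | rfl
    · have hB : ¬ B e := by
        rintro ⟨-, e', hs, i, hi0, hik, he'⟩
        exact h.noncrossing t i k (j + k) hi0 hik (by omega) (by omega)
          ⟨e', e, hs.notMem_edgeSet h.left.planet_le heP, hs.symm, he', he⟩ hj
      simp only [Pi.add_apply]
      rw [hDneg hB, hC'0 heP, add_zero]
    · rw [Nat.sub_add_cancel hk.le, iterate_nxt_self] at he
      exact absurd (h.left_attach _ e he heP) ht)
  rw [e1, Nat.sub_add_cancel hk.le, iterate_nxt_self] at h1
  simp only [Pi.add_apply, h1] at h2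
  exact add_right_cancel h2

end Union

/-! ### Extending colourings to the union, and existence of the common embedding. -/

section Extension

variable {α : Type*} {β : Type*} {m : ℕ} {P : Planet α β m} {G H U : Graph α β}
  {σ π S τ : Perm (α × β)} {I J : Set (Fin (4 * m))}

/-- In each sector at the centre, the darts of `H` come before those of `G` if the bridges of `H`
may be attached at the first surface vertex of the sector, and after them if those of `G` may. -/
def SectorOrder (P : Planet α β m) (I J : Set (Fin (4 * m))) (G H : Graph α β)
    (σ π τ : Perm (α × β)) : Prop :=
  ∀ t, (t ∉ I ∧ ∀ d ∈ darts H, d ∉ darts G →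
      First π (darts P.graph) d (P.centre, P.spoke (nxt t)) →
      First τ (darts G) d (σ (P.centre, P.spoke t))) ∨
    (t ∉ J ∧ ∀ d ∈ darts H, d ∉ darts G →
      First π (darts P.graph) d (P.centre, P.spoke (nxt t)) →
      First τ (darts G) d (P.centre, P.spoke (nxt t)))

/-- The colours of the corners of `G` in which a bridge of `H` is attached. -/
theorem Fits.attachment_eq (h : Fits P I J G H U σ π S) (hτ : IsRotation U τ)
    (hτH : ReturnsTo τ (darts H) π) (hord : SectorOrder P I J G H σ π τ) {C : β → ZMod 2}
    (hC : ∀ v ∈ G.vertexSet, bd G C v = 0) {f : α × β → ZMod 2} (hf : IsColouring G σ C f)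
    {d d' x x' : α × β} (hd : d ∈ darts H) (hd' : d' ∈ darts H) (hdP : d.1 ∈ P.graph.vertexSet)
    (hdP' : d'.1 ∈ P.graph.vertexSet) (he : d.2 ∉ P.graph.edgeSet)
    (hs : SameBridge P.graph H d.2 d'.2) (hx : First τ (darts G) d x)
    (hx' : First τ (darts G) d' x') : f x = f x' := by
  have hm := h.left.pos
  have hPH := h.right.planet_le
  have he' := hs.notMem_edgeSet hPH he
  have hnG : ∀ {d}, d ∈ darts H → d.2 ∉ P.graph.edgeSet → d ∉ darts G := fun hd he hG =>
    he (h.mem_planet hG hd).edge_mem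
  obtain ⟨p, hp⟩ := exists_first_planet hm h.right.rotation h.right.finite_darts hPH hd hdP
  obtain ⟨p', hp'⟩ := exists_first_planet hm h.right.rotation h.right.finite_darts hPH hd' hdP'
  have hin := h.right.inside_iff h.right_returns h.wheel hd hd' he hs hp hp'
  have hinc : ∀ {e x}, P.graph.Inc e x → G.Inc e x := fun he => he.mono h.left.planet_le
  -- attachments on the surface
  have hsurf : ∀ {d p x} {u : Fin (4 * m)}, d ∈ darts H → d.2 ∉ P.graph.edgeSet →
      First π (darts P.graph) d p → First τ (darts G) d x → p.1 = P.surface u →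
      u ∈ J ∧ u ∉ I ∧ x = p ∧ d.1 = P.surface u := by
    intro d p x u hd he hp hx hpu
    have hdu : d.1 = P.surface u := (hp.fst h.right.rotation).symm.trans hpu
    have hJ : u ∈ J := by
      refine h.right_attach u d.2 ?_ he
      rw [← hdu]; exact hd
    have hI : u ∉ I := fun hI => h.disjoint u hI hJ
    exact ⟨hJ, hI, hx.unique (h.first_left hτ hI hdu (hτH.trans_first (darts_mono hPH) hd hp)), hdu⟩
  by_cases hex : ∃ t, p ∈ P.inside t
  · obtain ⟨t, hpt⟩ := hex
    have hpt' := (hin t).1 hpt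
    -- The corner after a dart and the corner before the dart at the other end of its edge lie in
    -- one face.
    have hspoke : ∀ u, f (σ (P.centre, P.spoke u)) = f (P.surface u, P.spoke u) := by
      intro u
      have := hf _ (hinc (P.centre_dart u))
      rw [this.1, ← this.2, flip_of_isLink ((P.isLink_spoke u).mono h.left.planet_le)]
    have hspoke' : ∀ u, f (σ (P.surface u, P.spoke u)) = f (P.centre, P.spoke u) := by
      intro u
      have := hf _ (hinc (P.spoke_dart u))
      rw [this.1, ← this.2, flip_of_isLink ((P.isLink_spoke u).symm.mono h.left.planet_le)]
    have hrim : ∀ u, f (σ (P.surface u, P.rim u)) = f (P.surface (nxt u), P.rim u) := by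
      intro u
      have := hf _ (hinc (P.rim_dart u))
      rw [this.1, ← this.2, flip_of_isLink ((P.isLink_rim u).mono h.left.planet_le)]
    -- If `t ∉ I`, no edge of `G` divides the triangle at its first surface vertex, so all
    -- attachments lie in the face of `G` beside the `t`-th spoke and rim edge. If `t ∉ J`, the
    -- bridge is attached at most at the centre and at the second surface vertex, hence beside the
    -- next spoke.
    rcases hord t with ⟨htI, hc⟩ | ⟨htJ, hc⟩
    · suffices key : ∀ {d p x}, d ∈ darts H → d.2 ∉ P.graph.edgeSet →
          First π (darts P.graph) d p → First τ (darts G) d x → p ∈ P.inside t →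
          f x = f (P.surface t, P.spoke t) from
        (key hd he hp hx hpt).trans (key hd' he' hp' hx' hpt').symm
      intro d p x hd he hp hx hpt
      rcases hpt with rfl | rfl | rfl
      · rw [hx.unique (hc d hd (hnG hd he) hp), hspoke]
      · rw [(hsurf hd he hp hx rfl).2.2.1]
      · rw [(hsurf hd he hp hx rfl).2.2.1, ← hrim, h.left_apply htI (P.rim_dart t), h.wheel.rim]
    · suffices key : ∀ {d p x}, d ∈ darts H → d.2 ∉ P.graph.edgeSet →
          First π (darts P.graph) d p → First τ (darts G) d x → p ∈ P.inside t →
          f x = f (P.centre, P.spoke (nxt t)) from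
        (key hd he hp hx hpt).trans (key hd' he' hp' hx' hpt').symm
      intro d p x hd he hp hx hpt
      rcases hpt with rfl | rfl | rfl
      · rw [hx.unique (hc d hd (hnG hd he) hp)]
      · exact absurd (hsurf hd he hp hx rfl).1 htJ
      · obtain ⟨-, hI, hxp, -⟩ := hsurf hd he hp hx rfl
        rw [hxp, ← hspoke', h.left_apply hI (P.spoke_dart (nxt t)), h.wheel.spoke]
  · have hout : ∀ {p}, p ∈ darts P.graph → (∀ t, p ∉ P.inside t) →
        ∃ t, p = (P.surface t, P.rim t) := by
      intro p hp hno
      rcases P.darts_cases hp with ⟨t, rfl⟩ | ⟨t, rfl⟩ | ⟨t, rfl⟩ | ht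
      · exact absurd (Or.inl rfl) (hno t)
      · exact absurd (Or.inr (Or.inl rfl)) (hno t)
      · exact absurd (Or.inr (Or.inr rfl)) (hno t)
      · exact ht
    obtain ⟨t, rfl⟩ := hout hp.mem fun t ht => hex ⟨t, ht⟩
    obtain ⟨u, rfl⟩ := hout hp'.mem fun t ht => hex ⟨t, (hin t).2 ht⟩
    obtain ⟨-, htI, hxp, hdt⟩ := hsurf hd he hp hx rfl
    obtain ⟨-, huI, hxp', hdu⟩ := hsurf hd' he' hp' hx' rfl
    rw [hxp, hxp']
    refine (h.outer_eq hC hf htI huI ⟨d.2, d'.2, he, hs, ?_, ?_⟩).symm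
    · rw [← hdt]; exact hd
    · rw [← hdu]; exact hd'

/-- Colourings of `G` extend to the union. -/
theorem Fits.exists_extension (h : Fits P I J G H U σ π S) (hτ : IsRotation U τ)
    (hτG : ReturnsTo τ (darts G) σ) (hτH : ReturnsTo τ (darts H) π)
    (hord : SectorOrder P I J G H σ π τ) {C : β → ZMod 2}
    (hC : ∀ v ∈ G.vertexSet, bd G C v = 0) (hC0 : ∀ e ∉ G.edgeSet, C e = 0) :
    ∃ f, IsColouring U τ C f := by
  classical
  have hm := h.left.pos
  have hPH := h.right.planet_le
  have hPG := h.left.planet_le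
  obtain ⟨f, hf⟩ := h.left.planar C hC
  -- Each bridge of `H` receives the colour of the corners of `G` where it is attached; 0 is the
  -- default if there is no attachment.
  let p : β → Prop := fun e => ∃ d x, SameBridge P.graph H e d.2 ∧ d ∈ darts H ∧
    d.1 ∈ P.graph.vertexSet ∧ First τ (darts G) d x ∧ f x = 1
  let v : β → ZMod 2 := fun e => if p e then 1 else 0
  have hvs : ∀ {e e'}, SameBridge P.graph H e e' → v e = v e' := by
    intro e e' hs
    have : p e ↔ p e' := by
      constructor
      · rintro ⟨d, x, hs', hr⟩
        exact ⟨d, x, hs.symm.trans hs', hr⟩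
      · rintro ⟨d, x, hs', hr⟩
        exact ⟨d, x, hs.trans hs', hr⟩
    simp only [v, this]
  have hnP : ∀ {d}, d ∈ darts H → d ∉ darts G → d.2 ∉ P.graph.edgeSet := fun hd hn he =>
    hn ((Graph.IsSubgraph.inc_congr hPG he).1 ((Graph.IsSubgraph.inc_congr hPH he).2 hd))
  have hv : ∀ {d x}, d ∈ darts H → d ∉ darts G → d.1 ∈ P.graph.vertexSet →
      First τ (darts G) d x → v d.2 = f x := by
    intro d x hd hn hdP hx
    rcases zmod_cases (f x) with h0 | h1
    · rw [h0]
      refine if_neg ?_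
      rintro ⟨d', x', hs, hd', hdP', hx', h1⟩
      have := h.attachment_eq hτ hτH hord hC hf hd hd' hdP hdP' (hnP hd hn) hs hx hx'
      rw [h0, h1] at this
      exact zero_ne_one this
    · rw [h1]
      exact if_pos ⟨d, x, .refl, hd, hdP, hx, h1⟩
  have hUcases : ∀ {d}, d ∈ darts U → d ∉ darts G → d ∈ darts H := fun hd hn =>
    ((h.inc_iff _ _).1 hd).resolve_left hn
  let F : α × β → ZMod 2 := fun d => if d ∈ darts G then f d else v d.2
  have hFG : ∀ {d}, d ∈ darts G → F d = f d := fun hd => if_pos hd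
  have hFH : ∀ {d}, d ∉ darts G → F d = v d.2 := fun hd => if_neg hd
  refine ⟨F, fun d hd => ?_⟩
  by_cases hG : d ∈ darts G
  · have h1 := hf d hG
    have h2 := hτG d hG
    rw [hFG hG, ← flip_eq_of_le h.le_left hG, hFG (flip_mem hG)]
    refine ⟨?_, h1.2⟩
    rw [← h1.1]
    by_cases hG' : τ d ∈ darts G
    · rw [hFG hG', h2.eq_of_mem hG']
    · have hH := hUcases (hτ.mem hd) hG'
      rw [hFH hG', hv hH hG' ?_ h2]
      rw [hτ.fst]
      refine h.vertex_inter _ hG.vertex_mem ?_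
      rw [← hτ.fst d]
      exact hH.vertex_mem
  · have hH := hUcases hd hG
    have hCd : C d.2 = 0 := hC0 _ (notMem_edgeSet_of_notMem_darts h.le_left hd hG)
    have hdE := hnP hH hG
    rw [hCd, add_zero, hFH hG]
    constructor
    · by_cases hdP : d.1 ∈ P.graph.vertexSet
      · obtain ⟨e, he⟩ := P.exists_dart hm hdP
        have heG := he.mono hPG
        obtain ⟨x, hx⟩ := exists_first (A := darts G) (hτ.support_finite h.finite_darts)
          (hτ.sameCycle d.1 d.2 e hd (heG.mono h.le_left)) heG
        have hx' := hx.next hG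
        rw [hv hH hG hdP hx]
        by_cases hG' : τ d ∈ darts G
        · rw [hFG hG', hx'.eq_of_mem hG']
        · rw [hFH hG', hv (hUcases (hτ.mem hd) hG') hG' (by rwa [hτ.fst]) hx']
      · have hnG : d.1 ∉ G.vertexSet := fun h' => hdP (h.vertex_inter _ h' hH.vertex_mem)
        have hG' : τ d ∉ darts G := fun h' => hnG (hτ.fst d ▸ h'.vertex_mem)
        have hH' := hUcases (hτ.mem hd) hG'
        rw [hFH hG']
        rw [mem_darts, hτ.fst] at hH'
        exact hvs (sameBridge_of_inc hdP hH' hH)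
    · have hfl := flip_mem hH
      rw [← flip_eq_of_le h.le_right hH]
      obtain ⟨y, -, hy⟩ := exists_flip_eq hH
      rw [hy] at hfl ⊢
      have hn : (y, d.2) ∉ darts G := fun h' => hdE (h.mem_planet h' hfl).edge_mem
      rw [hFH hn]

/-- A cycle of the union splits into a cycle `D + C'` of `H` and a cycle `CG` of `G`, where the
spokes `C'` close up the part `D` outside the planet. Colourings for both extend to the union, and
their sum is a colouring for the given cycle. -/
theorem Fits.planar_union (h : Fits P I J G H U σ π S) (hτ : IsRotation U τ)
    (hτG : ReturnsTo τ (darts G) σ) (hτH : ReturnsTo τ (darts H) π)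
    (hord : SectorOrder P I J G H σ π τ) (hord' : SectorOrder P J I H G π σ τ) : Planar U τ := by
  classical
  intro C hC
  have hPH := h.right.planet_le
  have hUE : U.edgeSet.Finite := by
    refine (h.left.finite_edge.union h.right.finite_edge).subset fun e he => ?_
    obtain ⟨x, y, hxy⟩ := Graph.exists_isLink_of_mem_edgeSet he
    exact ((h.inc_iff _ _).1 hxy.inc_left).imp (fun h => h.edge_mem) fun h => h.edge_mem
  let D : β → ZMod 2 := fun e => if e ∈ H.edgeSet ∧ e ∉ P.graph.edgeSet then C e else 0
  have hD1 : ∀ {e}, e ∈ H.edgeSet → e ∉ P.graph.edgeSet → D e = C e := fun h1 h2 =>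
    if_pos ⟨h1, h2⟩
  have hD2 : ∀ {e}, (e ∉ H.edgeSet ∨ e ∈ P.graph.edgeSet) → D e = 0 := fun h' =>
    if_neg fun ⟨h1, h2⟩ => h'.elim (fun h' => h' h1) (fun h' => h2 h')
  obtain ⟨C', hC', hbd⟩ := h.right.exists_spoke_closure (D := D) (by
    intro v hv hvP
    have hvG : v ∉ G.vertexSet := fun hG => hvP (h.vertex_inter v hG hv)
    have h1 : bd U D v = bd H D v := bd_mono h.le_right (fun e he => hD2 (Or.inl he)) v
    rw [← h1, ← hC v (h.vertexSet_eq ▸ Or.inr hv)]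
    refine bd_congr fun e he => ?_
    have he' := ((h.inc_iff _ _).1 he).resolve_left fun h' => hvG h'.vertex_mem
    exact hD1 he'.edge_mem (notMem_edgeSet_of_inc hPH hvP he'))
  have hC'0 : ∀ {e}, e ∉ P.graph.edgeSet → C' e = 0 := fun {e} he => hC' e fun ⟨t, ht⟩ =>
    he (ht ▸ P.spoke_mem t)
  have hCH0 : ∀ e ∉ H.edgeSet, (D + C') e = 0 := fun e he => by
    rw [Pi.add_apply, hD2 (Or.inl he), hC'0 fun hP => he (hPH.edgeSet_mono hP), add_zero]
  let CG : β → ZMod 2 := fun e => if e ∈ G.edgeSet then C e + C' e else 0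
  have hCG0 : ∀ e ∉ G.edgeSet, CG e = 0 := fun e he => if_neg he
  have hUG : ∀ e ∈ U.edgeSet, CG e = C e + (D + C') e := by
    intro e he
    rw [Pi.add_apply]
    by_cases hG : e ∈ G.edgeSet
    · have hDe : D e = 0 := hD2 (by
        by_cases hH : e ∈ H.edgeSet
        · exact Or.inr (h.edge_inter e hG hH)
        · exact Or.inl hH)
      rw [hDe, zero_add]
      exact if_pos hG
    · obtain ⟨x, y, hxy⟩ := Graph.exists_isLink_of_mem_edgeSet he
      have hH : e ∈ H.edgeSet :=
        (((h.inc_iff _ _).1 hxy.inc_left).resolve_left fun h' => hG h'.edge_mem).edge_mem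
      have hP : e ∉ P.graph.edgeSet := fun h' => hG (h.left.planet_le.edgeSet_mono h')
      rw [hCG0 e hG, hD1 hH hP, hC'0 hP, add_zero, zmod_add_self]
  obtain ⟨f, hf⟩ := h.exists_extension hτ hτG hτH hord (C := CG) (by
    intro v hv
    have hvU : v ∈ U.vertexSet := h.vertexSet_eq ▸ Or.inl hv
    rw [← bd_mono h.le_left hCG0, bd_congr (D := C + (D + C')) fun e he => hUG e he.edge_mem,
      bd_add hUE, hC v hvU, zero_add, bd_mono h.le_right hCH0]
    by_cases hvH : v ∈ H.vertexSet
    · exact hbd v hvH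
    · exact bd_eq_zero fun e he => absurd he.vertex_mem hvH) hCG0
  obtain ⟨g, hg⟩ := h.symm.exists_extension hτ hτH hτG hord' hbd hCH0
  refine ⟨f + g, fun d hd => ?_⟩
  have h1 := hf.add hg d hd
  rw [Pi.add_apply CG, hUG d.2 hd.edge_mem, add_assoc, zmod_add_self, add_zero] at h1
  exact h1

/-- The union of two planar rotation systems that fit together. -/
theorem Fits.exists_union (h : Fits P I J G H U σ π S) : ∃ τ : Perm (α × β), IsRotation U τ ∧
    ReturnsTo τ (darts G) σ ∧ ReturnsTo τ (darts H) π ∧ Planar U τ := by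
  have hm := h.left.pos
  have hPG := h.left.planet_le
  have hPH := h.right.planet_le
  have hinter : darts G ∩ darts H = darts P.graph :=
    Subset.antisymm (fun d hd => h.mem_planet hd.1 hd.2) fun d hd =>
      ⟨darts_mono hPG hd, darts_mono hPH hd⟩
  have hσ : ∀ d ∉ darts G, σ d = d := h.left.rotation.of_not_inc
  have hπ : ∀ d ∉ darts H, π d = d := h.right.rotation.of_not_inc
  have hS : ∀ d ∉ darts G ∩ darts H, S d = d := by rw [hinter]; exact h.wheel_off
  have rσ : ReturnsTo σ (darts G ∩ darts H) S := by rw [hinter]; exact h.left_returns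
  have rπ : ReturnsTo π (darts G ∩ darts H) S := by rw [hinter]; exact h.right_returns
  -- The sector that ends at spoke `nxt t` starts at spoke `t`. The edges of `H` come first there if
  -- `t ∈ J`, and then `t ∉ I`, as `SectorOrder` demands.
  obtain ⟨τ, hmerge, hoff, hfst⟩ := exists_isMerge Prod.fst hσ hπ hS rσ rπ h.left.rotation.fst
    h.right.rotation.fst (h.left_returns.fst h.left.rotation h.wheel_off)
    (fun p => ∃ t ∈ J, p = (P.centre, P.spoke (nxt t)))
  have hτG := hmerge.returnsTo hσ hπ hS rσ rπ
  have hτH := hmerge.symm.returnsTo hπ hσ (by rwa [inter_comm]) (by rwa [inter_comm])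
    (by rwa [inter_comm])
  have hsuppG := h.left.rotation.support_finite h.left.finite_darts
  have hsuppH := h.right.rotation.support_finite h.right.finite_darts
  have hcG : ∀ {x e e'}, G.Inc e x → G.Inc e' x → τ.SameCycle (x, e) (x, e') := fun he he' =>
    hτG.sameCycle hsuppG he (h.left.rotation.sameCycle _ _ _ he he')
  have hcH : ∀ {x e e'}, H.Inc e x → H.Inc e' x → τ.SameCycle (x, e) (x, e') := fun he he' =>
    hτH.sameCycle hsuppH he (h.right.rotation.sameCycle _ _ _ he he')
  have hrot : IsRotation U τ := by
    refine ⟨fun d hd => ?_, hfst, fun x e e' he he' => ?_⟩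
    · rw [h.inc_iff, not_or] at hd
      exact hoff d hd.1 hd.2
    · rw [h.inc_iff] at he he'
      have hmix : ∀ {e e'}, G.Inc e x → H.Inc e' x → τ.SameCycle (x, e) (x, e') := by
        intro e e' he he'
        obtain ⟨e'', he''⟩ := P.exists_dart hm (h.vertex_inter x he.vertex_mem he'.vertex_mem)
        exact (hcG he (he''.mono hPG)).trans (hcH (he''.mono hPH) he')
      rcases he with he | he <;> rcases he' with he' | he'
      · exact hcG he he'
      · exact hmix he he'
      · exact (hmix he' he).symm
      · exact hcH he he'
  have hback : ∀ t, S⁻¹ (P.centre, P.spoke (nxt t)) = (P.centre, P.spoke t) := fun t =>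
    Perm.inv_eq_iff_eq.2 (h.wheel.centre t).symm
  have hK : ∀ t, t ∉ J → ¬ ∃ u ∈ J, (P.centre, P.spoke (nxt t)) = (P.centre, P.spoke (nxt u)) := by
    rintro t ht ⟨u, hu, he⟩
    have := nxt_injective (P.spoke_injective (congrArg Prod.snd he))
    exact ht (this ▸ hu)
  refine ⟨τ, hrot, hτG, hτH, h.planar_union hrot hτG hτH ?_ ?_⟩
  · intro t
    by_cases ht : t ∈ J
    · refine Or.inl ⟨fun hI => h.disjoint t hI ht, fun d hd hn hf => ?_⟩
      have := hmerge.first_pos hσ hπ hS hd hn (by rwa [hinter]) ⟨t, ht, rfl⟩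
      rwa [hback] at this
    · exact Or.inr ⟨ht, fun d hd hn hf => hmerge.first_neg hπ hd hn (by rwa [hinter]) (hK t ht)⟩
  · intro t
    have hinter' : darts H ∩ darts G = darts P.graph := by rw [inter_comm, hinter]
    by_cases ht : t ∈ J
    · exact Or.inr ⟨fun hI => h.disjoint t hI ht, fun d hd hn hf =>
        hmerge.symm.first_neg hσ hd hn (by rwa [hinter']) (not_not.2 ⟨t, ht, rfl⟩)⟩
    · refine Or.inl ⟨ht, fun d hd hn hf => ?_⟩
      have := hmerge.symm.first_pos hπ hσ (by rwa [inter_comm]) hd hn (by rwa [hinter']) (hK t ht)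
      rwa [hback] at this

end Extension

/-! ### Uniqueness -/

section Rigid

variable {X : Type*} {A B Z : Set X} {σ π τ τ' : Perm X}

/-- The data that determine a merge of two permutations on a cycle `Z`. -/
structure AgreeOn (Z A B : Set X) (σ π τ τ' : Perm X) : Prop where
  finite : {x | τ x ≠ x}.Finite
  finite' : {x | τ' x ≠ x}.Finite
  mem_or : ∀ z ∈ Z, z ∈ A ∨ z ∈ B
  maps : ∀ z ∈ Z, τ z ∈ Z
  maps' : ∀ z ∈ Z, τ' z ∈ Z
  common : ∃ p ∈ A ∩ B, ∀ z ∈ Z, τ.SameCycle z p ∧ τ'.SameCycle z p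
  left : ReturnsTo τ A σ
  left' : ReturnsTo τ' A σ
  right : ReturnsTo τ B π
  right' : ReturnsTo τ' B π
  first_left : ∀ z ∈ Z, z ∉ A → ∀ x x', First τ A z x → First τ' A z x' → x = x'
  first_right : ∀ z ∈ Z, z ∉ B → ∀ x x', First τ B z x → First τ' B z x' → x = x'

theorem AgreeOn.swap (h : AgreeOn Z A B σ π τ τ') : AgreeOn Z B A π σ τ τ' where
  finite := h.finite
  finite' := h.finite'
  mem_or z hz := (h.mem_or z hz).symm
  maps := h.maps
  maps' := h.maps'
  common := by rw [inter_comm]; exact h.common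
  left := h.right
  left' := h.right'
  right := h.left
  right' := h.left'
  first_left := h.first_right
  first_right := h.first_left

theorem AgreeOn.symm (h : AgreeOn Z A B σ π τ τ') : AgreeOn Z A B σ π τ' τ where
  finite := h.finite'
  finite' := h.finite
  mem_or := h.mem_or
  maps := h.maps'
  maps' := h.maps
  common := by
    obtain ⟨p, hp, hz⟩ := h.common
    exact ⟨p, hp, fun z h => (hz z h).symm⟩
  left := h.left'
  left' := h.left
  right := h.right'
  right' := h.right
  first_left z hz hn x x' h1 h2 := (h.first_left z hz hn x' x h2 h1).symm
  first_right z hz hn x x' h1 h2 := (h.first_right z hz hn x' x h2 h1).symm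

/-- Write `y` and `y'` for the two images of `d`. Following `τ'`, the first element of `A` from `y'`
is `y`. Following `τ`, and hence also `τ'` by agreement, the first element of `B` from `y` is `y'`.
Then `τ'` would run between them without ever meeting `A ∩ B`. -/
theorem AgreeOn.false_of_mem (h : AgreeOn Z A B σ π τ τ') {d : X} (hd : d ∈ Z) (hA : d ∈ A)
    (hy : τ d ∈ A) (hy' : τ' d ∉ A) : False := by
  have hZ := h.maps d hd
  have hZ' := h.maps' d hd
  have hB' := (h.mem_or _ hZ').resolve_left hy'
  obtain ⟨p, hp, hcyc⟩ := h.common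
  have h1 : First τ' A (τ' d) (τ d) := by
    rw [(h.left d hA).eq_of_mem hy]
    exact h.left' d hA
  have h2 : First τ B (τ d) (τ' d) := by
    by_cases hB : d ∈ B
    · rw [(h.right' d hB).eq_of_mem hB']
      exact h.right d hB
    · obtain ⟨x, hx⟩ := exists_first h.finite (hcyc d hd).1 hp.2
      rw [h.first_right d hd hB x (τ' d) hx (.step hB (.here hB'))] at hx
      exact hx.next hB
  have hne : τ d ∉ B := fun hB => hy' (h2.eq_of_mem hB ▸ hy)
  have h3 : First τ' B (τ d) (τ' d) := by
    obtain ⟨x, hx⟩ := exists_first h.finite' (hcyc _ hZ).2 hp.2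
    rwa [h.first_right _ hZ hne _ _ h2 hx]
  exact First.not_symm h.finite' hy' h1 h3 hp (hcyc _ hZ').2

theorem AgreeOn.eq_of_mem (h : AgreeOn Z A B σ π τ τ') {d : X} (hd : d ∈ Z) (hA : d ∈ A) :
    τ d = τ' d := by
  by_cases hy : τ d ∈ A
  · by_cases hy' : τ' d ∈ A
    · rw [(h.left d hA).eq_of_mem hy, (h.left' d hA).eq_of_mem hy']
    · exact (h.false_of_mem hd hA hy hy').elim
  · by_cases hy' : τ' d ∈ A
    · exact (h.symm.false_of_mem hd hA hy' hy).elim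
    · have hB := (h.mem_or _ (h.maps d hd)).resolve_left hy
      have hB' := (h.mem_or _ (h.maps' d hd)).resolve_left hy'
      by_cases hdB : d ∈ B
      · rw [(h.right d hdB).eq_of_mem hB, (h.right' d hdB).eq_of_mem hB']
      · exact h.first_right d hd hdB _ _ (.step hdB (.here hB)) (.step hdB (.here hB'))

theorem AgreeOn.eq (h : AgreeOn Z A B σ π τ τ') {d : X} (hd : d ∈ Z) : τ d = τ' d :=
  (h.mem_or d hd).elim (h.eq_of_mem hd) (h.swap.eq_of_mem hd)

end Rigid

/-! ### Uniqueness of the rotation at the centre and elsewhere. -/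

section Unique

variable {α : Type*} {β : Type*} {m : ℕ} {P : Planet α β m} {G H U : Graph α β}
  {σ π S τ τ' : Perm (α × β)} {I J : Set (Fin (4 * m))}

theorem bd_single_of_isLink [DecidableEq α] [DecidableEq β] (hloop : G.Loopless) {e : β} {x y : α}
    (h : G.IsLink e x y) (v : α) :
    bd G (Pi.single e 1) v = (if v = x then 1 else 0) + if v = y then 1 else 0 := by
  classical
  have hne : x ≠ y := fun he => hloop.not_isLoopAt e x (by rw [← he] at h; exact h)
  rw [bd_single]
  by_cases hx : v = x
  · subst hx
    rw [if_pos h.inc_left, if_pos rfl, if_neg hne, add_zero]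
  · by_cases hy : v = y
    · subst hy
      rw [if_pos h.inc_right, if_pos rfl, if_neg hx, zero_add]
    · rw [if_neg hx, if_neg hy, if_neg, add_zero]
      intro hi
      exact (hi.eq_or_eq_of_isLink h).elim hx hy

/-- In a 2-connected graph, there is a cycle through any two edges at a vertex. -/
theorem TwoConnected.exists_cycle (hG : TwoConnected G) (hE : G.edgeSet.Finite) {c : α} {e e' : β}
    (he : G.Inc e c) (he' : G.Inc e' c) (hne : e ≠ e') :
    ∃ C : β → ZMod 2, (∀ v, bd G C v = 0) ∧ (∀ a ∉ G.edgeSet, C a = 0) ∧ C e = 1 ∧ C e' = 1 ∧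
      ∀ a, G.Inc a c → a ≠ e → a ≠ e' → C a = 0 := by
  classical
  have hloop := hG.loopless
  obtain ⟨y, hy⟩ := id he
  obtain ⟨y', hy'⟩ := id he'
  have hcy : ∀ {e y}, G.IsLink e c y → y ≠ c := fun h he =>
    hloop.not_isLoopAt _ c (by rw [he] at h; exact h)
  have hmem : ∀ {y}, y ∈ G.vertexSet → y ≠ c → y ∈ (G.deleteVerts {c}).vertexSet := by
    intro y h1 h2
    rw [Graph.vertexSet_deleteVerts]
    exact ⟨h1, h2⟩
  -- A path in the graph without `c` between the other ends of `e` and `e'`, as a chain with these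
  -- ends as boundary. For parallel edges the two ends coincide and the boundary vanishes.
  obtain ⟨D, hD, hD0, hDc⟩ := connected_induction (hG.connected_delete c he.vertex_mem)
    (x := y) (p := fun z => ∃ D : β → ZMod 2,
      (∀ v, bd G D v = (if v = y then 1 else 0) + if v = z then 1 else 0) ∧
        (∀ a ∉ G.edgeSet, D a = 0) ∧ ∀ a, G.Inc a c → D a = 0)
    (hmem hy.right_mem (hcy hy)) ⟨0, fun v => by
      rw [bd_eq_zero (C := 0) fun _ _ => rfl, zmod_add_self], fun _ _ => rfl, fun _ _ => rfl⟩
    (by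
      rintro a x z hxz ⟨D, hD, hD0, hDc⟩
      have hxz' := hxz.mono Graph.deleteVerts_le
      refine ⟨D + Pi.single a 1, fun v => ?_, fun b hb => ?_, fun b hb => ?_⟩
      · rw [bd_add hE, hD, bd_single_of_isLink hloop hxz', add_assoc, ← add_assoc (ite (v = x) _ _),
          zmod_add_self, zero_add]
      · have hba : b ≠ a := fun h => hb (h ▸ hxz'.edge_mem)
        rw [Pi.add_apply, hD0 b hb, Pi.single_eq_of_ne hba, add_zero]
      · have hba : b ≠ a := by
          rintro rfl
          have h1 := hxz.left_mem
          have h2 := hxz.right_mem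
          rw [Graph.vertexSet_deleteVerts] at h1 h2
          rcases hb.eq_or_eq_of_isLink hxz' with h | h
          · exact h1.2 h.symm
          · exact h2.2 h.symm
        rw [Pi.add_apply, hDc b hb, Pi.single_eq_of_ne hba, add_zero])
    y' (hmem hy'.right_mem (hcy hy'))
  refine ⟨D + Pi.single e 1 + Pi.single e' 1, fun v => ?_, fun a ha => ?_, ?_, ?_,
    fun a ha h1 h2 => ?_⟩
  · rw [bd_add hE, bd_add hE, hD, bd_single_of_isLink hloop hy, bd_single_of_isLink hloop hy']
    generalize (if v = y then (1 : ZMod 2) else 0) = a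
    generalize (if v = y' then (1 : ZMod 2) else 0) = b
    generalize (if v = c then (1 : ZMod 2) else 0) = d
    revert a b d
    decide
  · have h1 : a ≠ e := fun h => ha (h ▸ he.edge_mem)
    have h2 : a ≠ e' := fun h => ha (h ▸ he'.edge_mem)
    simp [hD0 a ha, h1, h2]
  · simp [hDc e he, hne]
  · simp [hDc e' he', hne.symm]
  · simp [hDc a ha, h1, h2]

/-- In a 2-connected planar graph, distinct corners at a vertex are separated by a cycle. -/
theorem TwoConnected.exists_separating (hG : TwoConnected G) (hE : G.edgeSet.Finite)
    (hfin : (darts G).Finite) (hσ : IsRotation G σ) {x y : α × β} (hx : x ∈ darts G)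
    (hy : y ∈ darts G) (hxy : x.1 = y.1) (hne : x ≠ y) :
    ∃ C : β → ZMod 2, (∀ v, bd G C v = 0) ∧ (∀ a ∉ G.edgeSet, C a = 0) ∧
      ∀ f, IsColouring G σ C f → f x ≠ f y := by
  obtain ⟨c, e⟩ := x
  obtain ⟨c', e'⟩ := y
  obtain rfl : c = c' := hxy
  have hee : e ≠ e' := fun h => hne (by rw [h])
  obtain ⟨C, hC, hC0, h1, -, h3⟩ := hG.exists_cycle hE hx hy hee
  refine ⟨C, hC, hC0, fun f hf heq => ?_⟩
  have hstep := (hf _ hx).1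
  rw [h1] at hstep
  -- From the corner after `e`, the colour is constant until `e` or `e'` is met. Equal colours at
  -- `x` and `y` would contradict the change at `e`.
  obtain ⟨z, hz⟩ := exists_first (A := {(c, e), (c, e')}) (hσ.support_finite hfin)
    (Perm.sameCycle_apply_left.2 (.refl σ (c, e))) (Or.inl rfl)
  have hfz := hf.eq_of_first_at hσ (x := c) (fun a ha hn => h3 a ha
    (fun h => hn (Or.inl (by rw [h]))) (fun h => hn (Or.inr (by rw [h]; rfl))))
    (hσ.mem hx) (hσ.fst _) hz
  rw [hstep] at hfz
  rcases hz.mem with rfl | rfl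
  · exact one_ne_zero (left_eq_add.1 hfz.symm)
  · rw [← heq] at hfz
    exact one_ne_zero (left_eq_add.1 hfz.symm)

/-- In a 2-connected graph, bridges that are attached at the centre are attached at the surface. -/
theorem TwoConnected.exists_attachment (hH : TwoConnected H) (hm : 0 < m) (hP : P.graph ≤ H)
    {e : β} (he : H.Inc e P.centre) :
    ∃ t e', H.Inc e' (P.surface t) ∧ SameBridge P.graph H e e' := by
  obtain ⟨y, hy⟩ := he
  have hyc : y ≠ P.centre := fun h => hH.loopless.not_isLoopAt e _ (by rw [h] at hy; exact hy)
  by_cases hyP : y ∈ P.graph.vertexSet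
  · rcases hyP with rfl | ⟨t, rfl⟩
    · exact absurd rfl hyc
    · exact ⟨t, e, hy.inc_right, .refl⟩
  · have hmem : ∀ {z}, z ∈ (H.deleteVerts {P.centre}).vertexSet ↔
        z ∈ H.vertexSet ∧ z ≠ P.centre := by
      intro z
      rw [Graph.vertexSet_deleteVerts]
      rfl
    have key := connected_induction (hH.connected_delete P.centre hy.left_mem) (x := y)
      (p := fun z => (z ∉ P.graph.vertexSet ∧ ∃ e', H.Inc e' z ∧ SameBridge P.graph H e e') ∨
        ∃ t e', H.Inc e' (P.surface t) ∧ SameBridge P.graph H e e')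
      (hmem.2 ⟨hy.right_mem, hyc⟩) (Or.inl ⟨hyP, e, hy.inc_right, .refl⟩)
      (by
        rintro a x z hxz (⟨hx, e', he', hs⟩ | hr)
        · have hxz' := hxz.mono Graph.deleteVerts_le
          have hs' := hs.trans (sameBridge_of_inc hx he' hxz'.inc_left)
          by_cases hz : z ∈ P.graph.vertexSet
          · rcases hz with rfl | ⟨t, rfl⟩
            · exact absurd rfl (hmem.1 hxz.right_mem).2
            · exact Or.inr ⟨t, a, hxz'.inc_right, hs'⟩
          · exact Or.inl ⟨hz, a, hxz'.inc_right, hs'⟩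
        · exact Or.inr hr)
      (P.surface ⟨0, by omega⟩)
      (hmem.2 ⟨hP.vertexSet_mono (P.surface_mem _), P.surface_ne_centre _⟩)
    rcases key with ⟨h, -⟩ | h
    · exact absurd (P.surface_mem _) h
    · exact h

theorem IsColouring.restrict {C : β → ZMod 2} {f : α × β → ZMod 2} (hf : IsColouring U τ C f)
    (hτ : IsRotation U τ) (hGU : G ≤ U) (hC : ∀ e ∉ G.edgeSet, C e = 0)
    (hret : ReturnsTo τ (darts G) σ) : IsColouring G σ C f := fun d hd =>
  ⟨hf.apply_returnsTo hτ hGU hC hret hd, by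
    rw [flip_eq_of_le hGU hd]
    exact (hf d (darts_mono hGU hd)).2⟩

/-- The corner of `G` at the centre that contains a given edge of `H` is determined. -/
theorem Fits.first_eq (h : Fits P I J G H U σ π S) (hG : TwoConnected G) (hH : TwoConnected H)
    (hτ : IsRotation U τ) (hτG : ReturnsTo τ (darts G) σ) (hτH : ReturnsTo τ (darts H) π)
    (hτp : Planar U τ) (hτ' : IsRotation U τ') (hτG' : ReturnsTo τ' (darts G) σ)
    (hτH' : ReturnsTo τ' (darts H) π) (hτp' : Planar U τ') {d x x' : α × β} (hd : d ∈ darts H)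
    (hdG : d ∉ darts G) (hdc : d.1 = P.centre) (hx : First τ (darts G) d x)
    (hx' : First τ' (darts G) d x') : x = x' := by
  by_contra hne
  have hm := h.left.pos
  have hPH := h.right.planet_le
  have hPG := h.left.planet_le
  -- If the two corners differ, a cycle of `G` separates them; but the bridge of `H` cannot cross
  -- this cycle, and its attachment on the surface lies in the same corner `p` for both embeddings.
  obtain ⟨C, hC, hC0, hsep⟩ := hG.exists_separating h.left.finite_edge h.left.finite_darts
    h.left.rotation hx.mem hx'.mem ((hx.fst hτ).trans (hx'.fst hτ').symm) hne
  have hCU : ∀ v ∈ U.vertexSet, bd U C v = 0 := fun v _ => by rw [bd_mono h.le_left hC0, hC]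
  have hdU : d ∈ darts U := darts_mono h.le_right hd
  have hdE : d.2 ∉ G.edgeSet := notMem_edgeSet_of_notMem_darts h.le_left hdU hdG
  obtain ⟨t, e', he', hs⟩ := hH.exists_attachment hm hPH (e := d.2) (by rw [← hdc]; exact hd)
  have heP : e' ∉ P.graph.edgeSet := hs.notMem_edgeSet hPH fun hP => hdE (hPG.edgeSet_mono hP)
  have htI : t ∉ I := fun hI => h.disjoint t hI (h.right_attach t e' he' heP)
  have hs' : SameBridge G U d.2 e' := by
    refine Relation.ReflTransGen.mono (fun a b => ?_) _ _ hs
    rintro ⟨v, hv, h1, h2⟩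
    exact ⟨v, fun hvG => hv (h.vertex_inter v hvG h1.vertex_mem), h1.mono h.le_right,
      h2.mono h.le_right⟩
  obtain ⟨p, hp⟩ := exists_first_planet hm h.right.rotation h.right.finite_darts hPH
    (d := (P.surface t, e')) he' (P.surface_mem t)
  have hCd : ∀ d ∈ darts U, d ∉ darts G → C d.2 = 0 := fun d hd hd' =>
    hC0 _ (notMem_edgeSet_of_notMem_darts h.le_left hd hd')
  have key : ∀ {τ : Perm (α × β)} {f x}, IsRotation U τ → ReturnsTo τ (darts H) π →
      IsColouring U τ C f → First τ (darts G) d x → f x = f p := by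
    intro τ f x hτ hτH hf hx
    rw [← hf.eq_of_first hτ hCd hdU hx, ← hf.eq_of_first hτ hCd (he'.mono h.le_right)
      (h.first_left hτ htI rfl (hτH.trans_first (darts_mono hPH) he' hp))]
    exact hf.eq_of_sameBridge hτ h.finite_darts h.le_left hC0 hs' hdE hdU (he'.mono h.le_right)
  obtain ⟨f, hf⟩ := hτp C hCU
  obtain ⟨f', hf'⟩ := hτp' C hCU
  have hfx := key hτ hτH hf hx
  have hfx' := key hτ' hτH' hf' hx'
  have hfG := hf.restrict hτ h.le_left hC0 hτG
  have hfG' := hf'.restrict hτ' h.le_left hC0 hτG'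
  -- The two colourings restrict to the same rotation `σ` of `G`, so they differ by a constant, and
  -- the comparison can be made in `f'` alone.
  have hu := hfG.unique h.left.rotation h.left.finite_darts h.left.connected hfG' hx.mem
    (darts_mono hPG hp.mem)
  rw [hfx] at hu
  exact hsep f' hfG' ((add_left_cancel hu).trans hfx'.symm)

/-- At every vertex other than the centre, all darts of the union come from one of the two graphs,
which prescribes the rotation. At the centre, the rigidity of merges applies. -/
theorem Fits.unique (h : Fits P I J G H U σ π S) (hG : TwoConnected G) (hH : TwoConnected H)
    (hτ : IsRotation U τ) (hτG : ReturnsTo τ (darts G) σ) (hτH : ReturnsTo τ (darts H) π)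
    (hτp : Planar U τ) (hτ' : IsRotation U τ') (hτG' : ReturnsTo τ' (darts G) σ)
    (hτH' : ReturnsTo τ' (darts H) π) (hτp' : Planar U τ') : τ = τ' := by
  have hm := h.left.pos
  have hPH := h.right.planet_le
  have hPG := h.left.planet_le
  have hfin := h.finite_darts
  ext1 d
  by_cases hd : d ∈ darts U
  swap
  · rw [hτ.of_not_inc d hd, hτ'.of_not_inc d hd]
  by_cases hc : d.1 = P.centre
  · have hp : (P.centre, P.spoke ⟨0, by omega⟩) ∈ darts P.graph := P.centre_dart _
    have hagree : AgreeOn {d | d ∈ darts U ∧ d.1 = P.centre} (darts G) (darts H) σ π τ τ' :=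
      { finite := hτ.support_finite hfin
        finite' := hτ'.support_finite hfin
        mem_or := fun z hz => (h.inc_iff _ _).1 hz.1
        maps := fun z hz => ⟨hτ.mem hz.1, (hτ.fst z).trans hz.2⟩
        maps' := fun z hz => ⟨hτ'.mem hz.1, (hτ'.fst z).trans hz.2⟩
        common := by
          refine ⟨_, ⟨darts_mono hPG hp, darts_mono hPH hp⟩, ?_⟩
          rintro ⟨x, e⟩ ⟨hz, rfl⟩
          have hp' := darts_mono h.le_left (darts_mono hPG hp)
          exact ⟨hτ.sameCycle _ _ _ hz hp', hτ'.sameCycle _ _ _ hz hp'⟩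
        left := hτG
        left' := hτG'
        right := hτH
        right' := hτH'
        first_left := fun z hz hn x x' hx hx' =>
          h.first_eq hG hH hτ hτG hτH hτp hτ' hτG' hτH' hτp'
            (((h.inc_iff _ _).1 hz.1).resolve_left hn) hn hz.2 hx hx'
        first_right := fun z hz hn x x' hx hx' =>
          h.symm.first_eq hH hG hτ hτH hτG hτp hτ' hτH' hτG' hτp'
            (((h.inc_iff _ _).1 hz.1).resolve_right hn) hn hz.2 hx hx' }
    exact hagree.eq ⟨hd, hc⟩
  · have hcases : (∀ e, U.Inc e d.1 → G.Inc e d.1) ∨ ∀ e, U.Inc e d.1 → H.Inc e d.1 := by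
      by_cases hdP : d.1 ∈ P.graph.vertexSet
      · rcases hdP with hdc | ⟨t, ht⟩
        · exact absurd hdc hc
        · rw [← ht]
          by_cases htI : t ∈ I
          · left
            intro e he
            refine ((h.inc_iff _ _).1 he).elim id fun he => ?_
            by_cases heP : e ∈ P.graph.edgeSet
            · exact ((Graph.IsSubgraph.inc_congr hPH heP).2 he).mono hPG
            · exact absurd (h.right_attach t e he heP) (h.disjoint t htI)
          · right
            intro e he
            refine ((h.inc_iff _ _).1 he).elim (fun he => ?_) id
            by_cases heP : e ∈ P.graph.edgeSet
            · exact ((Graph.IsSubgraph.inc_congr hPG heP).2 he).mono hPH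
            · exact absurd (h.left_attach t e he heP) htI
      · by_cases hdG : d.1 ∈ G.vertexSet
        · left
          intro e he
          exact ((h.inc_iff _ _).1 he).resolve_right fun he =>
            hdP (h.vertex_inter _ hdG he.vertex_mem)
        · right
          intro e he
          exact ((h.inc_iff _ _).1 he).resolve_left fun he => hdG he.vertex_mem
    have hmem : ∀ {K : Graph α β} {τ : Perm (α × β)}, (∀ e, U.Inc e d.1 → K.Inc e d.1) →
        IsRotation U τ → τ d ∈ darts K := by
      intro K τ hK hτ
      have := hτ.mem hd
      rw [mem_darts, hτ.fst] at this ⊢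
      exact hK _ this
    rcases hcases with hK | hK
    · rw [(hτG d (hK _ hd)).eq_of_mem (hmem hK hτ), (hτG' d (hK _ hd)).eq_of_mem (hmem hK hτ')]
    · rw [(hτH d (hK _ hd)).eq_of_mem (hmem hK hτ), (hτH' d (hK _ hd)).eq_of_mem (hmem hK hτ')]

end Unique

/-! ### Unions of graphs that share a planet -/

section Unify

variable {α : Type*} {β : Type*} {m : ℕ} {P : Planet α β m} {G H : Graph α β}
  {I J : Set (Fin (4 * m))}

/-- The hypotheses on two graphs that share the planet `P` under which they are unifiable. -/
structure Compatible (P : Planet α β m) (I J : Set (Fin (4 * m))) (G H : Graph α β) : Prop where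
  pos : 0 < m
  le_left : P.graph ≤ G
  le_right : P.graph ≤ H
  left : TwoConnected G
  right : TwoConnected H
  left_finite : G.vertexSet.Finite ∧ G.edgeSet.Finite
  right_finite : H.vertexSet.Finite ∧ H.edgeSet.Finite
  vertex_inter : G.vertexSet ∩ H.vertexSet = P.graph.vertexSet
  edge_inter : G.edgeSet ∩ H.edgeSet = P.graph.edgeSet
  left_attach : ∀ t e, G.Inc e (P.surface t) → e ∉ P.graph.edgeSet → t ∈ I
  right_attach : ∀ t e, H.Inc e (P.surface t) → e ∉ P.graph.edgeSet → t ∈ J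
  disjoint : ∀ t, t ∈ I → t ∉ J
  noncrossing : ∀ t j k l, 0 < j → j < k → k < l → l < 4 * m →
    Joins P G (nxt^[j] t) (nxt^[l] t) → ¬ Joins P H t (nxt^[k] t)

theorem left_le_union : G ≤ union G H := ⟨fun _ hx => Or.inl hx, fun _ _ _ h => Or.inl h⟩

theorem Compatible.right_le_union (h : Compatible P I J G H) : H ≤ union G H := by
  refine ⟨fun _ hx => Or.inr hx, fun e x y hxy => ?_⟩
  by_cases he : e ∈ G.edgeSet
  · have hP : e ∈ P.graph.edgeSet := h.edge_inter ▸ ⟨he, hxy.edge_mem⟩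
    exact Or.inl (((Graph.IsSubgraph.isLink_iff h.le_right hP).2 hxy).mono h.le_left)
  · exact Or.inr ⟨he, hxy⟩

theorem Compatible.inc_union (h : Compatible P I J G H) (e : β) (x : α) :
    (union G H).Inc e x ↔ G.Inc e x ∨ H.Inc e x := by
  constructor
  · rintro ⟨y, hy | hy⟩
    · exact Or.inl ⟨y, hy⟩
    · exact Or.inr ⟨y, hy.2⟩
  · rintro (he | he)
    · exact he.mono left_le_union
    · exact he.mono h.right_le_union

theorem Compatible.loopless_union (h : Compatible P I J G H) : (union G H).Loopless := by
  refine ⟨fun e x hx => ?_⟩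
  rcases hx with hx | hx
  · exact h.left.loopless.not_isLoopAt e x hx
  · exact h.right.loopless.not_isLoopAt e x hx.2

theorem Compatible.connected_union (h : Compatible P I J G H) :
    (union G H).toSimpleGraph.Connected := by
  have hloop := h.loopless_union
  have hc : P.centre ∈ (union G H).vertexSet := Or.inl (h.le_left.vertexSet_mono P.centre_mem)
  have key : ∀ {K : Graph α β}, K ≤ union G H → K.toSimpleGraph.Connected →
      P.centre ∈ K.vertexSet → ∀ x ∈ K.vertexSet, ∃ hx : x ∈ (union G H).vertexSet,
        (union G H).toSimpleGraph.Reachable ⟨P.centre, hc⟩ ⟨x, hx⟩ := by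
    intro K hK hconn hcK
    refine connected_induction hconn hcK ⟨hc, .refl _⟩ ?_
    rintro e x y hxy ⟨hx, hr⟩
    have hxy' := hxy.mono hK
    refine ⟨hxy'.right_mem, hr.trans (SimpleGraph.Adj.reachable ⟨fun he => ?_, e, hxy'⟩)⟩
    have he' : x = y := congrArg Subtype.val he
    rw [← he'] at hxy'
    exact hloop.not_isLoopAt e x hxy'
  have hall : ∀ x : (union G H).vertexSet,
      (union G H).toSimpleGraph.Reachable ⟨P.centre, hc⟩ x := by
    rintro ⟨x, hx | hx⟩
    · exact (key left_le_union h.left.connected (h.le_left.vertexSet_mono P.centre_mem) x hx).2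
    · exact (key h.right_le_union h.right.connected
        (h.le_right.vertexSet_mono P.centre_mem) x hx).2
  exact { preconnected := fun x y => (hall x).symm.trans (hall y), nonempty := ⟨⟨_, hc⟩⟩ }

theorem Embedding.isPlanarRotation (hm : 0 < m) (hP : P.graph ≤ G) (hG : TwoConnected G)
    (hfin : G.vertexSet.Finite ∧ G.edgeSet.Finite) (σ : Embedding G) :
    IsPlanarRotation P G σ.rot where
  pos := hm
  planet_le := hP
  finite_vertex := hfin.1
  finite_edge := hfin.2
  loopless := hG.loopless
  connected := hG.connected
  rotation := σ.isRotation
  planar := (euler_iff_planar hfin.1 hfin.2 hG.loopless hG.connected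
    ⟨_, hP.edgeSet_mono (P.spoke_mem ⟨0, by omega⟩)⟩ σ.isRotation).1 σ.euler

theorem Embedding.exists_oriented (hm : 0 < m) (hP : P.graph ≤ G) (hG : TwoConnected G)
    (hfin : G.vertexSet.Finite ∧ G.edgeSet.Finite) (σ : Embedding G) :
    ∃ σ' S : Perm (α × β), (σ' = σ.rot ∨ σ' = σ.rot⁻¹) ∧ IsPlanarRotation P G σ' ∧
      (∀ d ∉ darts P.graph, S d = d) ∧ WheelRotation P S ∧ ReturnsTo σ' (darts P.graph) S := by
  have h := σ.isPlanarRotation hm hP hG hfin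
  obtain ⟨S, hS, hW, hret | hret⟩ := h.exists_wheelRotation
  · exact ⟨_, S, Or.inl rfl, h, hS, hW, hret⟩
  · exact ⟨_, S, Or.inr rfl, h.inv, hS, hW, hret⟩

theorem Embedding.induces_of_returnsTo {K : Graph α β} {τ : Embedding K} {σ : Embedding G}
    {σ' : Perm (α × β)} (hσ : σ' = σ.rot ∨ σ' = σ.rot⁻¹)
    (h : ReturnsTo τ.rot (darts G) σ') : τ.Induces σ := by
  rcases hσ with rfl | rfl
  · exact Or.inl ((restricts_iff_returnsTo σ.rot_of_not_inc).2 h)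
  · have := h.inv σ.isRotation.inv.of_not_inc
    rw [inv_inv] at this
    exact Or.inr ((restricts_iff_returnsTo σ.rot_of_not_inc).2 this)

theorem Embedding.Induces.returnsTo {K : Graph α β} {τ : Embedding K} {σ : Embedding G}
    {σ' : Perm (α × β)} (hσ : σ' = σ.rot ∨ σ' = σ.rot⁻¹) (h : τ.Induces σ) :
    ReturnsTo τ.rot (darts G) σ' ∨ ReturnsTo τ.rot⁻¹ (darts G) σ' := by
  rcases h with h | h
  · have h' := (restricts_iff_returnsTo σ.rot_of_not_inc).1 h
    rcases hσ with rfl | rfl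
    · exact Or.inl h'
    · exact Or.inr (h'.inv σ.rot_of_not_inc)
  · have h' := (restricts_iff_returnsTo σ.rot_of_not_inc).1 h
    rcases hσ with rfl | rfl
    · exact Or.inr h'
    · have := h'.inv σ.rot_of_not_inc
      rw [inv_inv] at this
      exact Or.inl this

/-- The standard rotation of a planet differs from its inverse. -/
theorem WheelRotation.false_of_inv {S T : Perm (α × β)} (hm : 0 < m) (hW : WheelRotation P S)
    (hS : ∀ d ∉ darts P.graph, S d = d) (h : ReturnsTo T (darts P.graph) S)
    (h' : ReturnsTo T⁻¹ (darts P.graph) S) : False := by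
  have h1 := (h.inv hS).eq h' (fun d hd => Perm.inv_eq_iff_eq.2 (hS d hd).symm) hS
  let t : Fin (4 * m) := ⟨0, by omega⟩
  have h2 : S⁻¹ (P.centre, P.spoke (nxt t)) = (P.centre, P.spoke t) :=
    Perm.inv_eq_iff_eq.2 (hW.centre t).symm
  rw [h1, hW.centre] at h2
  exact nxt_nxt_ne (by omega) t (P.spoke_injective (congrArg Prod.snd h2))

/-- Both embeddings are oriented so as to induce the standard rotation of the planet;
`WheelRotation.eq` makes the two copies of it equal, and the merge applies. -/
theorem Compatible.unifiable (h : Compatible P I J G H) : Unifiable G H := by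
  intro σ π
  obtain ⟨σ', S, hσ, hσ', hS, hW, hret⟩ := σ.exists_oriented h.pos h.le_left h.left h.left_finite
  obtain ⟨π', S', hπ, hπ', hS', hW', hret'⟩ :=
    π.exists_oriented h.pos h.le_right h.right h.right_finite
  obtain rfl := hW.eq hW' hS hS'
  have hfits : Fits P I J G H (union G H) σ' π' S :=
    { left := hσ'
      right := hπ'
      wheel := hW
      wheel_off := hS
      left_returns := hret
      right_returns := hret'
      le_left := left_le_union
      le_right := h.right_le_union
      vertexSet_eq := rfl
      inc_iff := h.inc_union
      vertex_inter := fun x h1 h2 => h.vertex_inter ▸ ⟨h1, h2⟩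
      edge_inter := fun e h1 h2 => h.edge_inter ▸ ⟨h1, h2⟩
      left_attach := h.left_attach
      right_attach := h.right_attach
      disjoint := h.disjoint
      noncrossing := h.noncrossing }
  have hEU : ∀ {R}, IsRotation (union G H) R →
      ((union G H).vertexSet.ncard + (faces (union G H) R).ncard = (union G H).edgeSet.ncard + 2 ↔
        Planar (union G H) R) := fun hR =>
    euler_iff_planar (h.left_finite.1.union h.right_finite.1)
      (h.left_finite.2.union h.right_finite.2) h.loopless_union h.connected_union
      ⟨_, Or.inl (h.le_left.edgeSet_mono (P.spoke_mem ⟨0, by have := h.pos; omega⟩))⟩ hR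
  obtain ⟨τ, hτ, hτG, hτH, hτp⟩ := hfits.exists_union
  refine ⟨⟨τ, hτ.of_not_inc, hτ.fst, hτ.sameCycle, (hEU hτ).2 hτp⟩,
    ⟨Embedding.induces_of_returnsTo hσ hτG, Embedding.induces_of_returnsTo hπ hτH⟩, ?_⟩
  rintro τ' ⟨hG, hH⟩
  have hrot := τ'.isRotation
  have hp := (hEU hrot).1 τ'.euler
  have hPG := darts_mono h.le_left
  have hPH := darts_mono h.le_right
  -- A competing embedding may induce either graph up to reversal. Both graphs contain the planet,
  -- whose rotation is not its own inverse, so both are reversed or neither is.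
  rcases hG.returnsTo hσ with hG | hG <;> rcases hH.returnsTo hπ with hH | hH
  · exact Or.inl (hfits.unique h.left h.right hrot hG hH hp hτ hτG hτH hτp)
  · exact (hW.false_of_inv h.pos hS (hG.trans hPG hret) (hH.trans hPH hret')).elim
  · exact (hW.false_of_inv h.pos hS (hH.trans hPH hret') (hG.trans hPG hret)).elim
  · refine Or.inr ?_
    rw [← inv_inv τ'.rot]
    exact congrArg _
      (hfits.unique h.left h.right hrot.inv hG hH (hp.inv hrot) hτ hτG hτH hτp)

end Unify

/-! ### Arches -/

section Arch

variable {α : Type*} {β : Type*} {m n : ℕ} {P : Planet α β m}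

/-- Consecutive edges of the chain meet outside `Q`, so only the two ends of the concatenated walk
can be in `Q`. -/
theorem SameBridge.exists_walk {Q H : Graph α β} {e e' : β} (h : SameBridge Q H e e')
    {x x' : α} (hx : H.Inc e x) (hx' : H.Inc e' x') :
    ∃ w : H.toSimpleGraph.Walk ⟨x, hx.vertex_mem⟩ ⟨x', hx'.vertex_mem⟩,
      ∀ z ∈ w.support, z.1 ∈ Q.vertexSet → z.1 = x ∨ z.1 = x' := by
  have hedge : ∀ {e x y}, (hx : H.Inc e x) → (hy : H.Inc e y) →
      ∃ w : H.toSimpleGraph.Walk ⟨x, hx.vertex_mem⟩ ⟨y, hy.vertex_mem⟩,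
        ∀ z ∈ w.support, z.1 = x ∨ z.1 = y := by
    intro e x y hx hy
    by_cases hxy : x = y
    · subst hxy
      refine ⟨.nil, fun z hz => ?_⟩
      rw [SimpleGraph.Walk.support_nil, List.mem_singleton] at hz
      exact Or.inl (congrArg Subtype.val hz)
    · obtain ⟨z, hz⟩ := id hx
      have hzy : y = z := (hy.eq_or_eq_of_isLink hz).resolve_left fun h => hxy h.symm
      subst hzy
      have hadj : H.toSimpleGraph.Adj ⟨x, hx.vertex_mem⟩ ⟨y, hy.vertex_mem⟩ :=
        ⟨fun h => hxy (congrArg Subtype.val h), e, hz⟩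
      refine ⟨.cons hadj .nil, fun z hz => ?_⟩
      rw [SimpleGraph.Walk.support_cons, SimpleGraph.Walk.support_nil, List.mem_cons,
        List.mem_singleton] at hz
      exact hz.imp (congrArg Subtype.val) (congrArg Subtype.val)
  induction h generalizing x' with
  | refl =>
    obtain ⟨w, hw⟩ := hedge hx hx'
    exact ⟨w, fun z hz _ => hw z hz⟩
  | tail _ h ih =>
    obtain ⟨v, hv, h1, h2⟩ := h
    obtain ⟨w, hw⟩ := ih h1
    obtain ⟨w', hw'⟩ := hedge h2 hx'
    refine ⟨w.append w', fun z hz hzQ => ?_⟩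
    rcases (SimpleGraph.Walk.mem_support_append_iff _ _).1 hz with hz | hz
    · exact Or.inl ((hw z hz hzQ).resolve_right fun h => hv (h ▸ hzQ))
    · exact Or.inr ((hw' z hz).resolve_left fun h => hv (h ▸ hzQ))

theorem Joins.isArch {I : Set (Fin m)} {𝒢 : HybridDeletionSequence α β n} {k : Fin (n + 1)}
    {t u : Fin (4 * m)} (h : Joins P (𝒢.graph k) t u) {i j : Fin m}
    (hi : i ∈ I) (hj : j ∈ I) (hij : i ≠ j) (ht : t ∈ foundation i) (hu : u ∈ foundation j) :
    IsArch P I 𝒢 i j := by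
  classical
  obtain ⟨e, e', -, hs, h1, h2⟩ := h
  obtain ⟨w, hw⟩ := hs.exists_walk h1 h2
  refine ⟨hi, hj, hij, k, _, _, w.bypass, w.bypass_isPath, ⟨t, ht, rfl⟩, ⟨u, hu, rfl⟩,
    fun z hz hzP => ?_⟩
  exact (hw z (w.support_bypass_subset_support hz) hzP).imp Subtype.ext Subtype.ext

theorem div_of_mem_foundation {i : Fin m} {t : Fin (4 * m)} (h : t ∈ foundation i) :
    (t : ℕ) / 4 = i := by
  obtain ⟨r, rfl⟩ := h
  have : ((site i r : Fin (4 * m)) : ℕ) = 4 * i + r := rfl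
  omega

theorem sbtw_iff {a b c : Fin m} :
    sbtw a b c ↔ a < b ∧ b < c ∨ b < c ∧ c < a ∨ c < a ∧ a < b := Iff.rfl

/-- Positions met in cyclic order on the rim have foundations in weak cyclic order on the equator.
The inequalities between foundations of different graphs make this order strict. -/
theorem cross_of_iterate {t : Fin (4 * m)} {j k l : ℕ} (hj : 0 < j) (hjk : j < k) (hkl : k < l)
    (hl : l < 4 * m) {a b c d : Fin m} (ha : nxt^[j] t ∈ foundation a)
    (hb : nxt^[l] t ∈ foundation b) (hc : t ∈ foundation c) (hd : nxt^[k] t ∈ foundation d)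
    (hac : a ≠ c) (had : a ≠ d) (hbc : b ≠ c) (hbd : b ≠ d) :
    a ≠ b ∧ c ≠ d ∧ Cross a b c d := by
  have hmod : ∀ i < 4 * m, ((nxt^[i] t : Fin (4 * m)) : ℕ) = t + i ∨
      ((nxt^[i] t : Fin (4 * m)) : ℕ) + 4 * m = t + i := by
    intro i hi
    have ht := t.isLt
    rw [val_iterate_nxt]
    rcases lt_or_ge (t + i : ℕ) (4 * m) with h | h
    · exact Or.inl (Nat.mod_eq_of_lt h)
    · rw [Nat.mod_eq_sub_mod h, Nat.mod_eq_of_lt (by omega)]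
      omega
  have h1 := div_of_mem_foundation ha
  have h2 := div_of_mem_foundation hb
  have h3 := div_of_mem_foundation hc
  have h4 := div_of_mem_foundation hd
  have k1 := hmod j (by omega)
  have k2 := hmod l hl
  have k3 := hmod k (by omega)
  have l1 := (nxt^[j] t).isLt
  have l2 := (nxt^[l] t).isLt
  have l3 := (nxt^[k] t).isLt
  rw [Ne, Fin.ext_iff] at hac had hbc hbd
  have key : (c < a ∧ a < d ∧ d < b) ∨ (a < d ∧ d < b ∧ b < c) ∨ (d < b ∧ b < c ∧ c < a) ∨
      (b < c ∧ c < a ∧ a < d) := by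
    simp only [Fin.lt_def]
    clear hmod ha hb hc hd
    generalize ((nxt^[j] t : Fin (4 * m)) : ℕ) = x at *
    generalize ((nxt^[k] t : Fin (4 * m)) : ℕ) = y at *
    generalize ((nxt^[l] t : Fin (4 * m)) : ℕ) = z at *
    -- Once one of the successive positions has passed the end of the index range, all later ones
    -- have too, which leaves four possible linear orders.
    rcases k2 with k2 | k2
    · exact Or.inl (by omega)
    rcases k3 with k3 | k3
    · exact Or.inr (Or.inr (Or.inr (by omega)))
    rcases k1 with k1 | k1
    · exact Or.inr (Or.inr (Or.inl (by omega)))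
    · exact Or.inr (Or.inl (by omega))
  rw [Cross, sbtw_iff, sbtw_iff, sbtw_iff, sbtw_iff]
  simp only [Ne, Fin.ext_iff, Fin.lt_def] at key ⊢
  clear hmod ha hb hc hd h1 h2 h3 h4 k1 k2 k3 l1 l2 l3
  rcases key with h | h | h | h <;> exact ⟨by omega, by omega, Or.inr ⟨by omega, by omega⟩⟩

/-- For equator 0 the village is a single vertex, which is not 2-connected. -/
theorem IsHousingSequence.pos {I : Set (Fin m)} {𝒢 : HybridDeletionSequence α β n}
    (h : IsHousingSequence P I 𝒢) : 0 < m := by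
  rcases Nat.eq_zero_or_pos m with rfl | hm
  · exfalso
    obtain ⟨f, _, g, _, hf, _⟩ := h.first_last
    have hsub : (𝒢.graph 0).vertexSet ⊆ {f .centre} := by
      intro x hx
      obtain ⟨v, -, rfl⟩ := hf.bijOn_vertex.surjOn hx
      rcases v with _ | k | ⟨i, _⟩
      · rfl
      · exact k.elim0
      · exact i.elim0
    have h1 := (h.twoConnected 0).three_le.trans (encard_le_encard hsub)
    rw [encard_singleton] at h1
    exact absurd h1 (by decide)
  · exact hm

end Arch

end Housing

theorem mainTheorem6 {α : Type*} {β : Type*} {m n : ℕ} (P : Housing.Planet α β m)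
    (I J : Set (Fin m)) (𝒢 ℋ : Housing.HybridDeletionSequence α β n)
    (h𝒢 : Housing.IsHousingSequence P I 𝒢) (hℋ : Housing.IsHousingSequence P J ℋ)
    (h𝒢_att : Housing.AttachesAtFoundations P I 𝒢)
    (hℋ_att : Housing.AttachesAtFoundations P J ℋ)
    (h_vertex : ∀ k, (𝒢.graph k).vertexSet ∩ (ℋ.graph k).vertexSet = P.graph.vertexSet)
    (h_edge : ∀ k, (𝒢.graph k).edgeSet ∩ (ℋ.graph k).edgeSet = P.graph.edgeSet)
    (hIJ : Disjoint I J) (hweak : Disjoint 𝒢.weak ℋ.weak)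
    (harch : ∀ i j i' j' : Fin m, Housing.IsArch P I 𝒢 i j → Housing.IsArch P J ℋ i' j' →
      ¬ Housing.Cross i j i' j') :
    Housing.UnifiableSeq 𝒢 ℋ := by
  have hne : ∀ {i j : Fin m}, i ∈ I → j ∈ J → i ≠ j := fun hi hj h =>
    Set.disjoint_left.1 hIJ hi (h ▸ hj)
  refine ⟨fun k => Housing.Compatible.unifiable (P := P)
    (I := {t | ∃ i ∈ I, t ∈ Housing.foundation i}) (J := {t | ∃ i ∈ J, t ∈ Housing.foundation i})
    { pos := h𝒢.pos
      le_left := h𝒢.planet_le k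
      le_right := hℋ.planet_le k
      left := h𝒢.twoConnected k
      right := hℋ.twoConnected k
      left_finite := ⟨𝒢.finite_vertex k, 𝒢.finite_edge k⟩
      right_finite := ⟨ℋ.finite_vertex k, ℋ.finite_edge k⟩
      vertex_inter := h_vertex k
      edge_inter := h_edge k
      left_attach := fun t e => h𝒢_att k e t
      right_attach := fun t e => hℋ_att k e t
      disjoint := ?_
      noncrossing := ?_ }, hweak⟩
  · rintro t ⟨i, hi, hti⟩ ⟨j, hj, htj⟩
    exact hne hi hj
      (Fin.ext ((Housing.div_of_mem_foundation hti).symm.trans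
        (Housing.div_of_mem_foundation htj)))
  -- The four attachments of two crossing bridges lie in foundations with indices in `I` or `J`,
  -- which turns the bridges into crossing arches.
  · intro t j l r hj hjl hlr hr hG hH
    have hG' := hG
    have hH' := hH
    obtain ⟨e, e', he, hs, h1, h2⟩ := hG
    obtain ⟨e₁, e₁', he₁, hs₁, h3, h4⟩ := hH
    obtain ⟨a, ha, hja⟩ := h𝒢_att k e _ h1 he
    obtain ⟨b, hb, hlb⟩ := h𝒢_att k e' _ h2 (hs.notMem_edgeSet (h𝒢.planet_le k) he)
    obtain ⟨c, hc, htc⟩ := hℋ_att k e₁ _ h3 he₁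
    obtain ⟨d, hd, hrd⟩ := hℋ_att k e₁' _ h4 (hs₁.notMem_edgeSet (hℋ.planet_le k) he₁)
    obtain ⟨hab, hcd, hcross⟩ := Housing.cross_of_iterate hj hjl hlr hr hja hlb htc hrd (hne ha hc)
      (hne ha hd) (hne hb hc) (hne hb hd)
    exact harch a b c d (hG'.isArch ha hb hab hja hlb)
      (hH'.isArch hc hd hcd htc hrd) hcross
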